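/- **Setting.** There are $n\ge 2$ nodes. A *distributed problem* consists of a dimension $d\ge1$, an initial point $x^0\in\mathbb R^d$, a set $\mathcal H$ of honest nodes, distributions $\mathcal D_i$ on some $\mathbb R^q$, and a Borel function $F:\mathbb R^d\times\mathbb R^q\to\mathbb R$; the objective is $f=\frac1{|\mathcal H|}\sum_{i\in\mathcal H}f_i$ with $f_i(x)=\mathbb E_{\xi\sim\mathcal D_i}[F(x,\xi)]$. Write $f\in\mathcal F_{L,\zeta^2}$ if $f$ is $C^1$, every $f_i$ ($i\in\mathcal H$) is bounded below with $L$-Lipschitz gradient, and $\frac1{|\mathcal H|}\sum_{i\in\mathcal H}\|\nabla f_i(x)-\nabla f(x)\|^2\le\zeta^2$ for all $x$. The oracle, which returns $\nabla F(x,\xi)$ with $\xi\sim\mathcal D_i$, is in $\mathcal O_{\sigma^2}$ if $F(\cdot,\xi)$ is $C^1$ for every $\xi$ and, for $i\in\mathcal H$, $\mathbb E_{\xi\sim\mathcal D_i}[\nabla F(x,\xi)]=\nabla f_i(x)$ and $\mathbb E_{\xi\sim\mathcal D_i}\|\nabla F(x,\xi)-\nabla f_i(x)\|^2\le\sigma^2$.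 Let $0\le\delta\le\delta_{\max}<\frac12$ and $|\mathcal H|\ge(1-\delta)n$. A (measurable) map $\mathsf A:(\mathbb R^d)^n\to\mathbb R^d$ is a *$(\delta_{\max},\rho)$-robust aggregator* for $\mathcal H$ if $\|\mathsf A(w_1,\dots,w_n)-\bar w\|^2\le\frac{\rho\delta}{|\mathcal H|}\sum_{i\in\mathcal H}\|w_i-\bar w\|^2$ for all $w_1,\dots,w_n\in\mathbb R^d$, where $\bar w=\frac1{|\mathcal H|}\sum_{i\in\mathcal H}w_i$. **Methods.** Fix $\alpha_{\min}>0$. A method of the class $\mathcal M$ has a batch size $m\ge1$ and starts at $x^0$. In iteration $t=0,1,\dots$ it chooses query points $x^{(t,1)},\dots,x^{(t,m)}\in\mathrm{span}(x^0,\dots,x^t)$; every honest node $i$ draws fresh independent samples $\xi_i^{(t,l)}\sim\mathcal D_i$ and sends $w_i^t=\sum_{j=0}^t\sum_{l=1}^m\alpha^{(t,j,l)}\nabla F(x^{(j,l)},\xi_i^{(j,l)})$, where $\alpha^{(t,j,l)}\ge0$ and $\sum_{j,l}\alpha^{(t,j,l)}\ge\alpha_{\min}$; the other nodes send arbitrary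 vectors; and $x^{t+1}\in\mathrm{span}(x^0,\dots,x^t,w^0,\dots,w^t)$ with $w^t=\mathsf A(w_1^t,\dots,w_n^t)$. The output after $t$ iterations is some $\hat x^t\in\mathrm{span}(x^0,\dots,x^t)$. All choices may be adaptive and randomized, but never depend on samples that have not been drawn yet. An oracle query means that all honest nodes compute one stochastic gradient, so the output after $K$ queries is $\tilde x^K=\hat x^{\lfloor K/m\rfloor}$. The Byzantine error of a method is $\inf_t\mathbb E\|\nabla f(\hat x^t)\|$, and $\varepsilon_{\rm bzt}$ denotes its infimum over all methods in $\mathcal M$ on the given problem with the given aggregator. The query complexity of a method for optimization error $\epsilon$ is the least $K$ with $\mathbb E\|\nabla f(\tilde x^K)\|\le\varepsilon_{\rm bzt}+\epsilon$ (and $\infty$ if there is none). **Theorem.** (a) *Strongly convex case.* For every $\kappa_0>1$ there is a constant $c>0$, depending only on $\kappa_0$, such that the following holds for all $n\ge2$, $0\le\delta\le\delta_{\max}<\frac12$, $\rho,\sigma,\zeta\ge0$, $\mu,\epsilon,\alpha_{\min}>0$, $L\ge\kappa_0\mu$ and all $R$ with $\epsilon\le cLR$ and $\rho^{1/2}\delta^{1/2}\zeta\le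 cLR$. There are a distributed problem with $|\mathcal H|\ge(1-\delta)n$, $f\in\mathcal F_{L,\zeta^2}$, $\mu$-strongly convex $f_i$ ($i\in\mathcal H$) and $\|x^0-\arg\min f\|=R$, with its oracle in $\mathcal O_{\sigma^2}$, and a $(\delta_{\max},\rho)$-robust aggregator for $\mathcal H$, such that $\varepsilon_{\rm bzt}\ge c\,\rho^{1/2}\delta^{1/2}\zeta$ and the query complexity of every method in $\mathcal M$ for optimization error $\epsilon$ is at least $$c\left(\frac{\rho\delta\sigma^2}{\epsilon^2}+\frac{\sigma^2}{(1-\delta)n\epsilon^2}+\sqrt{\kappa}\,\log\frac{\mu R}{\epsilon}\right),\qquad\kappa=\frac L\mu .$$ (b) *Non-convex case.* There is a universal constant $c>0$ such that the following holds for all $n\ge2$, $0\le\delta\le\delta_{\max}<\frac12$, $\rho,\sigma,\zeta\ge0$, $L,\epsilon,\alpha_{\min}>0$ and all $\Delta$ with $\epsilon^2\le cL\Delta$ and $\rho\delta\zeta^2\le cL\Delta$. There are a distributed problem with $|\mathcal H|\ge(1-\delta)n$, $f\in\mathcal F_{L,\zeta^2}$, non-convex $f_i$ ($i\in\mathcal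 H$) and $f(x^0)-\inf f=\Delta$, with its oracle in $\mathcal O_{\sigma^2}$, and a $(\delta_{\max},\rho)$-robust aggregator for $\mathcal H$, such that $\varepsilon_{\rm bzt}\ge c\,\rho^{1/2}\delta^{1/2}\zeta$ and the query complexity of every method in $\mathcal M$ for optimization error $\epsilon$ is at least $$c\left(\frac{L\Delta\rho\delta\sigma^2}{\epsilon^4}+\frac{L\Delta\sigma^2}{(1-\delta)n\epsilon^4}+\frac{L\Delta}{\epsilon^2}\right).$$ -/

import Mathlib

open MeasureTheory ProbabilityTheory
open scoped ENNReal

noncomputable section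

namespace ByzOpt

/-- The Euclidean space `ℝ^d`. -/
abbrev Vec (d : ℕ) : Type := EuclideanSpace ℝ (Fin d)

/-- The average of the vectors `w i` over the honest nodes `i ∈ H`. -/
def honestMean {n d : ℕ} (H : Finset (Fin n)) (w : Fin n → Vec d) : Vec d :=
  (1 / (H.card : ℝ)) • ∑ i ∈ H, w i

/-- A distributed stochastic optimization problem with `n` nodes, together with the point at
which the methods are initialized: minimize
`f x = (1 / |H|) * ∑ i ∈ H, f_i x`, where `f_i x = 𝔼_{ξ ∼ D i} [F (x, ξ)]`. -/
structure Problem (n : ℕ) where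
  /-- the dimension of the decision variable -/
  d : ℕ
  d_pos : 0 < d
  /-- the dimension of the data -/
  q : ℕ
  /-- the loss of a decision variable on a data point -/
  F : Vec d → Vec q → ℝ
  measurable_F : Measurable (fun p : Vec d × Vec q => F p.1 p.2)
  /-- the set of honest nodes; the other nodes are Byzantine -/
  H : Finset (Fin n)
  /-- the local data distributions -/
  D : Fin n → Measure (Vec q)
  prob_D : ∀ i, IsProbabilityMeasure (D i)
  integrable_F : ∀ i ∈ H, ∀ x, Integrable (F x) (D i)
  /-- the initial point -/
  x0 : Vec d

namespace Problem

variable {n : ℕ} (P : Problem n)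

/-- The local function `f_i`. -/
def localLoss (i : Fin n) (x : Vec P.d) : ℝ := ∫ ξ, P.F x ξ ∂(P.D i)

/-- The objective `f`. -/
def loss (x : Vec P.d) : ℝ := (1 / (P.H.card : ℝ)) * ∑ i ∈ P.H, P.localLoss i x

/-- The answer `∇F(x, ξ)` of the stochastic gradient oracle. -/
def stochGrad (x : Vec P.d) (ξ : Vec P.q) : Vec P.d := gradient (fun y => P.F y ξ) x

/-- The function class: `f` is continuously differentiable, the `f_i` of the honest nodes are
bounded below and `L`-smooth, and their gradients have dissimilarity at most `ζ²`. -/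
structure InFunctionClass (L ζ : ℝ) : Prop where
  contDiff : ContDiff ℝ 1 P.loss
  bddBelow : ∀ i ∈ P.H, BddBelow (Set.range (P.localLoss i))
  differentiable : ∀ i ∈ P.H, Differentiable ℝ (P.localLoss i)
  smooth : ∀ i ∈ P.H, ∀ x y,
    ‖gradient (P.localLoss i) x - gradient (P.localLoss i) y‖ ≤ L * ‖x - y‖
  dissimilarity : ∀ x,
    (1 / (P.H.card : ℝ)) *
      ∑ i ∈ P.H, ‖gradient (P.localLoss i) x - gradient P.loss x‖ ^ 2 ≤ ζ ^ 2

/-- The oracle class: `F(·, ξ)` is continuously differentiable, and `∇F(x, ξ)` is an unbiased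
estimator of `∇f_i(x)` with variance at most `σ²` at every honest node. (The independence of the
samples is part of `MethodRun`.) -/
structure InOracleClass (σ : ℝ) : Prop where
  contDiff : ∀ ξ, ContDiff ℝ 1 (fun x => P.F x ξ)
  integrable : ∀ i ∈ P.H, ∀ x, Integrable (P.stochGrad x) (P.D i)
  unbiased : ∀ i ∈ P.H, ∀ x, ∫ ξ, P.stochGrad x ξ ∂(P.D i) = gradient (P.localLoss i) x
  variance : ∀ i ∈ P.H, ∀ x,
    ∫⁻ ξ, ‖P.stochGrad x ξ - gradient (P.localLoss i) x‖ₑ ^ 2 ∂(P.D i)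
      ≤ ENNReal.ofReal (σ ^ 2)

/-- The local functions of the honest nodes are `μ`-strongly convex. -/
def IsStronglyConvex (μ : ℝ) : Prop :=
  ∀ i ∈ P.H, ∀ x y,
    P.localLoss i x + inner ℝ (gradient (P.localLoss i) x) (y - x) + μ / 2 * ‖y - x‖ ^ 2
      ≤ P.localLoss i y

/-- The local functions of the honest nodes are non-convex. -/
def IsNonConvex : Prop := ∀ i ∈ P.H, ¬ ConvexOn ℝ Set.univ (P.localLoss i)

/-- The minimizer of `f` is at distance `R` from the initial point. -/
def HasInitialDistance (R : ℝ) : Prop :=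
  ∃ xmin, IsMinOn P.loss Set.univ xmin ∧ ‖P.x0 - xmin‖ = R

/-- `f(x⁰) - inf f = Δ`. -/
def HasInitialGap (Δ : ℝ) : Prop :=
  BddBelow (Set.range P.loss) ∧ P.loss P.x0 - ⨅ x, P.loss x = Δ

end Problem

/-- `A` is a `(δmax, ρ)`-robust aggregator for the honest set `H`, where `δ ≤ δmax` is the
estimated fraction of Byzantine nodes: whatever the messages are (in particular those of the
Byzantine nodes), the output is close to the average of the honest messages. -/
structure IsRobustAggregator {n d : ℕ} (δmax ρ δ : ℝ) (H : Finset (Fin n))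
    (A : (Fin n → Vec d) → Vec d) : Prop where
  measurable : Measurable A
  rho_nonneg : 0 ≤ ρ
  delta_nonneg : 0 ≤ δ
  delta_le : δ ≤ δmax
  deltaMax_lt : δmax < 1 / 2
  card_honest : (1 - δ) * n ≤ H.card
  robust : ∀ w : Fin n → Vec d,
    ‖A w - honestMean H w‖ ^ 2
      ≤ ρ * δ / (H.card : ℝ) * ∑ i ∈ H, ‖w i - honestMean H w‖ ^ 2

/-- A method of the class `𝓜`, running on the problem `P` with the aggregator `A`. All
coefficients of the linear combinations that the method forms may be adaptive and randomized:
they are only restricted by the requirement that the samples of an iteration are independent of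
what was determined before they were drawn, which is recorded by the filtration `ℱ`. -/
structure MethodRun {n : ℕ} (P : Problem n) (A : (Fin n → Vec P.d) → Vec P.d)
    (αmin : ℝ) where
  Ω : Type
  mΩ : MeasurableSpace Ω
  Pr : Measure Ω
  prob : IsProbabilityMeasure Pr
  /-- the batch size -/
  m : ℕ
  m_pos : 0 < m
  /-- `ℱ t` is the information available before the samples of iteration `t` are drawn -/
  ℱ : Filtration ℕ mΩ
  /-- `ξ t l i` is the `l`-th sample of the honest node `i` at iteration `t` -/
  ξ : ℕ → Fin m → P.H → Ω → Vec P.q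
  /-- the iterates `xᵗ` -/
  x : ℕ → Ω → Vec P.d
  /-- the query points `x^(t,l)`, common to all honest nodes -/
  query : ℕ → Fin m → Ω → Vec P.d
  /-- `α t j l` is the weight, in iteration `t`, of the `l`-th gradient of iteration `j` -/
  α : ℕ → ℕ → Fin m → Ω → ℝ
  /-- the message that a node sends to the server -/
  w : ℕ → Fin n → Ω → Vec P.d
  /-- the output after `t` iterations -/
  out : ℕ → Ω → Vec P.d
  -- sampling: independent across iterations, batch indices and nodes
  law_ξ : ∀ t, Measure.map (fun ω (p : Fin m × P.H) => ξ t p.1 p.2 ω) Pr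
    = Measure.pi (fun p : Fin m × P.H => P.D p.2)
  indep_ξ : ∀ t, Indep (ℱ t)
    (MeasurableSpace.comap (fun ω (p : Fin m × P.H) => ξ t p.1 p.2 ω) inferInstance) Pr
  -- information
  measurable_ξ : ∀ t l i, Measurable[ℱ (t + 1)] (ξ t l i)
  measurable_x : ∀ t, Measurable[ℱ t] (x t)
  measurable_query : ∀ t l, Measurable[ℱ t] (query t l)
  measurable_α : ∀ t j l, Measurable[ℱ (t + 1)] (α t j l)
  measurable_w : ∀ t i, Measurable[ℱ (t + 1)] (w t i)
  measurable_out : ∀ t, Measurable[ℱ t] (out t)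
  -- local computation
  x_zero : ∀ ω, x 0 ω = P.x0
  query_mem : ∀ t l ω, query t l ω ∈ Submodule.span ℝ {v | ∃ s ≤ t, v = x s ω}
  α_nonneg : ∀ t j l ω, 0 ≤ α t j l ω
  α_sum : ∀ t ω, αmin ≤ ∑ j ∈ Finset.range (t + 1), ∑ l, α t j l ω
  -- communication: the messages of the nodes outside `P.H` are arbitrary
  w_honest : ∀ t (i : P.H) ω, w t i ω =
    ∑ j ∈ Finset.range (t + 1), ∑ l, α t j l ω • P.stochGrad (query j l ω) (ξ j l i ω)
  -- global update
  x_succ_mem : ∀ t ω, x (t + 1) ω ∈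
    Submodule.span ℝ ({v | ∃ s ≤ t, v = x s ω} ∪ {v | ∃ s ≤ t, v = A (fun i => w s i ω)})
  out_mem : ∀ t ω, out t ω ∈ Submodule.span ℝ {v | ∃ s ≤ t, v = x s ω}

namespace MethodRun

variable {n : ℕ} {P : Problem n} {A : (Fin n → Vec P.d) → Vec P.d} {αmin : ℝ}
  (M : MethodRun P A αmin)

/-- `𝔼 ‖∇f(x̂ᵗ)‖`, an extended nonnegative real. -/
def expGradNorm (t : ℕ) : ℝ≥0∞ :=
  @lintegral M.Ω M.mΩ M.Pr (fun ω => ‖gradient P.loss (M.out t ω)‖ₑ)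

/-- The Byzantine error of the method: the infimum of `𝔼 ‖∇f(x̂ᵗ)‖` over all `t`. -/
def byzantineError : ℝ≥0∞ := ⨅ t : ℕ, M.expGradNorm t

/-- The number of oracle queries (one query: every honest node computes one stochastic gradient)
after which the expected gradient norm of the output is at most `e`: the infimum of all `K` such
that this holds after `K` queries, that is after `K / m` complete iterations. It is `∞` if this
never happens. -/
def queryComplexity (e : ℝ≥0∞) : ℝ≥0∞ :=
  ⨅ (K : ℕ) (_ : M.expGradNorm (K / M.m) ≤ e), (K : ℝ≥0∞)

end MethodRun

/-- The Byzantine error `ε_bzt` of a problem with a given aggregator: the smallest Byzantine error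
over all methods of the class. -/
def byzantineError {n : ℕ} (P : Problem n) (A : (Fin n → Vec P.d) → Vec P.d) (αmin : ℝ) :
    ℝ≥0∞ :=
  ⨅ M : MethodRun P A αmin, M.byzantineError

end ByzOpt

end

noncomputable section

namespace ByzOpt

open Filter Topology

/-! ### Gradients and regularity -/

/-! In the hard instances all nodes are honest and the adversary is the aggregator. `erasingMean` is
the plain average, except that it sets coordinates to zero whenever the robustness inequality pays
for it: the floor coordinate is charged to the empirical variance of the floor coordinate, a tail of
the chain to that of the noise coordinates.

Byzantine error. Along the floor coordinate the objective has a slope `b`, and the nodes are tilted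
by `τ i`. Message weights are nonnegative, so the mean floor message is at most `b + θ` times the
total weight, while its variance is `ζ ^ 2` times the squared total weight. As `(b + θ) ^ 2 ≤ ρ * δ
* ζ ^ 2`, the floor coordinate is always erased (`Regular.floor_erased`), stays zero forever, and
leaves a gradient of norm at least `b - θ`. This value is also attained in the limit
(`Hard.byzantineError_le`): a method that advances only on batches in which every node draws each of
its data points once sees no noise and reaches the minimizer of the chain. Hence the Byzantine error
is exactly `b - θ`, the reference value of the query complexity.

Lock. A chain gradient of order `ε` alone would raise the norm above `b` only by about `ε ^ 2 / b`.
Therefore a product of sines lowers the floor slope from `b` to `b - θ` once the last chain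
coordinate reaches its target; while the floor coordinate is zero, it does not affect the chain
gradient. As long as the last chain coordinate is zero, the norm is at least `b - θ + 3 * ε`, so a
chain that is locked with probability one half rules out error `ε` (`Hard.le_queryComplexity`).

Three obstacles delay the chain. Each iteration opens at most one coordinate
(`Hard.le_queryComplexity_chain`). With additive noise, the frontier coordinate is erased until
order `ρ * δ * σ ^ 2 / ε ^ 2` samples have seen it (`Hard.le_queryComplexity_noise`). With a mask
that is lifted with probability `1 / (N + 1)`, each coordinate needs a lucky sample at one of the
`n` nodes (`Hard.le_queryComplexity_switch`). The sum of the three terms is at most three times the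
largest, and the instance may depend on the parameters, so one instance per term suffices.

In the strongly convex case the chain is a Nesterov quadratic with geometric minimizer; it has
length of order `√κ * log (μ * R / ε)` for the third term and length one for the noise terms. In the
non-convex case it is the staircase `stair` of length of order `L * Δ / ε ^ 2`, and `mask` hides its
frontier with a gradient bounded independently of the length. -/

lemma hasGradientAt_of_forall {d : ℕ} {f : Vec d → ℝ} {f' : Vec d →L[ℝ] ℝ} {g x : Vec d}
    (hf : HasFDerivAt f f' x) (h : ∀ v, f' v = ∑ k, g k * v k) : HasGradientAt f g x := by
  have h1 : f' = InnerProductSpace.toDual ℝ (Vec d) g := by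
    ext1 v
    rw [h v, InnerProductSpace.toDual_apply_apply, PiLp.inner_apply]
    simp [mul_comm]
  exact hasGradientAt_iff_hasFDerivAt.2 (hf.congr_fderiv h1)

lemma inner_eq_sum {d : ℕ} (x y : Vec d) : inner ℝ x y = ∑ k, x k * y k := by
  simp [PiLp.inner_apply, mul_comm]

lemma contDiff_one_of_hasGradientAt {d : ℕ} {f : Vec d → ℝ} {g : Vec d → Vec d}
    (hf : ∀ x, HasGradientAt f (g x) x) (hg : Continuous g) : ContDiff ℝ 1 f := by
  rw [contDiff_one_iff_fderiv]
  refine ⟨fun x => (hf x).hasFDerivAt.differentiableAt, ?_⟩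
  have : fderiv ℝ f = fun x => InnerProductSpace.toDual ℝ (Vec d) (g x) := by
    ext1 x; exact (hf x).hasFDerivAt.fderiv
  rw [this]
  exact (InnerProductSpace.toDual ℝ (Vec d)).continuous.comp hg

lemma HasGradientAt.add' {d : ℕ} {f₁ f₂ : Vec d → ℝ} {g₁ g₂ x : Vec d}
    (h₁ : HasGradientAt f₁ g₁ x) (h₂ : HasGradientAt f₂ g₂ x) :
    HasGradientAt (fun y => f₁ y + f₂ y) (g₁ + g₂) x :=
  hasGradientAt_iff_hasFDerivAt.2
    ((h₁.hasFDerivAt.fun_add h₂.hasFDerivAt).congr_fderiv (map_add _ _ _).symm)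

lemma HasGradientAt.const_mul' {d : ℕ} {f : Vec d → ℝ} {g x : Vec d} (c : ℝ)
    (h : HasGradientAt f g x) : HasGradientAt (fun y => c * f y) (c • g) x :=
  hasGradientAt_iff_hasFDerivAt.2
    ((h.hasFDerivAt.const_mul c).congr_fderiv (by rw [map_smulₛₗ]; rfl))

lemma HasGradientAt.sum' {d : ℕ} {ι : Type*} {s : Finset ι} {f : ι → Vec d → ℝ}
    {g : ι → Vec d} {x : Vec d} (h : ∀ i ∈ s, HasGradientAt (f i) (g i) x) :
    HasGradientAt (fun y => ∑ i ∈ s, f i y) (∑ i ∈ s, g i) x :=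
  hasGradientAt_iff_hasFDerivAt.2
    ((HasFDerivAt.fun_sum fun i hi => (h i hi).hasFDerivAt).congr_fderiv (map_sum _ _ _).symm)

/-! ### Problems with finitely many data points -/

/-- The data point that stands for the `j`-th sample of node `i`. -/
def label {n N : ℕ} (i : Fin n) (j : Fin N) : Vec 1 :=
  WithLp.toLp 2 (fun _ => (((finProdFinEquiv (i, j) : Fin (n * N)) : ℕ) : ℝ))

lemma label_injective {n N : ℕ} {i i' : Fin n} {j j' : Fin N}
    (h : label i j = label i' j') : i = i' ∧ j = j' := by
  have h0 := congrArg (fun v : Vec 1 => v 0) h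
  simp only [label, Nat.cast_inj] at h0
  have := finProdFinEquiv.injective (Fin.ext h0)
  simpa using this

/-- The uniform distribution on the labels of node `i`. -/
def labelLaw (n N : ℕ) (i : Fin n) : Measure (Vec 1) :=
  ((N : ℝ≥0∞) + 1)⁻¹ • ∑ j : Fin (N + 1), Measure.dirac (label i j)

section LabelLaw

variable {n N : ℕ}

instance isProbabilityMeasure_labelLaw (i : Fin n) : IsProbabilityMeasure (labelLaw n N i) :=
  ⟨by
    simp only [labelLaw, Measure.smul_apply, Measure.finsetSum_apply, measure_univ,
      Finset.sum_const, Finset.card_univ, Fintype.card_fin, smul_eq_mul, nsmul_eq_mul, mul_one,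
      Nat.cast_add, Nat.cast_one]
    exact ENNReal.inv_mul_cancel (by simp) (by simp)⟩

lemma integrable_labelLaw {E : Type*} [NormedAddCommGroup E] (i : Fin n) (h : Vec 1 → E) :
    Integrable h (labelLaw n N i) := by
  refine Integrable.smul_measure ?_ (by simp)
  exact integrable_finsetSum_measure.2 fun j _ => integrable_dirac (by simp)

lemma integral_labelLaw {E : Type*} [NormedAddCommGroup E] [NormedSpace ℝ E]
    [CompleteSpace E] (i : Fin n) (h : Vec 1 → E) :
    ∫ ξ, h ξ ∂(labelLaw n N i) = ((N : ℝ) + 1)⁻¹ • ∑ j : Fin (N + 1), h (label i j) := by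
  unfold labelLaw
  rw [integral_smul_measure, integral_finsetSum_measure]
  · simp [integral_dirac, ENNReal.toReal_add]
  · intro j _
    exact integrable_dirac (by simp)

lemma lintegral_labelLaw (i : Fin n) (h : Vec 1 → ℝ≥0∞) :
    ∫⁻ ξ, h ξ ∂(labelLaw n N i) = ((N : ℝ≥0∞) + 1)⁻¹ * ∑ j : Fin (N + 1), h (label i j) := by
  unfold labelLaw
  rw [lintegral_smul_measure, lintegral_finsetSum_measure]
  simp [lintegral_dirac]

lemma labelLaw_label (i : Fin n) (j : Fin (N + 1)) :
    labelLaw n N i {label i j} = ((N : ℝ≥0∞) + 1)⁻¹ := by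
  simp only [labelLaw, Measure.smul_apply, Measure.finsetSum_apply, smul_eq_mul]
  rw [Finset.sum_eq_single j]
  · simp
  · intro j' _ hj'
    rw [Measure.dirac_apply' _ (measurableSet_singleton _)]
    rw [Set.indicator_of_notMem]
    exact fun h => hj' (label_injective h).2
  · simp

lemma ae_labelLaw (i : Fin n) :
    ∀ᵐ ξ ∂(labelLaw n N i), ∃ j : Fin (N + 1), ξ = label i j := by
  have hset : {ξ : Vec 1 | ¬ ∃ j : Fin (N + 1), ξ = label i j}
      = (⋃ j : Fin (N + 1), {label i j})ᶜ := by ext ξ; simp [eq_comm]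
  rw [ae_iff, hset]
  have hm : MeasurableSet (⋃ j : Fin (N + 1), {label i j} : Set (Vec 1))ᶜ :=
    (MeasurableSet.iUnion fun j => measurableSet_singleton _).compl
  simp only [labelLaw, Measure.smul_apply, Measure.finsetSum_apply, smul_eq_mul,
    mul_eq_zero]
  right
  refine Finset.sum_eq_zero fun j _ => ?_
  rw [Measure.dirac_apply' _ hm]
  rw [Set.indicator_of_notMem]
  exact fun h => h (Set.mem_iUnion.2 ⟨j, rfl⟩)

end LabelLaw

/-- The function that takes the value `φ i j` at the label of `(i, j)`, and `0` elsewhere. -/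
def byLabel {n N : ℕ} {E : Type*} [AddCommMonoid E] (φ : Fin n → Fin N → E) (ξ : Vec 1) : E :=
  ∑ i, ∑ j, Set.indicator {label i j} (fun _ => φ i j) ξ

lemma byLabel_label {n N : ℕ} {E : Type*} [AddCommMonoid E] (φ : Fin n → Fin N → E)
    (i : Fin n) (j : Fin N) : byLabel φ (label i j) = φ i j := by
  unfold byLabel
  rw [Finset.sum_eq_single i, Finset.sum_eq_single j]
  · simp
  · intro j' _ hj'
    refine Set.indicator_of_notMem (s := {label i j'}) (fun h => hj' ?_) _
    exact (label_injective h).2.symm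
  · simp
  · intro i' _ hi'
    refine Finset.sum_eq_zero fun j' _ => ?_
    refine Set.indicator_of_notMem (s := {label i' j'}) (fun h => hi' ?_) _
    exact (label_injective h).1.symm
  · simp

lemma measurable_byLabel {n N d : ℕ} (φ : Fin n → Fin N → Vec d) :
    Measurable (byLabel φ) :=
  Finset.measurable_sum _ fun _ _ => Finset.measurable_sum _ fun _ _ =>
    measurable_const.indicator (measurableSet_singleton _)

/-- A problem in which node `i` draws the loss uniformly from `φ i 0, φ i 1, …`, and all nodes
are honest. -/
@[reducible]
def finiteProblem {n d N : ℕ} (hd : 0 < d) (φ : Fin n → Fin (N + 1) → Vec d → ℝ)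
    (hφ : ∀ i j, Continuous (φ i j)) (x0 : Vec d) : Problem n where
  d := d
  d_pos := hd
  q := 1
  F x ξ := byLabel (fun i j => φ i j x) ξ
  measurable_F := by
    refine Finset.measurable_sum _ fun i _ => Finset.measurable_sum _ fun j _ => ?_
    have : (fun p : Vec d × Vec 1 =>
        Set.indicator {label i j} (fun _ => φ i j p.1) p.2)
        = Set.indicator (Prod.snd ⁻¹' {label i j}) (fun p => φ i j p.1) := by
      ext p; simp [Set.indicator]
    rw [this]
    exact ((hφ i j).measurable.comp measurable_fst).indicator
      (measurable_snd (measurableSet_singleton _))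
  H := Finset.univ
  D i := labelLaw n N i
  prob_D _ := inferInstance
  integrable_F i _ x := integrable_labelLaw i _
  x0 := x0

section FiniteProblem

variable {n d N : ℕ} (hd : 0 < d) (φ : Fin n → Fin (N + 1) → Vec d → ℝ)
    (hφ : ∀ i j, Continuous (φ i j)) (x0 : Vec d)

lemma finiteProblem_localLoss (i : Fin n) :
    (finiteProblem hd φ hφ x0).localLoss i = fun x => ((N : ℝ) + 1)⁻¹ * ∑ j, φ i j x := by
  ext x
  refine (integral_labelLaw i (fun ξ => byLabel (fun i j => φ i j x) ξ)).trans ?_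
  simp only [byLabel_label, smul_eq_mul]

variable {φ} {g : Fin n → Fin (N + 1) → Vec d → Vec d}

lemma hasGradientAt_byLabel (hg : ∀ i j x, HasGradientAt (φ i j) (g i j x) x)
    (ξ : Vec 1) (x : Vec d) :
    HasGradientAt (fun y => byLabel (fun i j => φ i j y) ξ)
      (byLabel (fun i j => g i j x) ξ) x := by
  unfold byLabel
  refine HasGradientAt.sum' fun i _ => HasGradientAt.sum' fun j _ => ?_
  by_cases h : ξ ∈ ({label i j} : Set (Vec 1))
  · simpa only [Set.indicator_of_mem h] using hg i j x
  · simpa only [Set.indicator_of_notMem h] using hasGradientAt_const x 0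

lemma finiteProblem_stochGrad (hg : ∀ i j x, HasGradientAt (φ i j) (g i j x) x) (x : Vec d)
    (ξ : Vec 1) :
    (finiteProblem hd φ hφ x0).stochGrad x ξ = byLabel (fun i j => g i j x) ξ :=
  (hasGradientAt_byLabel hg ξ x).gradient

lemma finiteProblem_inOracleClass {gl : Fin n → Vec d → Vec d} {σ : ℝ}
    (hg : ∀ i j x, HasGradientAt (φ i j) (g i j x) x)
    (hgc : ∀ i j, Continuous (g i j))
    (hgl : ∀ i x, gl i x = ((N : ℝ) + 1)⁻¹ • ∑ j, g i j x)
    (hvar : ∀ i x, ((N : ℝ) + 1)⁻¹ * ∑ j, ‖g i j x - gl i x‖ ^ 2 ≤ σ ^ 2) :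
    (finiteProblem hd φ hφ x0).InOracleClass σ := by
  have hgrad : ∀ i x, gradient ((finiteProblem hd φ hφ x0).localLoss i) x = gl i x := by
    intro i x
    rw [finiteProblem_localLoss, hgl]
    exact (HasGradientAt.const_mul' _ (HasGradientAt.sum' fun j _ => hg i j x)).gradient
  have hsg : ∀ x, (finiteProblem hd φ hφ x0).stochGrad x = byLabel (fun i j => g i j x) :=
    fun x => funext fun ξ => finiteProblem_stochGrad hd hφ x0 hg x ξ
  refine ⟨fun ξ => ?_, fun i _ x => integrable_labelLaw i _, fun i _ x => ?_, fun i _ x => ?_⟩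
  · refine contDiff_one_of_hasGradientAt (hasGradientAt_byLabel hg ξ) ?_
    refine continuous_finsetSum _ fun i _ => continuous_finsetSum _ fun j _ => ?_
    by_cases h : ξ ∈ ({label i j} : Set (Vec 1))
    · simpa only [Set.indicator_of_mem h] using hgc i j
    · simpa only [Set.indicator_of_notMem h] using continuous_const
  · rw [hgrad, hsg, hgl]
    refine (integral_labelLaw i (byLabel fun i j => g i j x)).trans ?_
    simp only [byLabel_label]
  · rw [hgrad, hsg]
    refine (lintegral_labelLaw i
      (fun ξ => ‖byLabel (fun i j => g i j x) ξ - gl i x‖ₑ ^ 2)).trans_le ?_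
    simp only [byLabel_label]
    have h1 : ∀ j, ‖g i j x - gl i x‖ₑ ^ 2 = ENNReal.ofReal (‖g i j x - gl i x‖ ^ 2) := by
      intro j
      rw [ENNReal.ofReal_pow (norm_nonneg _), ofReal_norm]
    simp only [h1]
    rw [← ENNReal.ofReal_sum_of_nonneg (fun _ _ => by positivity)]
    have h2 : ((N : ℝ≥0∞) + 1)⁻¹ = ENNReal.ofReal (((N : ℝ) + 1)⁻¹) := by
      rw [ENNReal.ofReal_inv_of_pos (by positivity), ENNReal.ofReal_add (by positivity) (by simp)]
      simp
    rw [h2, ← ENNReal.ofReal_mul (by positivity)]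
    exact ENNReal.ofReal_le_ofReal (hvar i x)

end FiniteProblem

/-! ### Samples of a run on a finite problem -/

section Runs

variable {n d N : ℕ} {hd : 0 < d} {φ : Fin n → Fin (N + 1) → Vec d → ℝ}
    {hφ : ∀ i j, Continuous (φ i j)} {x0 : Vec d}
    {A : (Fin n → Vec d) → Vec d} {αmin : ℝ}

lemma MethodRun.measurable_sample {P : Problem n} {A : (Fin n → Vec P.d) → Vec P.d}
    (M : MethodRun P A αmin) (t : ℕ) (l : Fin M.m) (i : P.H) :
    Measurable[M.mΩ] (M.ξ t l i) :=
  (M.measurable_ξ t l i).mono (M.ℱ.le _) le_rfl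

lemma MethodRun.map_sample {P : Problem n} {A : (Fin n → Vec P.d) → Vec P.d}
    (M : MethodRun P A αmin) (t : ℕ) (l : Fin M.m) (i : P.H) :
    @Measure.map M.Ω _ M.mΩ _ (M.ξ t l i) M.Pr = P.D i := by
  let _ := M.mΩ
  have := P.prob_D
  have h := M.law_ξ t
  have hmeas : Measurable (fun ω (p : Fin M.m × P.H) => M.ξ t p.1 p.2 ω) :=
    measurable_pi_lambda _ fun p => M.measurable_sample t p.1 p.2
  have h2 := (measurePreserving_eval (fun p : Fin M.m × P.H => P.D p.2) (l, i)).map_eq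
  rw [← h, Measure.map_map (measurable_pi_apply _) hmeas] at h2
  exact h2

/-- Only countably many samples are drawn, so one null set suffices. Outside it a run is described
by the indices `J`, and confinement can be proved path by path. -/
lemma MethodRun.ae_label (M : MethodRun (finiteProblem hd φ hφ x0) A αmin) :
    ∀ᵐ ω ∂M.Pr, ∃ J : ℕ → Fin M.m → Fin n → Fin (N + 1),
      ∀ t l i, M.ξ t l i ω = label i.1 (J t l i.1) := by
  let _ := M.mΩ
  have h : ∀ᵐ ω ∂M.Pr, ∀ t l i, ∃ j : Fin (N + 1), M.ξ t l i ω = label i.1 j := by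
    rw [ae_all_iff]; intro t
    rw [ae_all_iff]; intro l
    rw [ae_all_iff]; intro i
    have h1 := ae_labelLaw (N := N) i.1
    have h2 := M.map_sample t l i
    change _ = labelLaw n N i.1 at h2
    rw [← h2] at h1
    exact ae_of_ae_map (M.measurable_sample t l i).aemeasurable h1
  filter_upwards [h] with ω hω
  choose J hJ using hω
  exact ⟨fun t l i => J t l ⟨i, Finset.mem_univ i⟩, fun t l i => hJ t l i⟩

lemma MethodRun.measure_sample_eq (M : MethodRun (finiteProblem hd φ hφ x0) A αmin)
    (t : ℕ) (l : Fin M.m) (i : Fin n) (j : Fin (N + 1)) :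
    M.Pr {ω | M.ξ t l ⟨i, Finset.mem_univ i⟩ ω = label i j} = ((N : ℝ≥0∞) + 1)⁻¹ := by
  let _ := M.mΩ
  have h2 := M.map_sample t l ⟨i, Finset.mem_univ i⟩
  change _ = labelLaw n N i at h2
  rw [← labelLaw_label i j, ← h2]
  exact (Measure.map_apply (M.measurable_sample t l ⟨i, Finset.mem_univ i⟩)
    (measurableSet_singleton (label i j : Vec 1))).symm

end Runs

/-! ### Coordinates -/

/-- The dimension of the hard instances: one floor coordinate, one dummy coordinate, a chain of
`T + 1` coordinates, and `N + 1` noise coordinates for each of the `n` nodes. -/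
def dim (n T N : ℕ) : ℕ :=
  Fintype.card (Unit ⊕ (Unit ⊕ (Fin (T + 1) ⊕ (Fin n × Fin (N + 1)))))

/-- The enumeration of the coordinates. -/
def idx (n T N : ℕ) :
    (Unit ⊕ (Unit ⊕ (Fin (T + 1) ⊕ (Fin n × Fin (N + 1))))) ≃ Fin (dim n T N) :=
  Fintype.equivFin _

section Coordinates

variable {n T N : ℕ}

lemma dim_pos : 0 < dim n T N := Fintype.card_pos

/-- The floor coordinate. -/
def fl : Fin (dim n T N) := idx n T N (Sum.inl ())

/-- The dummy coordinate. -/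
def du : Fin (dim n T N) := idx n T N (Sum.inr (Sum.inl ()))

/-- The chain coordinates. -/
def ch (k : Fin (T + 1)) : Fin (dim n T N) := idx n T N (Sum.inr (Sum.inr (Sum.inl k)))

/-- The noise coordinates. -/
def no (i : Fin n) (j : Fin (N + 1)) : Fin (dim n T N) :=
  idx n T N (Sum.inr (Sum.inr (Sum.inr (i, j))))

/-- The point with given coordinates. -/
def mkPt (a b : ℝ) (z : Fin (T + 1) → ℝ) (v : Fin n → Fin (N + 1) → ℝ) : Vec (dim n T N) :=
  WithLp.toLp 2 fun k => Sum.elim (fun _ => a) (Sum.elim (fun _ => b)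
    (Sum.elim z fun p => v p.1 p.2)) ((idx n T N).symm k)

@[simp] lemma mkPt_fl (a b : ℝ) (z : Fin (T + 1) → ℝ) (v : Fin n → Fin (N + 1) → ℝ) :
    mkPt a b z v fl = a := by simp [mkPt, fl]

@[simp] lemma mkPt_du (a b : ℝ) (z : Fin (T + 1) → ℝ) (v : Fin n → Fin (N + 1) → ℝ) :
    mkPt a b z v du = b := by simp [mkPt, du]

@[simp] lemma mkPt_ch (a b : ℝ) (z : Fin (T + 1) → ℝ) (v : Fin n → Fin (N + 1) → ℝ)
    (k : Fin (T + 1)) : mkPt a b z v (ch k) = z k := by simp [mkPt, ch]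

@[simp] lemma mkPt_no (a b : ℝ) (z : Fin (T + 1) → ℝ) (v : Fin n → Fin (N + 1) → ℝ)
    (i : Fin n) (j : Fin (N + 1)) : mkPt a b z v (no i j) = v i j := by simp [mkPt, no]

lemma forall_coord {p : Fin (dim n T N) → Prop} (h1 : p fl) (h2 : p du) (h3 : ∀ k, p (ch k))
    (h4 : ∀ i j, p (no i j)) (k : Fin (dim n T N)) : p k := by
  obtain ⟨c, rfl⟩ := (idx n T N).surjective k
  rcases c with ⟨⟩ | ⟨⟨⟩ | k | ⟨i, j⟩⟩
  exacts [h1, h2, h3 k, h4 i j]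

lemma ext_coord {x y : Vec (dim n T N)} (h1 : x fl = y fl) (h2 : x du = y du)
    (h3 : ∀ k, x (ch k) = y (ch k)) (h4 : ∀ i j, x (no i j) = y (no i j)) : x = y :=
  PiLp.ext (forall_coord h1 h2 h3 h4)

lemma sum_coord (g : Fin (dim n T N) → ℝ) :
    ∑ k, g k = g fl + g du + ∑ k, g (ch k) + ∑ i, ∑ j, g (no i j) := by
  rw [← (idx n T N).sum_comp g]
  simp only [Fintype.sum_sum_type, Finset.univ_unique, Finset.sum_singleton,
    Fintype.sum_prod_type, fl, du, ch, no]
  simp only [PUnit.default_eq_unit, add_assoc]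

lemma norm_sq_coord (x : Vec (dim n T N)) :
    ‖x‖ ^ 2 = x fl ^ 2 + x du ^ 2 + ∑ k, x (ch k) ^ 2 + ∑ i, ∑ j, x (no i j) ^ 2 := by
  rw [EuclideanSpace.real_norm_sq_eq, sum_coord]

/-- The chain coordinates of a point. -/
def chain : Vec (dim n T N) →L[ℝ] Vec (T + 1) :=
  LinearMap.toContinuousLinearMap
    { toFun := fun x => WithLp.toLp 2 fun k => x (ch k)
      map_add' := fun x y => by ext k; simp
      map_smul' := fun c x => by ext k; simp }

@[simp] lemma chain_apply (x : Vec (dim n T N)) (k : Fin (T + 1)) : chain x k = x (ch k) := rfl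

lemma norm_sq_chain (x : Vec (dim n T N)) : ‖chain x‖ ^ 2 = ∑ k, x (ch k) ^ 2 := by
  rw [EuclideanSpace.real_norm_sq_eq]; rfl

@[simp] lemma chain_mkPt (a b : ℝ) (z : Vec (T + 1)) (v : Fin n → Fin (N + 1) → ℝ) :
    chain (mkPt a b z v) = z := by ext k; simp

/-- Chain vectors in which only the first `k` coordinates may be nonzero. -/
def initial (T k : ℕ) : Submodule ℝ (Vec (T + 1)) where
  carrier := {z | ∀ i : Fin (T + 1), k ≤ i → z i = 0}
  add_mem' := fun hx hy i hi => by simp [hx i hi, hy i hi]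
  zero_mem' := fun i _ => by simp
  smul_mem' := fun c x hx i hi => by simp [hx i hi]

lemma mem_initial {k : ℕ} {z : Vec (T + 1)} :
    z ∈ initial T k ↔ ∀ i : Fin (T + 1), k ≤ i → z i = 0 := Iff.rfl

lemma initial_mono : Monotone (initial T) := fun _ _ h _ hz i hi => hz i (h.trans hi)

/-- Points with vanishing floor coordinate in which only the first `k` chain coordinates may be
nonzero. -/
def reached (n T N k : ℕ) : Submodule ℝ (Vec (dim n T N)) where
  carrier := {x | x fl = 0 ∧ chain x ∈ initial T k}
  add_mem' := fun hx hy => ⟨by simp [hx.1, hy.1], by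
    rw [map_add]; exact add_mem hx.2 hy.2⟩
  zero_mem' := ⟨by simp, by rw [map_zero]; exact zero_mem _⟩
  smul_mem' := fun c x hx => ⟨by simp [hx.1], by
    rw [map_smul]; exact Submodule.smul_mem _ _ hx.2⟩

lemma mem_reached {k : ℕ} {x : Vec (dim n T N)} :
    x ∈ reached n T N k ↔ x fl = 0 ∧ chain x ∈ initial T k := Iff.rfl

lemma reached_mono : Monotone (reached n T N) := fun _ _ h _ hx => ⟨hx.1, initial_mono h hx.2⟩

end Coordinates

/-! ### Runs that are confined to a sequence of subspaces -/

section Confined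

variable {n : ℕ} {P : Problem n} {A : (Fin n → Vec P.d) → Vec P.d} {αmin : ℝ}

lemma MethodRun.span_le {M : MethodRun P A αmin} {ω : M.Ω} {W : ℕ → Submodule ℝ (Vec P.d)}
    (hW : Monotone W) {t : ℕ} (h : ∀ s ≤ t, M.x s ω ∈ W s) :
    Submodule.span ℝ {v | ∃ s ≤ t, v = M.x s ω} ≤ W t := by
  rw [Submodule.span_le]
  rintro _ ⟨s, hs, rfl⟩
  exact hW hs (h s hs)

/-- The span rules confine queries and iterates by themselves; only the aggregated messages need an
argument, and `hstep` may assume that all queries so far were confined. -/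
lemma MethodRun.x_mem {M : MethodRun P A αmin} {ω : M.Ω} {W : ℕ → Submodule ℝ (Vec P.d)}
    (hW : Monotone W) (h0 : P.x0 ∈ W 0) {t₀ : ℕ}
    (hstep : ∀ t < t₀, (∀ j ≤ t, ∀ l, M.query j l ω ∈ W j) →
      A (fun i => M.w t i ω) ∈ W (t + 1)) :
    ∀ t ≤ t₀, M.x t ω ∈ W t := by
  intro t
  induction t using Nat.strong_induction_on with
  | _ t ih =>
    intro ht
    rcases t with _ | t
    · rw [M.x_zero]; exact h0
    · have hx : ∀ s ≤ t, M.x s ω ∈ W s := fun s hs => ih s (by omega) (by omega)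
      have hq : ∀ j ≤ t, ∀ l, M.query j l ω ∈ W j := fun j hj l =>
        MethodRun.span_le hW (fun s hs => hx s (hs.trans hj)) (M.query_mem j l ω)
      refine (Submodule.span_le.2 ?_ : _ ≤ W (t + 1)) (M.x_succ_mem t ω)
      rintro _ (⟨s, hs, rfl⟩ | ⟨s, hs, rfl⟩)
      · exact hW (by omega) (hx s hs)
      · exact hW (by omega) (hstep s (by omega) fun j hj => hq j (hj.trans hs))

lemma MethodRun.out_mem_of_confined {M : MethodRun P A αmin} {ω : M.Ω}
    {W : ℕ → Submodule ℝ (Vec P.d)}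
    (hW : Monotone W) (h0 : P.x0 ∈ W 0) {t : ℕ}
    (hstep : ∀ s < t, (∀ j ≤ s, ∀ l, M.query j l ω ∈ W j) →
      A (fun i => M.w s i ω) ∈ W (s + 1)) :
    M.out t ω ∈ W t :=
  MethodRun.span_le hW (fun s hs => MethodRun.x_mem hW h0 hstep s hs) (M.out_mem t ω)

end Confined

/-! ### The aggregator -/

section Aggregator

variable {n T N : ℕ}

lemma honestMean_univ_apply {d : ℕ} (w : Fin n → Vec d) (k : Fin d) :
    honestMean Finset.univ w k = (n : ℝ)⁻¹ * ∑ i, w i k := by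
  simp [honestMean]

/-- The empirical variance of the floor coordinate. -/
def floorVar (w : Fin n → Vec (dim n T N)) : ℝ :=
  (n : ℝ)⁻¹ * ∑ i, (w i fl - honestMean Finset.univ w fl) ^ 2

/-- The empirical variance of the noise coordinates. -/
def noiseVar (w : Fin n → Vec (dim n T N)) : ℝ :=
  (n : ℝ)⁻¹ * ∑ i, ∑ i', ∑ j, (w i (no i' j) - honestMean Finset.univ w (no i' j)) ^ 2

/-- The average, except that the floor coordinate and the tail of the chain are erased whenever
the variance permits it. -/
def erasingMean (ρδ : ℝ) (w : Fin n → Vec (dim n T N)) : Vec (dim n T N) :=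
  let u := honestMean Finset.univ w
  -- The two erasures draw on disjoint parts of the variance, so both can be afforded at once.
  mkPt (if u fl ^ 2 ≤ ρδ * floorVar w then 0 else u fl) (u du)
    (fun k => if ∑ k' ∈ Finset.univ.filter (k ≤ ·), u (ch k') ^ 2 ≤ ρδ * noiseVar w
      then 0 else u (ch k))
    (fun i j => u (no i j))

lemma floorVar_nonneg (w : Fin n → Vec (dim n T N)) : 0 ≤ floorVar w := by
  unfold floorVar; positivity

lemma noiseVar_nonneg (w : Fin n → Vec (dim n T N)) : 0 ≤ noiseVar w := by
  unfold noiseVar; positivity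

/-- The smallest erased index certifies that the whole tail from it on is at most `v`, and this tail
contains every erased index: the budget is spent only once. -/
lemma sum_sq_erased_le {m : ℕ} (u : Fin m → ℝ) {v : ℝ} (hv : 0 ≤ v) :
    ∑ k, (if ∑ k' ∈ Finset.univ.filter (k ≤ ·), u k' ^ 2 ≤ v then u k ^ 2 else 0) ≤ v := by
  set E := Finset.univ.filter fun k : Fin m =>
    ∑ k' ∈ Finset.univ.filter (k ≤ ·), u k' ^ 2 ≤ v with hE
  rw [← Finset.sum_filter, ← hE]
  rcases E.eq_empty_or_nonempty with h | h
  · simpa [h] using hv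
  · have hk := E.min'_mem h
    refine le_trans (Finset.sum_le_sum_of_subset_of_nonneg ?_ fun _ _ _ => sq_nonneg _)
      (Finset.mem_filter.1 hk).2
    intro i hi
    simpa using E.min'_le i hi

lemma measurable_erasingMean (ρδ : ℝ) :
    Measurable (erasingMean ρδ : (Fin n → Vec (dim n T N)) → Vec (dim n T N)) := by
  have hcoord : ∀ i k, Measurable fun w : Fin n → Vec (dim n T N) => w i k := by
    intro i k
    have : Continuous fun w : Fin n → Vec (dim n T N) => w i k := by fun_prop
    exact this.measurable
  have hmean : ∀ k, Measurable fun w : Fin n → Vec (dim n T N) =>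
      honestMean Finset.univ w k := by
    intro k
    simp only [honestMean_univ_apply]
    fun_prop
  have hf : Measurable fun w : Fin n → Vec (dim n T N) => floorVar w := by
    unfold floorVar; fun_prop
  have hn : Measurable fun w : Fin n → Vec (dim n T N) => noiseVar w := by
    unfold noiseVar; fun_prop
  refine (WithLp.measurable_toLp 2 _).comp (measurable_pi_lambda _ ?_)
  have key : ∀ k, Measurable fun w : Fin n → Vec (dim n T N) => erasingMean ρδ w k := by
    refine forall_coord ?_ ?_ ?_ ?_
    · simp only [erasingMean, mkPt_fl]
      exact Measurable.ite (measurableSet_le (by fun_prop) (by fun_prop)) measurable_const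
        (hmean _)
    · simp only [erasingMean, mkPt_du]; exact hmean _
    · intro k
      simp only [erasingMean, mkPt_ch]
      exact Measurable.ite (measurableSet_le (by fun_prop) (by fun_prop)) measurable_const
        (hmean _)
    · intro i j
      simp only [erasingMean, mkPt_no]; exact hmean _
  exact key

lemma isRobustAggregator_erasingMean {δmax ρ δ : ℝ} (hρ : 0 ≤ ρ) (hδ : 0 ≤ δ) (hδm : δ ≤ δmax)
    (hm : δmax < 1 / 2) :
    IsRobustAggregator δmax ρ δ Finset.univ
      (erasingMean (ρ * δ) : (Fin n → Vec (dim n T N)) → Vec (dim n T N)) where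
  measurable := measurable_erasingMean _
  rho_nonneg := hρ
  delta_nonneg := hδ
  delta_le := hδm
  deltaMax_lt := hm
  card_honest := by
    rw [Finset.card_univ, Fintype.card_fin]
    nlinarith [Nat.cast_nonneg (α := ℝ) n]
  robust w := by
    set u := honestMean Finset.univ w with hu
    have hρδ : 0 ≤ ρ * δ := mul_nonneg hρ hδ
    have h1 : ‖erasingMean (ρ * δ) w - u‖ ^ 2 ≤ ρ * δ * floorVar w + ρ * δ * noiseVar w := by
      rw [norm_sq_coord]
      have hfl : (erasingMean (ρ * δ) w - u) fl ^ 2 ≤ ρ * δ * floorVar w := by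
        simp only [PiLp.sub_apply, erasingMean, mkPt_fl, ← hu]
        split_ifs with h
        · simpa using h
        · simpa using mul_nonneg hρδ (floorVar_nonneg w)
      have hch : ∑ k, (erasingMean (ρ * δ) w - u) (ch k) ^ 2 ≤ ρ * δ * noiseVar w := by
        refine le_trans (le_of_eq ?_) (sum_sq_erased_le (fun k => u (ch k))
          (mul_nonneg hρδ (noiseVar_nonneg w)))
        refine Finset.sum_congr rfl fun k _ => ?_
        simp only [PiLp.sub_apply, erasingMean, mkPt_ch, ← hu]
        split_ifs <;> simp
      have hdu : (erasingMean (ρ * δ) w - u) du = 0 := by simp [erasingMean, ← hu]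
      have hno : ∀ i j, (erasingMean (ρ * δ) w - u) (no i j) = 0 := by
        intro i j; simp [erasingMean, ← hu]
      simp only [hdu, hno]
      simp only [ne_eq, OfNat.ofNat_ne_zero, not_false_eq_true, zero_pow, Finset.sum_const_zero,
        add_zero]
      linarith
    -- Chain and dummy coordinates only enlarge the right-hand side.
    have h2 : floorVar w + noiseVar w ≤ (n : ℝ)⁻¹ * ∑ i, ‖w i - u‖ ^ 2 := by
      unfold floorVar noiseVar
      rw [← mul_add, ← Finset.sum_add_distrib]
      refine mul_le_mul_of_nonneg_left (Finset.sum_le_sum fun i _ => ?_) (by positivity)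
      rw [norm_sq_coord]
      simp only [PiLp.sub_apply, ← hu]
      have : 0 ≤ ∑ k, (w i (ch k) - u (ch k)) ^ 2 := Finset.sum_nonneg fun _ _ => sq_nonneg _
      nlinarith [sq_nonneg (w i du - u du)]
    calc _ ≤ ρ * δ * (floorVar w + noiseVar w) := by linarith
      _ ≤ ρ * δ * ((n : ℝ)⁻¹ * ∑ i, ‖w i - u‖ ^ 2) := mul_le_mul_of_nonneg_left h2 hρδ
      _ = _ := by
        rw [Finset.card_univ, Fintype.card_fin]; ring

lemma erasingMean_fl_eq_zero {ρδ : ℝ} {w : Fin n → Vec (dim n T N)}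
    (h : honestMean Finset.univ w fl ^ 2 ≤ ρδ * floorVar w) : erasingMean ρδ w fl = 0 := by
  simp [erasingMean, h]

lemma erasingMean_mem_reached {ρδ : ℝ} {w : Fin n → Vec (dim n T N)} {k : ℕ}
    (hfl : honestMean Finset.univ w fl ^ 2 ≤ ρδ * floorVar w)
    (hch : ∀ i, chain (w i) ∈ initial T k) : erasingMean ρδ w ∈ reached n T N k := by
  refine ⟨erasingMean_fl_eq_zero hfl, fun i hi => ?_⟩
  simp only [chain_apply, erasingMean, mkPt_ch, honestMean_univ_apply]
  have : ∀ i', w i' (ch i) = 0 := fun i' => hch i' i hi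
  simp [this]

/-- Beyond coordinate `k` the mean vanishes, so the tail sum tested at `k` is a single square, and
passing the test erases the frontier. -/
lemma erasingMean_mem_reached_of_frontier {ρδ : ℝ}
    {w : Fin n → Vec (dim n T N)} {k : ℕ}
    (hfl : honestMean Finset.univ w fl ^ 2 ≤ ρδ * floorVar w)
    (hch : ∀ i, chain (w i) ∈ initial T (k + 1))
    (hk : ∀ i : Fin (T + 1), (i : ℕ) = k →
      honestMean Finset.univ w (ch i) ^ 2 ≤ ρδ * noiseVar w) :
    erasingMean ρδ w ∈ reached n T N k := by
  have h0 : ∀ i : Fin (T + 1), k + 1 ≤ i → honestMean Finset.univ w (ch i) = 0 := by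
    intro i hi
    have : ∀ i', w i' (ch i) = 0 := fun i' => hch i' i hi
    simp [honestMean_univ_apply, this]
  refine ⟨erasingMean_fl_eq_zero hfl, fun i hi => ?_⟩
  simp only [chain_apply, erasingMean, mkPt_ch]
  rcases Nat.eq_or_lt_of_le hi with h | h
  · rw [if_pos]
    rw [Finset.sum_eq_single i]
    · exact hk i h.symm
    · intro i' hi' hne
      have : i < i' := lt_of_le_of_ne (Finset.mem_filter.1 hi').2 (Ne.symm hne)
      rw [h0 i' (by have : (i : ℕ) < i' := this; omega)]
      simp
    · simp
  · rw [h0 i h]; simp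

end Aggregator

/-! ### The hard instances -/

/-- The parameters of a hard instance. The chain is governed by the function `H`; the floor
coordinate carries a slope `b` that decreases by `θ` when the last chain coordinate has reached
its target; `τ` describes the heterogeneity of the nodes; `s` is the size of the additive noise
and `ω • ψ` is switched on and off at random. -/
structure Design (n T N : ℕ) where
  (a b θ lam e s ω : ℝ)
  τ : Fin n → ℝ
  (H ψ : Vec (T + 1) → ℝ)
  (gH gψ : Vec (T + 1) → Vec (T + 1))

namespace Design

variable {n T N : ℕ} (D : Design n T N)

/-- The common loss, tilted by `c` in the floor coordinate. -/
def base (c : ℝ) (x : Vec (dim n T N)) : ℝ :=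
  D.a / 2 * x fl ^ 2 + (D.b + c) * x fl
    -- At zero floor coordinate this term has floor derivative `-θ * sin (x_last / lam)` and no
    -- chain derivative: it lowers the slope without revealing anything about the chain.
    - D.θ * D.lam * (Real.sin (x fl / D.lam) * Real.sin (x (ch (Fin.last T)) / D.lam))
    + D.H (chain x) + D.e / 2 * (x du ^ 2 + ∑ i, ∑ j, x (no i j) ^ 2)

/-- The gradient of `base`. -/
def baseGrad (c : ℝ) (x : Vec (dim n T N)) : Vec (dim n T N) :=
  mkPt (D.a * x fl + D.b + c
      - D.θ * (Real.cos (x fl / D.lam) * Real.sin (x (ch (Fin.last T)) / D.lam)))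
    (D.e * x du)
    (fun k => D.gH (chain x) k - if k = Fin.last T then
      D.θ * (Real.sin (x fl / D.lam) * Real.cos (x (ch (Fin.last T)) / D.lam)) else 0)
    (fun i j => D.e * x (no i j))

/-- The centered random factor of `ψ`. -/
def switch (N : ℕ) (j : Fin (N + 1)) : ℝ := ((N : ℝ) + 1) * (if j = 0 then 1 else 0) - 1

/-- The direction of the additive noise. -/
def noise (s : ℝ) (i : Fin n) (j : Fin (N + 1)) (i' : Fin n) (j' : Fin (N + 1)) : ℝ :=
  if i' = i then s * ((if j' = j then 1 else 0) - ((N : ℝ) + 1)⁻¹) else 0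

/-- The loss of the `j`-th data point of node `i`. -/
def sample (i : Fin n) (j : Fin (N + 1)) (x : Vec (dim n T N)) : ℝ :=
  D.base (D.τ i) x + (∑ i', ∑ j', noise D.s i j i' j' * x (no i' j')
    + D.ω * switch N j * D.ψ (chain x))

/-- The noise of the stochastic gradient. -/
def noiseGrad (i : Fin n) (j : Fin (N + 1)) (x : Vec (dim n T N)) : Vec (dim n T N) :=
  mkPt 0 0 (fun k => D.ω * switch N j * D.gψ (chain x) k) (noise D.s i j)

/-- The gradient of `sample`. -/
def sampleGrad (i : Fin n) (j : Fin (N + 1)) (x : Vec (dim n T N)) : Vec (dim n T N) :=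
  D.baseGrad (D.τ i) x + D.noiseGrad i j x

/-- The functions of a design have the claimed gradients, and the tilts average to zero. -/
structure Regular : Prop where
  n_pos : 0 < n
  lam_pos : 0 < D.lam
  hasGradientAt_H : ∀ z, HasGradientAt D.H (D.gH z) z
  continuous_gH : Continuous D.gH
  hasGradientAt_ψ : ∀ z, HasGradientAt D.ψ (D.gψ z) z
  continuous_gψ : Continuous D.gψ
  sum_τ : ∑ i, D.τ i = 0

lemma sum_switch : ∑ j, switch N j = 0 := by
  simp [switch, Finset.sum_sub_distrib]

lemma sum_noise (s : ℝ) (i i' : Fin n) (j' : Fin (N + 1)) : ∑ j, noise s i j i' j' = 0 := by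
  unfold noise
  split_ifs
  · rw [← Finset.mul_sum, Finset.sum_sub_distrib]
    have h : ((N : ℝ) + 1) ≠ 0 := by positivity
    simp [h]
  · simp

lemma proj_apply' {d : ℕ} (k : Fin d) (v : Vec d) :
    (EuclideanSpace.proj k : Vec d →L[ℝ] ℝ) v = v k := rfl

lemma hasFDerivAt_coord {d : ℕ} (k : Fin d) (x : Vec d) :
    HasFDerivAt (fun y : Vec d => y k) (EuclideanSpace.proj k : Vec d →L[ℝ] ℝ) x :=
  (EuclideanSpace.proj k : Vec d →L[ℝ] ℝ).hasFDerivAt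

variable {D}

lemma hasFDerivAt_comp_chain {G : Vec (T + 1) → ℝ} {g : Vec (T + 1) → Vec (T + 1)}
    (hG : ∀ z, HasGradientAt G (g z) z) (x : Vec (dim n T N)) :
    HasFDerivAt (fun y : Vec (dim n T N) => G (chain y))
      ((InnerProductSpace.toDual ℝ (Vec (T + 1)) (g (chain x))).comp chain) x :=
  (hG (chain x)).hasFDerivAt.comp x chain.hasFDerivAt

lemma toDual_chain_apply (g : Vec (T + 1)) (v : Vec (dim n T N)) :
    (InnerProductSpace.toDual ℝ (Vec (T + 1)) g) (chain v) = ∑ k, g k * v (ch k) := by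
  rw [InnerProductSpace.toDual_apply_apply, inner_eq_sum]; rfl

lemma Regular.hasGradientAt_base (hD : D.Regular) (c : ℝ) (x : Vec (dim n T N)) :
    HasGradientAt (D.base c) (D.baseGrad c x) x := by
  have hl := hD.lam_pos.ne'
  have h1 := (hasFDerivAt_coord fl x).mul_const D.lam⁻¹
  have h2 := (hasFDerivAt_coord (ch (Fin.last T)) x).mul_const D.lam⁻¹
  have hno : HasFDerivAt (fun y : Vec (dim n T N) => ∑ i, ∑ j, y (no i j) ^ 2) _ x :=
    HasFDerivAt.fun_sum fun i _ => HasFDerivAt.fun_sum fun j _ =>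
      (hasFDerivAt_coord (no i j) x).pow 2
  have h := ((((((hasFDerivAt_coord fl x).pow 2).const_mul (D.a / 2)).add
    ((hasFDerivAt_coord fl x).const_mul (D.b + c))).sub
    ((h1.sin.mul h2.sin).const_mul (D.θ * D.lam))).add
    (hasFDerivAt_comp_chain hD.hasGradientAt_H x)).add
    ((((hasFDerivAt_coord du x).pow 2).add hno).const_mul (D.e / 2))
  refine hasGradientAt_of_forall h fun v => ?_
  rw [sum_coord]
  simp only [add_apply, sub_apply,
    smul_apply, ContinuousLinearMap.comp_apply, toDual_chain_apply,
    sum_apply, proj_apply', smul_eq_mul, baseGrad,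
    mkPt_fl, mkPt_du, mkPt_ch, mkPt_no, sub_mul, Finset.sum_sub_distrib, ite_mul, zero_mul,
    Finset.sum_ite_eq', Finset.mem_univ, if_true]
  have e1 : ∑ i, ∑ j, D.e * x (no i j) * v (no i j)
      = D.e / 2 * ∑ i, ∑ j, 2 * x (no i j) * v (no i j) := by
    rw [Finset.mul_sum]
    refine Finset.sum_congr rfl fun i _ => ?_
    rw [Finset.mul_sum]
    exact Finset.sum_congr rfl fun j _ => by ring
  rw [e1]
  simp
  field_simp
  ring

lemma Regular.continuous_baseGrad (hD : D.Regular) (c : ℝ) : Continuous (D.baseGrad c) := by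
  have hg := hD.continuous_gH
  refine (PiLp.continuous_toLp 2 _).comp (continuous_pi ?_)
  have key : ∀ k, Continuous fun x => D.baseGrad c x k := by
    refine forall_coord ?_ ?_ ?_ ?_ <;> simp only [baseGrad, mkPt_fl, mkPt_du, mkPt_ch, mkPt_no]
    · fun_prop
    · fun_prop
    · intro k
      split_ifs <;> fun_prop
    · intro i j; fun_prop
  exact key

lemma Regular.hasGradientAt_sample (hD : D.Regular) (i : Fin n) (j : Fin (N + 1))
    (x : Vec (dim n T N)) : HasGradientAt (D.sample i j) (D.sampleGrad i j x) x := by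
  refine HasGradientAt.add' (hD.hasGradientAt_base _ x) ?_
  have hno : HasFDerivAt (fun y : Vec (dim n T N) =>
      ∑ i', ∑ j', noise D.s i j i' j' * y (no i' j')) _ x :=
    HasFDerivAt.fun_sum fun i' _ => HasFDerivAt.fun_sum fun j' _ =>
      (hasFDerivAt_coord (no i' j') x).const_mul (noise D.s i j i' j')
  have h := hno.add ((hasFDerivAt_comp_chain hD.hasGradientAt_ψ x).const_mul (D.ω * switch N j))
  refine hasGradientAt_of_forall h fun v => ?_
  rw [sum_coord]
  simp only [add_apply,
    smul_apply, ContinuousLinearMap.comp_apply, toDual_chain_apply,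
    sum_apply, proj_apply', smul_eq_mul, noiseGrad,
    mkPt_fl, mkPt_du, mkPt_ch, mkPt_no, zero_mul, Finset.mul_sum]
  simp only [mul_assoc]
  ring

lemma Regular.continuous_sampleGrad (hD : D.Regular) (i : Fin n) (j : Fin (N + 1)) :
    Continuous (D.sampleGrad i j) := by
  have hg := hD.continuous_gψ
  refine (hD.continuous_baseGrad _).add ?_
  refine (PiLp.continuous_toLp 2 _).comp (continuous_pi ?_)
  have key : ∀ k, Continuous fun x => D.noiseGrad i j x k := by
    refine forall_coord ?_ ?_ ?_ ?_ <;> simp only [noiseGrad, mkPt_fl, mkPt_du, mkPt_ch, mkPt_no]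
    · fun_prop
    · fun_prop
    · intro k; fun_prop
    · intro i j; fun_prop
  exact key

lemma Regular.continuous_sample (hD : D.Regular) (i : Fin n) (j : Fin (N + 1)) :
    Continuous (D.sample i j) :=
  continuous_iff_continuousAt.2 fun x => (hD.hasGradientAt_sample i j x).continuousAt

/-- The problem that belongs to a design, where `r` is the initial value of the dummy
coordinate. -/
@[reducible]
def problem (hD : D.Regular) (r : ℝ) : Problem n :=
  finiteProblem dim_pos D.sample hD.continuous_sample (mkPt 0 r (fun _ => 0) fun _ _ => 0)

lemma Regular.localLoss (hD : D.Regular) {r : ℝ} (i : Fin n) :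
    (problem hD r).localLoss i = D.base (D.τ i) := by
  refine (finiteProblem_localLoss _ _ _ _ i).trans ?_
  ext x
  have h : ∑ j, D.sample i j x = ((N : ℝ) + 1) * D.base (D.τ i) x := by
    simp only [sample, Finset.sum_add_distrib]
    have h1 : ∑ j, ∑ i', ∑ j', noise D.s i j i' j' * x (no i' j') = 0 := by
      rw [Finset.sum_comm]
      refine Finset.sum_eq_zero fun i' _ => ?_
      rw [Finset.sum_comm]
      refine Finset.sum_eq_zero fun j' _ => ?_
      rw [← Finset.sum_mul, sum_noise, zero_mul]
    have h2 : ∑ j, D.ω * switch N j * D.ψ (chain x) = 0 := by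
      rw [← Finset.sum_mul, ← Finset.mul_sum, sum_switch]; ring
    rw [h1, h2]; simp
  rw [h, ← mul_assoc, inv_mul_cancel₀ (by positivity), one_mul]

lemma base_tilt (c : ℝ) (x : Vec (dim n T N)) : D.base c x = D.base 0 x + c * x fl := by
  unfold base; ring

lemma baseGrad_tilt (c : ℝ) (x : Vec (dim n T N)) :
    D.baseGrad c x = D.baseGrad 0 x + mkPt c 0 (fun _ => 0) fun _ _ => 0 := by
  refine ext_coord ?_ ?_ ?_ ?_ <;> simp [baseGrad]
  ring

lemma Regular.loss (hD : D.Regular) {r : ℝ} : (problem hD r).loss = D.base 0 := by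
  have hn : (n : ℝ) ≠ 0 := by exact_mod_cast hD.n_pos.ne'
  ext x
  have h : ∀ i, (problem hD r).localLoss i x = D.base 0 x + D.τ i * x fl := by
    intro i; rw [hD.localLoss]; exact base_tilt _ _
  simp only [Problem.loss]
  change 1 / (((Finset.univ : Finset (Fin n)).card : ℕ) : ℝ) *
    ∑ i, (problem hD r).localLoss i x = _
  simp only [h, Finset.sum_add_distrib, ← Finset.sum_mul, hD.sum_τ, Finset.card_univ,
    Fintype.card_fin, Finset.sum_const, nsmul_eq_mul]
  field_simp
  ring

lemma Regular.gradient_localLoss (hD : D.Regular) {r : ℝ} (i : Fin n) (x : Vec (dim n T N)) :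
    gradient ((problem hD r).localLoss i) x = D.baseGrad (D.τ i) x := by
  rw [hD.localLoss]; exact (hD.hasGradientAt_base _ x).gradient

lemma Regular.gradient_loss (hD : D.Regular) {r : ℝ} (x : Vec (dim n T N)) :
    gradient (problem hD r).loss x = D.baseGrad 0 x := by
  rw [hD.loss]; exact (hD.hasGradientAt_base _ x).gradient

lemma Regular.stochGrad_label (hD : D.Regular) {r : ℝ} (x : Vec (dim n T N)) (i : Fin n)
    (j : Fin (N + 1)) : (problem hD r).stochGrad x (label i j) = D.sampleGrad i j x :=
  (finiteProblem_stochGrad dim_pos hD.continuous_sample _ hD.hasGradientAt_sample x _).trans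
    (byLabel_label _ i j)

/-- Serves both the unbiasedness of the oracle and the balanced batches of `waitingRun`, in which
all noise cancels. -/
lemma sum_sampleGrad (i : Fin n) (x : Vec (dim n T N)) :
    ∑ j, D.sampleGrad i j x = ((N : ℝ) + 1) • D.baseGrad (D.τ i) x := by
  have h : ∑ j, D.noiseGrad i j x = 0 := by
    refine ext_coord ?_ ?_ ?_ ?_ <;> simp only [WithLp.ofLp_sum, Finset.sum_apply, noiseGrad,
      mkPt_fl, mkPt_du, mkPt_ch, mkPt_no, PiLp.zero_apply, Finset.sum_const_zero]
    · intro k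
      rw [← Finset.sum_mul, ← Finset.mul_sum, sum_switch]; ring
    · intro i' j'
      exact sum_noise _ _ _ _
  simp only [sampleGrad, Finset.sum_add_distrib, h, add_zero, Finset.sum_const, Finset.card_univ,
    Fintype.card_fin]
  rw [← Nat.cast_smul_eq_nsmul ℝ]
  push_cast
  rfl

lemma norm_sq_noiseGrad (i : Fin n) (j : Fin (N + 1)) (x : Vec (dim n T N)) :
    ‖D.noiseGrad i j x‖ ^ 2 = (D.ω * switch N j) ^ 2 * ‖D.gψ (chain x)‖ ^ 2
      + D.s ^ 2 * (1 - ((N : ℝ) + 1)⁻¹) := by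
  rw [norm_sq_coord, EuclideanSpace.real_norm_sq_eq]
  simp only [noiseGrad, mkPt_fl, mkPt_du, mkPt_ch, mkPt_no, mul_pow, Finset.mul_sum]
  have h : ∑ i', ∑ j', noise D.s i j i' j' ^ 2 = D.s ^ 2 * (1 - ((N : ℝ) + 1)⁻¹) := by
    rw [Finset.sum_eq_single i]
    · have : ∀ j', noise D.s i j i j' ^ 2 = D.s ^ 2 *
          ((if j' = j then 1 - 2 * ((N : ℝ) + 1)⁻¹ else 0) + ((N : ℝ) + 1)⁻¹ ^ 2) := by
        intro j'
        simp only [noise, if_true]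
        split_ifs <;> ring
      simp only [this]
      rw [← Finset.mul_sum, Finset.sum_add_distrib]
      simp only [Finset.sum_ite_eq', Finset.mem_univ, if_true, Finset.sum_const,
        Finset.card_univ, Fintype.card_fin, nsmul_eq_mul]
      push_cast
      have : ((N : ℝ) + 1) ≠ 0 := by positivity
      field_simp
      ring
    · intro i' _ hi'
      exact Finset.sum_eq_zero fun j' _ => by simp [noise, hi']
    · simp
  rw [h]
  ring

lemma sum_switch_sq : ∑ j, switch N j ^ 2 = ((N : ℝ) + 1) * N := by
  have : ∀ j : Fin (N + 1), switch N j ^ 2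
      = (if j = 0 then ((N : ℝ) + 1) ^ 2 - 2 * ((N : ℝ) + 1) else 0) + 1 := by
    intro j
    unfold switch
    split_ifs <;> ring
  simp only [this, Finset.sum_add_distrib]
  simp
  ring

/-- The switch is on with probability `1 / (N + 1)` and has variance `N`, so a mask with gradient
`g` costs `ω ^ 2 * N * ‖g‖ ^ 2`: rarity is paid for by variance. -/
lemma Regular.inOracleClass (hD : D.Regular) {r σ : ℝ}
    (hσ : ∀ z, D.ω ^ 2 * N * ‖D.gψ z‖ ^ 2 + D.s ^ 2 ≤ σ ^ 2) :
    (problem hD r).InOracleClass σ := by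
  have hN : ((N : ℝ) + 1) ≠ 0 := by positivity
  refine finiteProblem_inOracleClass (gl := fun i x => D.baseGrad (D.τ i) x) dim_pos
    hD.continuous_sample _ hD.hasGradientAt_sample hD.continuous_sampleGrad
    (fun i x => ?_) (fun i x => ?_)
  · rw [sum_sampleGrad, smul_smul, inv_mul_cancel₀ hN, one_smul]
  · have : ∀ j, ‖D.sampleGrad i j x - D.baseGrad (D.τ i) x‖ ^ 2
        = switch N j ^ 2 * (D.ω ^ 2 * ‖D.gψ (chain x)‖ ^ 2)
          + D.s ^ 2 * (1 - ((N : ℝ) + 1)⁻¹) := by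
      intro j
      rw [sampleGrad, add_sub_cancel_left, norm_sq_noiseGrad]; ring
    simp only [this, Finset.sum_add_distrib, ← Finset.sum_mul, sum_switch_sq]
    simp only [Finset.sum_const, Finset.card_univ, Fintype.card_fin, nsmul_eq_mul]
    push_cast
    refine le_trans (le_of_eq (b := D.ω ^ 2 * N * ‖D.gψ (chain x)‖ ^ 2
      + D.s ^ 2 * (1 - ((N : ℝ) + 1)⁻¹)) (by field_simp)) (le_trans ?_ (hσ (chain x)))
    have : 0 < ((N : ℝ) + 1)⁻¹ := by positivity
    nlinarith [sq_nonneg D.s]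

end Design

/-! ### Membership of the hard instances in the problem classes -/

/-- Mean value inequality for `cos t + sin x * t`, whose derivative is at most `|y - x|` in modulus
between `x` and `y`. -/
lemma abs_cos_sub_le (x y : ℝ) :
    |Real.cos y - Real.cos x + Real.sin x * (y - x)| ≤ (y - x) ^ 2 := by
  have h := Convex.norm_image_sub_le_of_norm_hasDerivWithin_le (s := Set.uIcc x y)
    (f := fun t => Real.cos t + Real.sin x * t) (f' := fun t => -Real.sin t + Real.sin x * 1)
    (C := |y - x|) (x := x) (y := y)
    (fun t _ => ((Real.hasDerivAt_cos t).add
      ((hasDerivAt_id t).const_mul (Real.sin x))).hasDerivWithinAt)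
    (fun t ht => ?_) (convex_uIcc x y) Set.left_mem_uIcc Set.right_mem_uIcc
  · rw [Real.norm_eq_abs, Real.norm_eq_abs] at h
    calc _ = |Real.cos y + Real.sin x * y - (Real.cos x + Real.sin x * x)| := by ring_nf
      _ ≤ _ := h
      _ = (y - x) ^ 2 := by rw [← sq, sq_abs]
  · have h1 : |Real.sin x - Real.sin t| ≤ |x - t| := by
      have := Real.abs_sin_sub_sin_le x t
      exact this
    have h2 : |t - x| ≤ |y - x| := Set.abs_sub_left_of_mem_uIcc ht
    rw [Real.norm_eq_abs]
    calc |-Real.sin t + Real.sin x * 1| = |Real.sin x - Real.sin t| := by ring_nf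
      _ ≤ |x - t| := h1
      _ = |t - x| := abs_sub_comm _ _
      _ ≤ _ := h2

/-- Since `sin A * sin B` is half of `cos (A - B) - cos (A + B)`, the remainder is half of two
cosine remainders, and the squares of difference and sum of the increments average to the right-hand
side. -/
lemma sin_mul_sin_sub_le (A B A' B' : ℝ) :
    Real.sin A' * Real.sin B' - Real.sin A * Real.sin B
      - Real.cos A * Real.sin B * (A' - A) - Real.sin A * Real.cos B * (B' - B)
      ≤ (A' - A) ^ 2 + (B' - B) ^ 2 := by
  have h1 := (abs_le.1 (abs_cos_sub_le (A - B) (A' - B'))).2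
  have h2 := (abs_le.1 (abs_cos_sub_le (A + B) (A' + B'))).1
  rw [Real.cos_sub, Real.cos_sub, Real.sin_sub] at h1
  rw [Real.cos_add, Real.cos_add, Real.sin_add] at h2
  nlinarith

lemma abs_sin_mul_cos_sub_le (A B A' B' : ℝ) :
    |Real.sin A * Real.cos B - Real.sin A' * Real.cos B'| ≤ |A - A'| + |B - B'| := by
  have h1 : |Real.sin A - Real.sin A'| ≤ |A - A'| := Real.abs_sin_sub_sin_le A A'
  have h2 : |Real.cos B - Real.cos B'| ≤ |B - B'| := Real.abs_cos_sub_cos_le B B'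
  calc _ = |(Real.sin A - Real.sin A') * Real.cos B
        + Real.sin A' * (Real.cos B - Real.cos B')| := by ring_nf
    _ ≤ |Real.sin A - Real.sin A'| * |Real.cos B|
        + |Real.sin A'| * |Real.cos B - Real.cos B'| := by
      rw [← abs_mul, ← abs_mul]; exact abs_add_le _ _
    _ ≤ |A - A'| * 1 + 1 * |B - B'| := by
      gcongr
      · exact Real.abs_cos_le_one B
      · exact Real.abs_sin_le_one A'
    _ = _ := by ring

namespace Design

variable {n T N : ℕ} {D : Design n T N}

lemma Regular.bddBelow_base (hD : D.Regular) {B : ℝ} (ha : 0 < D.a) (he : 0 ≤ D.e)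
    (hθ : 0 ≤ D.θ) (hB : ∀ z, B ≤ D.H z) (c : ℝ) (x : Vec (dim n T N)) :
    B - (D.b + c) ^ 2 / (2 * D.a) - D.θ * D.lam ≤ D.base c x := by
  have h1 : -((D.b + c) ^ 2 / (2 * D.a)) ≤ D.a / 2 * x fl ^ 2 + (D.b + c) * x fl := by
    rw [← sub_nonneg]
    have : D.a / 2 * x fl ^ 2 + (D.b + c) * x fl - -((D.b + c) ^ 2 / (2 * D.a))
        = (D.a * x fl + (D.b + c)) ^ 2 / (2 * D.a) := by field_simp; ring
    rw [this]; positivity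
  have h2 : D.θ * D.lam * (Real.sin (x fl / D.lam) * Real.sin (x (ch (Fin.last T)) / D.lam))
      ≤ D.θ * D.lam := by
    refine mul_le_of_le_one_right (mul_nonneg hθ hD.lam_pos.le) ?_
    refine le_trans (le_abs_self _) ?_
    rw [abs_mul]
    exact mul_le_one₀ (Real.abs_sin_le_one _) (abs_nonneg _) (Real.abs_sin_le_one _)
  have h3 : 0 ≤ D.e / 2 * (x du ^ 2 + ∑ i, ∑ j, x (no i j) ^ 2) := by positivity
  have h4 := hB (chain x)
  unfold base
  linarith

/-- The difference of gradients splits into a block-diagonal part `u` with constant `M` and the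
coupling part `v`, which lives in two coordinates and has constant `2 * (θ / lam)`. -/
lemma Regular.norm_baseGrad_sub_le (hD : D.Regular) {M : ℝ} (ha : 0 ≤ D.a) (haM : D.a ≤ M)
    (he : 0 ≤ D.e) (heM : D.e ≤ M) (hθ : 0 ≤ D.θ)
    (hH : ∀ z z', ‖D.gH z - D.gH z'‖ ≤ M * ‖z - z'‖) (c : ℝ) (x y : Vec (dim n T N)) :
    ‖D.baseGrad c x - D.baseGrad c y‖ ≤ (M + 2 * (D.θ / D.lam)) * ‖x - y‖ := by
  have hl := hD.lam_pos
  have hM : 0 ≤ M := ha.trans haM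
  set u : Vec (dim n T N) := mkPt (D.a * (x fl - y fl)) (D.e * (x du - y du))
    (fun k => (D.gH (chain x) - D.gH (chain y)) k) (fun i j => D.e * (x (no i j) - y (no i j)))
    with hu
  set p := D.θ * (Real.sin (x (ch (Fin.last T)) / D.lam) * Real.cos (x fl / D.lam)
    - Real.sin (y (ch (Fin.last T)) / D.lam) * Real.cos (y fl / D.lam)) with hp
  set q := D.θ * (Real.sin (x fl / D.lam) * Real.cos (x (ch (Fin.last T)) / D.lam)
    - Real.sin (y fl / D.lam) * Real.cos (y (ch (Fin.last T)) / D.lam)) with hq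
  set v : Vec (dim n T N) := mkPt p 0 (fun k => if k = Fin.last T then q else 0)
    (fun _ _ => 0) with hv
  have huv : D.baseGrad c x - D.baseGrad c y = u - v := by
    refine ext_coord ?_ ?_ ?_ ?_
    · simp [baseGrad, hu, hv, hp]; ring
    · simp [baseGrad, hu, hv]; ring
    · intro k
      simp only [baseGrad, hu, hv, hq, PiLp.sub_apply, mkPt_ch]
      split_ifs <;> ring
    · intro i j; simp [baseGrad, hu, hv]; ring
  have hnu : ‖u‖ ≤ M * ‖x - y‖ := by
    refine abs_le_of_sq_le_sq' ?_ (by positivity) |>.2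
    rw [norm_sq_coord, mul_pow, norm_sq_coord (x - y)]
    simp only [hu, mkPt_fl, mkPt_du, mkPt_ch, mkPt_no, mul_pow]
    have h1 : ∑ k, ((D.gH (chain x) - D.gH (chain y)) k) ^ 2
        ≤ M ^ 2 * ∑ k, (x - y) (ch k) ^ 2 := by
      rw [← EuclideanSpace.real_norm_sq_eq, ← norm_sq_chain, ← mul_pow, map_sub]
      exact pow_le_pow_left₀ (norm_nonneg _) (hH _ _) 2
    have h2 : ∑ i, ∑ j, D.e ^ 2 * (x (no i j) - y (no i j)) ^ 2
        ≤ M ^ 2 * ∑ i, ∑ j, (x - y) (no i j) ^ 2 := by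
      simp only [← Finset.mul_sum, PiLp.sub_apply]
      gcongr
    have h3 : D.a ^ 2 ≤ M ^ 2 := pow_le_pow_left₀ ha haM 2
    have h4 : D.e ^ 2 ≤ M ^ 2 := pow_le_pow_left₀ he heM 2
    have h5 := mul_le_mul_of_nonneg_right h3 (sq_nonneg (x fl - y fl))
    have h6 := mul_le_mul_of_nonneg_right h4 (sq_nonneg (x du - y du))
    simp only [PiLp.sub_apply] at *
    linarith
  have hdiff : ∀ k, |x k / D.lam - y k / D.lam| = |(x - y) k| / D.lam := by
    intro k
    rw [← sub_div, abs_div, abs_of_pos hl]; rfl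
  have hsplit : (x - y) fl ^ 2 + (x - y) (ch (Fin.last T)) ^ 2 ≤ ‖x - y‖ ^ 2 := by
    rw [norm_sq_coord]
    have h1 : (x - y) (ch (Fin.last T)) ^ 2 ≤ ∑ k, (x - y) (ch k) ^ 2 :=
      Finset.single_le_sum (f := fun k => (x - y) (ch k) ^ 2) (fun _ _ => sq_nonneg _)
        (Finset.mem_univ _)
    have h2 : 0 ≤ ∑ i, ∑ j, (x - y) (no i j) ^ 2 := by positivity
    linarith [sq_nonneg ((x - y) du)]
  have hpa : |p| ≤ D.θ / D.lam * (|(x - y) fl| + |(x - y) (ch (Fin.last T))|) := by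
    have := abs_sin_mul_cos_sub_le (x (ch (Fin.last T)) / D.lam) (x fl / D.lam)
      (y (ch (Fin.last T)) / D.lam) (y fl / D.lam)
    rw [hdiff, hdiff] at this
    rw [hp, abs_mul, abs_of_nonneg hθ]
    refine (mul_le_mul_of_nonneg_left this hθ).trans (le_of_eq ?_)
    ring
  have hqa : |q| ≤ D.θ / D.lam * (|(x - y) fl| + |(x - y) (ch (Fin.last T))|) := by
    have := abs_sin_mul_cos_sub_le (x fl / D.lam) (x (ch (Fin.last T)) / D.lam)
      (y fl / D.lam) (y (ch (Fin.last T)) / D.lam)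
    rw [hdiff, hdiff] at this
    rw [hq, abs_mul, abs_of_nonneg hθ]
    refine (mul_le_mul_of_nonneg_left this hθ).trans (le_of_eq ?_)
    ring
  have hnv : ‖v‖ ≤ 2 * (D.θ / D.lam) * ‖x - y‖ := by
    refine abs_le_of_sq_le_sq' ?_ (by positivity) |>.2
    have hvs : ‖v‖ ^ 2 = p ^ 2 + q ^ 2 := by
      rw [norm_sq_coord]
      simp [hv, ite_pow]
    have hs : (|(x - y) fl| + |(x - y) (ch (Fin.last T))|) ^ 2 ≤ 2 * ‖x - y‖ ^ 2 := by
      have h1 := sq_abs ((x - y) fl)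
      have h2 := sq_abs ((x - y) (ch (Fin.last T)))
      nlinarith [sq_nonneg (|(x - y) fl| - |(x - y) (ch (Fin.last T))|)]
    have hp2 : p ^ 2 ≤ (D.θ / D.lam) ^ 2 * (2 * ‖x - y‖ ^ 2) := by
      rw [← sq_abs]
      refine (pow_le_pow_left₀ (abs_nonneg _) hpa 2).trans ?_
      rw [mul_pow]
      gcongr
    have hq2 : q ^ 2 ≤ (D.θ / D.lam) ^ 2 * (2 * ‖x - y‖ ^ 2) := by
      rw [← sq_abs]
      refine (pow_le_pow_left₀ (abs_nonneg _) hqa 2).trans ?_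
      rw [mul_pow]
      gcongr
    rw [hvs]
    nlinarith
  rw [huv]
  calc ‖u - v‖ ≤ ‖u‖ + ‖v‖ := norm_sub_le _ _
    _ ≤ _ := by linarith

lemma Regular.inFunctionClass (hD : D.Regular) {r M B L ζ : ℝ} (ha : 0 < D.a)
    (haM : D.a ≤ M) (he : 0 ≤ D.e) (heM : D.e ≤ M) (hθ : 0 ≤ D.θ)
    (hH : ∀ z z', ‖D.gH z - D.gH z'‖ ≤ M * ‖z - z'‖) (hB : ∀ z, B ≤ D.H z)
    (hL : M + 2 * (D.θ / D.lam) ≤ L) (hτ : (n : ℝ)⁻¹ * ∑ i, D.τ i ^ 2 ≤ ζ ^ 2) :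
    (problem hD r).InFunctionClass L ζ where
  contDiff := by
    rw [hD.loss]
    exact contDiff_one_of_hasGradientAt (hD.hasGradientAt_base 0) (hD.continuous_baseGrad 0)
  bddBelow i _ := by
    rw [hD.localLoss]
    exact ⟨_, Set.forall_mem_range.2 (hD.bddBelow_base ha he hθ hB _)⟩
  differentiable i _ := by
    rw [hD.localLoss]
    exact fun x => (hD.hasGradientAt_base _ x).hasFDerivAt.differentiableAt
  smooth i _ x y := by
    rw [hD.gradient_localLoss, hD.gradient_localLoss]
    exact (hD.norm_baseGrad_sub_le ha.le haM he heM hθ hH _ x y).trans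
      (mul_le_mul_of_nonneg_right hL (norm_nonneg _))
  dissimilarity x := by
    have h : ∀ i, ‖gradient ((problem hD r).localLoss i) x - gradient (problem hD r).loss x‖ ^ 2
        = D.τ i ^ 2 := by
      intro i
      rw [hD.gradient_localLoss, hD.gradient_loss, baseGrad_tilt, add_sub_cancel_left,
        norm_sq_coord]
      simp
    change 1 / (((Finset.univ : Finset (Fin n)).card : ℕ) : ℝ) * ∑ i,
      ‖gradient ((problem hD r).localLoss i) x - gradient (problem hD r).loss x‖ ^ 2 ≤ ζ ^ 2
    simp only [h, Finset.card_univ, Fintype.card_fin, one_div]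
    exact hτ

/-- The coupling is not convex. Its defect is paid for by the surplus `η` of `a` over `μ` in the
floor coordinate and by the surplus `η` of `H` in the last chain coordinate. -/
lemma Regular.base_strongConvex (hD : D.Regular) {μ η : ℝ} (ha : μ + η ≤ D.a) (he : μ ≤ D.e)
    (hθ : 0 ≤ D.θ) (hη : 2 * (D.θ / D.lam) ≤ η)
    (hH : ∀ z z', D.H z + inner ℝ (D.gH z) (z' - z) + μ / 2 * ‖z' - z‖ ^ 2
      + η / 2 * (z' (Fin.last T) - z (Fin.last T)) ^ 2 ≤ D.H z') (c : ℝ)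
    (x y : Vec (dim n T N)) :
    D.base c x + inner ℝ (D.baseGrad c x) (y - x) + μ / 2 * ‖y - x‖ ^ 2 ≤ D.base c y := by
  have hl := hD.lam_pos
  have h1 := hH (chain x) (chain y)
  rw [← map_sub, norm_sq_chain, inner_eq_sum] at h1
  have h2 := mul_le_mul_of_nonneg_left (sin_mul_sin_sub_le (x fl / D.lam)
    (x (ch (Fin.last T)) / D.lam) (y fl / D.lam) (y (ch (Fin.last T)) / D.lam))
    (mul_nonneg hθ hl.le)
  have h3 : D.θ * D.lam * ((y fl / D.lam - x fl / D.lam) ^ 2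
      + (y (ch (Fin.last T)) / D.lam - x (ch (Fin.last T)) / D.lam) ^ 2)
      = D.θ / D.lam * ((y fl - x fl) ^ 2 + (y (ch (Fin.last T)) - x (ch (Fin.last T))) ^ 2) := by
    field_simp
  rw [h3] at h2
  have h4 : D.θ / D.lam * ((y fl - x fl) ^ 2 + (y (ch (Fin.last T)) - x (ch (Fin.last T))) ^ 2)
      ≤ η / 2 * ((y fl - x fl) ^ 2 + (y (ch (Fin.last T)) - x (ch (Fin.last T))) ^ 2) :=
    mul_le_mul_of_nonneg_right (by linarith) (by positivity)
  have h5 : ∑ i, ∑ j, y (no i j) ^ 2 = ∑ i, ∑ j, x (no i j) ^ 2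
      + 2 * ∑ i, ∑ j, x (no i j) * (y (no i j) - x (no i j))
      + ∑ i, ∑ j, (y (no i j) - x (no i j)) ^ 2 := by
    simp only [Finset.mul_sum, ← Finset.sum_add_distrib]
    exact Finset.sum_congr rfl fun i _ => Finset.sum_congr rfl fun j _ => by ring
  have h6 : 0 ≤ ∑ i, ∑ j, (y (no i j) - x (no i j)) ^ 2 := by positivity
  rw [inner_eq_sum, sum_coord, norm_sq_coord]
  simp only [base, baseGrad, mkPt_fl, mkPt_du, mkPt_ch, mkPt_no, PiLp.sub_apply, sub_mul, ite_mul,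
    zero_mul, Finset.sum_sub_distrib, Finset.sum_ite_eq', Finset.mem_univ, if_true, chain_apply,
    map_sub] at h1 ⊢
  have h7 : ∑ i, ∑ j, D.e * x (no i j) * (y (no i j) - x (no i j))
      = D.e * ∑ i, ∑ j, x (no i j) * (y (no i j) - x (no i j)) := by
    simp only [Finset.mul_sum, mul_assoc]
  rw [h5, h7]
  have h8 : D.θ * D.lam * (Real.sin (y fl / D.lam) * Real.sin (y (ch (Fin.last T)) / D.lam)
      - Real.sin (x fl / D.lam) * Real.sin (x (ch (Fin.last T)) / D.lam)
      - Real.cos (x fl / D.lam) * Real.sin (x (ch (Fin.last T)) / D.lam)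
        * (y fl / D.lam - x fl / D.lam)
      - Real.sin (x fl / D.lam) * Real.cos (x (ch (Fin.last T)) / D.lam)
        * (y (ch (Fin.last T)) / D.lam - x (ch (Fin.last T)) / D.lam))
      = D.θ * D.lam * (Real.sin (y fl / D.lam) * Real.sin (y (ch (Fin.last T)) / D.lam))
      - D.θ * D.lam * (Real.sin (x fl / D.lam) * Real.sin (x (ch (Fin.last T)) / D.lam))
      - D.θ * (Real.cos (x fl / D.lam) * Real.sin (x (ch (Fin.last T)) / D.lam)) * (y fl - x fl)
      - D.θ * (Real.sin (x fl / D.lam) * Real.cos (x (ch (Fin.last T)) / D.lam))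
        * (y (ch (Fin.last T)) - x (ch (Fin.last T))) := by
    field_simp
  rw [h8] at h2
  have h9 := mul_nonneg (sub_nonneg.2 he) (sq_nonneg (y du - x du))
  have h10 := mul_nonneg (sub_nonneg.2 he) h6
  have h11 := mul_nonneg (sub_nonneg.2 ha) (sq_nonneg (y fl - x fl))
  nlinarith

lemma Regular.isStronglyConvex (hD : D.Regular) {r μ η : ℝ} (ha : μ + η ≤ D.a)
    (he : μ ≤ D.e) (hθ : 0 ≤ D.θ) (hη : 2 * (D.θ / D.lam) ≤ η)
    (hH : ∀ z z', D.H z + inner ℝ (D.gH z) (z' - z) + μ / 2 * ‖z' - z‖ ^ 2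
      + η / 2 * (z' (Fin.last T) - z (Fin.last T)) ^ 2 ≤ D.H z') :
    (problem hD r).IsStronglyConvex μ := by
  intro i _ x y
  rw [hD.gradient_localLoss, hD.localLoss]
  exact hD.base_strongConvex ha he hθ hη hH _ x y

/-- Where the sine is one, the cosine is zero, so the chain equations hold at `z` for every value of
the floor coordinate, and the floor equation is solved by continuity. The initial dummy coordinate
then adjusts the distance to exactly `R`. -/
lemma Regular.exists_hasInitialDistance (hD : D.Regular) {μ η R : ℝ} (hμ : 0 ≤ μ)
    (ha0 : 0 < D.a) (ha : μ + η ≤ D.a)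
    (he : μ ≤ D.e) (hθ : 0 ≤ D.θ) (hη : 2 * (D.θ / D.lam) ≤ η)
    (hH : ∀ z z', D.H z + inner ℝ (D.gH z) (z' - z) + μ / 2 * ‖z' - z‖ ^ 2
      + η / 2 * (z' (Fin.last T) - z (Fin.last T)) ^ 2 ≤ D.H z')
    {z : Vec (T + 1)} (hz : D.gH z = 0) (hsin : Real.sin (z (Fin.last T) / D.lam) = 1)
    (hb : D.θ ≤ D.b) (hR0 : 0 ≤ R) (hR : ((D.b + D.θ) / D.a) ^ 2 + ‖z‖ ^ 2 ≤ R ^ 2) :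
    ∃ r, (problem hD r).HasInitialDistance R := by
  have hcos : Real.cos (z (Fin.last T) / D.lam) = 0 := by
    have := Real.sin_sq_add_cos_sq (z (Fin.last T) / D.lam)
    rw [hsin] at this
    nlinarith
  obtain ⟨u, ⟨hu1, hu2⟩, hu⟩ : ∃ u ∈ Set.Icc (-((D.b + D.θ) / D.a)) 0,
      D.a * u + D.b - D.θ * Real.cos (u / D.lam) = 0 := by
    have hc : ContinuousOn (fun u => D.a * u + D.b - D.θ * Real.cos (u / D.lam))
        (Set.Icc (-((D.b + D.θ) / D.a)) 0) := by fun_prop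
    refine intermediate_value_Icc (neg_nonpos.2 ?_) hc ⟨?_, ?_⟩
    · exact div_nonneg (by linarith) ha0.le
    · have h1 : D.a * -((D.b + D.θ) / D.a) = -(D.b + D.θ) := by field_simp
      have h2 := Real.neg_one_le_cos (-((D.b + D.θ) / D.a) / D.lam)
      simp only [h1]
      nlinarith
    · simp; exact hb
  set xm : Vec (dim n T N) := mkPt u 0 z fun _ _ => 0 with hxm
  have hgrad : D.baseGrad 0 xm = 0 := by
    refine ext_coord ?_ ?_ ?_ ?_
    · simp [baseGrad, hxm, hsin, hu]
    · simp [baseGrad, hxm]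
    · intro k
      simp [baseGrad, hxm, hcos, hz]
    · intro i j; simp [baseGrad, hxm]
  have hxs : ‖xm‖ ^ 2 = u ^ 2 + ‖z‖ ^ 2 := by
    rw [norm_sq_coord, EuclideanSpace.real_norm_sq_eq]; simp [hxm]
  have hle : ‖xm‖ ^ 2 ≤ R ^ 2 := by
    have : u ^ 2 ≤ ((D.b + D.θ) / D.a) ^ 2 := sq_le_sq' hu1 (by linarith)
    linarith
  refine ⟨Real.sqrt (R ^ 2 - ‖xm‖ ^ 2), xm, ?_, ?_⟩
  · rw [hD.loss]
    intro y _
    have := hD.base_strongConvex ha he hθ hη hH 0 xm y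
    rw [hgrad, inner_zero_left] at this
    have h2 : 0 ≤ μ / 2 * ‖y - xm‖ ^ 2 := by positivity
    change D.base 0 xm ≤ D.base 0 y
    linarith
  · have : ‖(mkPt 0 (Real.sqrt (R ^ 2 - ‖xm‖ ^ 2)) (fun _ => 0) fun _ _ => 0 : Vec (dim n T N))
        - xm‖ ^ 2 = R ^ 2 := by
      have h0 : ‖xm‖ ^ 2 = u ^ 2 + ∑ k, z k ^ 2 := by
        rw [hxs, EuclideanSpace.real_norm_sq_eq]
      have h1 := Real.sq_sqrt (sub_nonneg.2 hle)
      generalize Real.sqrt (R ^ 2 - ‖xm‖ ^ 2) = r at h1 ⊢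
      rw [norm_sq_coord]
      simp [hxm]
      linarith
    exact (sq_eq_sq₀ (norm_nonneg _) hR0).1 this

/-- The lower bound on the infimum shows that the gap with zero dummy coordinate is at most `Δ`; the
quadratic in the dummy coordinate makes up the difference. -/
lemma Regular.exists_hasInitialGap (hD : D.Regular) {B Δ : ℝ} (ha : 0 < D.a) (he : 0 < D.e)
    (hθ : 0 ≤ D.θ) (hB : ∀ z, B ≤ D.H z)
    (hΔ : D.H 0 - B + D.b ^ 2 / (2 * D.a) + D.θ * D.lam ≤ Δ) :
    ∃ r, (problem hD r).HasInitialGap Δ := by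
  have hlow := hD.bddBelow_base ha he.le hθ hB 0
  set m := B - (D.b + 0) ^ 2 / (2 * D.a) - D.θ * D.lam with hm
  have hbdd : BddBelow (Set.range (D.base 0)) := ⟨m, by rintro _ ⟨x, rfl⟩; exact hlow x⟩
  have hinf : m ≤ ⨅ x, D.base 0 x := le_ciInf hlow
  have hstart : ∀ r : ℝ, D.base 0 (mkPt 0 r (fun _ => 0) fun _ _ => 0 : Vec (dim n T N))
      = D.H 0 + D.e / 2 * r ^ 2 := by
    intro r
    have : chain (mkPt 0 r (fun _ => 0) fun _ _ => 0 : Vec (dim n T N)) = 0 := by ext k; simp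
    simp only [base, this, mkPt_fl, mkPt_du, mkPt_ch, mkPt_no]
    simp
  obtain ⟨r, hr⟩ : ∃ r : ℝ, r ^ 2 = 2 * (Δ - (D.H 0 - ⨅ x, D.base 0 x)) / D.e := by
    refine ⟨_, Real.sq_sqrt (div_nonneg ?_ he.le)⟩
    simp only [add_zero] at hm
    linarith
  refine ⟨r, ?_⟩
  unfold Problem.HasInitialGap
  rw [hD.loss]
  refine ⟨hbdd, ?_⟩
  change D.base 0 _ - (⨅ x, D.base 0 x) = Δ
  rw [hstart, hr]
  generalize (⨅ x, D.base 0 x) = I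
  field_simp
  ring

/-- On the embedded chain all other terms vanish, so the restriction to this subspace is `H` itself.
-/
lemma Regular.isNonConvex (hD : D.Regular) {r : ℝ} (hH : ¬ ConvexOn ℝ Set.univ D.H) :
    (problem hD r).IsNonConvex := by
  intro i _ hconv
  rw [hD.localLoss] at hconv
  refine hH ?_
  let emb : Vec (T + 1) →ₗ[ℝ] Vec (dim n T N) :=
    { toFun := fun z => mkPt 0 0 z fun _ _ => 0
      map_add' := fun x y => by refine ext_coord ?_ ?_ ?_ ?_ <;> simp
      map_smul' := fun c x => by refine ext_coord ?_ ?_ ?_ ?_ <;> simp }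
  have h := hconv.comp_linearMap emb
  have h2 : D.base (D.τ i) ∘ emb = D.H := by
    ext z
    have : emb z = mkPt 0 0 z fun _ _ => 0 := rfl
    simp only [Function.comp_apply, this, base, chain_mkPt]
    simp
  rw [h2] at h
  simpa using h

end Design

/-! ### A method that waits for balanced batches -/

section Waiting

variable {n N : ℕ}

/-- The samples of one iteration with batch size `N + 1`. -/
abbrev Batch (n N : ℕ) : Type :=
  Fin (N + 1) × ↥(Finset.univ : Finset (Fin n)) → Vec 1

/-- The batch in which every node sees each of its data points exactly once. -/
def balanced (n N : ℕ) : Batch n N := fun p => label p.2.1 p.1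

/-- The law of a batch. -/
def batchLaw (n N : ℕ) : Measure (Batch n N) :=
  Measure.pi fun p : Fin (N + 1) × ↥(Finset.univ : Finset (Fin n)) => labelLaw n N p.2.1

instance : IsProbabilityMeasure (batchLaw n N) := by unfold batchLaw; infer_instance

lemma batchLaw_balanced_ne_zero : batchLaw n N {balanced n N} ≠ 0 := by
  unfold batchLaw
  rw [Measure.pi_singleton]
  refine Finset.prod_ne_zero_iff.2 fun p _ => ?_
  rw [balanced, labelLaw_label]
  exact ENNReal.inv_ne_zero.2 (by finiteness)

/-- The law of an infinite sequence of batches. -/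
def batchesLaw (n N : ℕ) : Measure (ℕ → Batch n N) := Measure.infinitePi fun _ => batchLaw n N

instance : IsProbabilityMeasure (batchesLaw n N) := by unfold batchesLaw; infer_instance

/-- The number of balanced batches among the first `t` batches. -/
def balancedCount (t : ℕ) (ω : ℕ → Batch n N) : ℕ :=
  ∑ s ∈ Finset.range t, Set.indicator {balanced n N} (fun _ => 1) (ω s)

lemma balancedCount_succ (t : ℕ) (ω : ℕ → Batch n N) :
    balancedCount (t + 1) ω
      = balancedCount t ω + Set.indicator {balanced n N} (fun _ => 1) (ω t) :=
  Finset.sum_range_succ _ _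

lemma balancedCount_mono (ω : ℕ → Batch n N) : Monotone fun t => balancedCount t ω :=
  monotone_nat_of_le_succ fun t => by rw [balancedCount_succ]; exact Nat.le_add_right _ _

/-- The count rises by at most one per batch, hence it takes every value, and it leaves a value
precisely at a balanced batch. -/
lemma exists_of_lt_balancedCount {t k : ℕ} {ω : ℕ → Batch n N} (h : k < balancedCount t ω) :
    ∃ s < t, balancedCount s ω = k ∧ ω s = balanced n N := by
  induction t with
  | zero => simp [balancedCount] at h
  | succ t ih =>
    rw [balancedCount_succ] at h
    by_cases hk : k < balancedCount t ω
    · obtain ⟨s, hs, h'⟩ := ih hk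
      exact ⟨s, by omega, h'⟩
    · by_cases hω : ω t = balanced n N
      · rw [Set.indicator_of_mem (by simpa using hω)] at h
        exact ⟨t, by omega, by omega, hω⟩
      · rw [Set.indicator_of_notMem (by simpa using hω)] at h
        omega

/-- The information that is available before the `t`-th batch is drawn. -/
def batchFiltration (n N : ℕ) :
    Filtration ℕ (inferInstance : MeasurableSpace (ℕ → Batch n N)) where
  seq t := ⨆ s ∈ Set.Iio t, MeasurableSpace.comap (fun ω : ℕ → Batch n N => ω s) inferInstance
  mono' _ _ h := biSup_mono fun _ hs => lt_of_lt_of_le hs h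
  le' _ := iSup₂_le fun s _ => (measurable_pi_apply s).comap_le

lemma measurable_batch {s t : ℕ} (h : s < t) :
    Measurable[batchFiltration n N t] fun ω : ℕ → Batch n N => ω s :=
  measurable_iff_comap_le.2 (le_iSup₂ (f := fun s (_ : s ∈ Set.Iio t) =>
    MeasurableSpace.comap (fun ω : ℕ → Batch n N => ω s) inferInstance) s h)

lemma measurable_balancedCount (t : ℕ) :
    Measurable[batchFiltration n N t] (balancedCount (n := n) (N := N) t) := by
  refine Finset.measurable_sum _ fun s hs => ?_
  have h : Measurable (Set.indicator {balanced n N} fun _ => (1 : ℕ)) :=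
    measurable_const.indicator (measurableSet_singleton _)
  exact h.comp (measurable_batch (Finset.mem_range.1 hs))

lemma iIndepFun_batch :
    iIndepFun (fun s (ω : ℕ → Batch n N) => ω s) (batchesLaw n N) :=
  iIndepFun_infinitePi (P := fun _ => batchLaw n N) (X := fun _ ω => ω) fun _ => measurable_id

lemma indep_batch (t : ℕ) :
    Indep (batchFiltration n N t)
      (MeasurableSpace.comap (fun ω : ℕ → Batch n N => ω t) inferInstance)
      (batchesLaw n N) := by
  have h := indep_iSup_of_disjoint (fun s => (measurable_pi_apply s).comap_le)
    iIndepFun_batch (S := Set.Iio t) (T := {t}) (by simp) (μ := batchesLaw n N)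
  simp only [Set.mem_singleton_iff, iSup_iSup_eq_left] at h
  exact h

lemma map_batch (t : ℕ) :
    Measure.map (fun ω : ℕ → Batch n N => ω t) (batchesLaw n N) = batchLaw n N :=
  (measurePreserving_eval_infinitePi (fun _ => batchLaw n N) t).map_eq

/-- Second Borel–Cantelli lemma: the batches are independent and each is balanced with the same
positive probability. -/
lemma ae_balancedCount_tendsto :
    ∀ᵐ ω ∂(batchesLaw n N), Tendsto (fun t => balancedCount t ω) atTop atTop := by
  have hm : ∀ t, MeasurableSet ((fun ω : ℕ → Batch n N => ω t) ⁻¹' {balanced n N}) :=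
    fun t => measurable_pi_apply t (measurableSet_singleton _)
  have hp : ∀ t, batchesLaw n N ((fun ω : ℕ → Batch n N => ω t) ⁻¹' {balanced n N})
      = batchLaw n N {balanced n N} := by
    intro t
    rw [← map_batch t, Measure.map_apply (measurable_pi_apply t) (measurableSet_singleton _)]
  have hind : iIndepSet (fun t => (fun ω : ℕ → Batch n N => ω t) ⁻¹' {balanced n N})
      (batchesLaw n N) := by
    rw [iIndepSet_iff_meas_biInter hm]
    intro S
    exact iIndepFun_batch.measure_inter_preimage_eq_mul S
      (sets := fun _ => {balanced n N}) fun _ _ => measurableSet_singleton _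
  have h1 := measure_limsup_eq_one hm hind (by
    simp only [hp]
    exact ENNReal.tsum_const_eq_top_of_ne_zero batchLaw_balanced_ne_zero)
  have h2 : ∀ᵐ ω ∂(batchesLaw n N), ω ∈ limsup (fun t =>
      (fun ω : ℕ → Batch n N => ω t) ⁻¹' {balanced n N}) atTop := by
    refine (prob_compl_eq_zero_iff ?_).2 h1
    exact MeasurableSet.measurableSet_limsup hm
  filter_upwards [h2] with ω hω
  rw [mem_limsup_iff_frequently_mem] at hω
  refine tendsto_atTop_atTop_of_monotone (balancedCount_mono ω) fun k => ?_
  induction k with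
  | zero => exact ⟨0, Nat.zero_le _⟩
  | succ k ih =>
    obtain ⟨t, ht⟩ := ih
    obtain ⟨s, hs, hs'⟩ := frequently_atTop.1 hω t
    refine ⟨s + 1, ?_⟩
    rw [balancedCount_succ, Set.indicator_of_mem (show ω s ∈ ({balanced n N} : Set _) from hs')]
    have := balancedCount_mono ω hs
    simp only at this
    omega

/-! ### Messages, iterates and error of the waiting method -/

variable {d : ℕ} {hd : 0 < d} {φ : Fin n → Fin (N + 1) → Vec d → ℝ}
    {hφ : ∀ i j, Continuous (φ i j)} {x0 : Vec d}
    {g : Fin n → Fin (N + 1) → Vec d → Vec d}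

/-- The messages of an iteration at the query point `x` with weights `α`. -/
def batchMessage (g : Fin n → Fin (N + 1) → Vec d → Vec d) (α : ℝ) (x : Vec d)
    (b : Batch n N) (i : Fin n) : Vec d :=
  ∑ l, α • byLabel (fun i j => g i j x) (b (l, ⟨i, Finset.mem_univ i⟩))

lemma batchMessage_balanced (α : ℝ) (x : Vec d) (i : Fin n) :
    batchMessage g α x (balanced n N) i = ∑ j, α • g i j x := by
  unfold batchMessage balanced
  simp only [byLabel_label]

lemma measurable_batchMessage (g : Fin n → Fin (N + 1) → Vec d → Vec d) (α : ℝ) (x : Vec d)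
    (i : Fin n) : Measurable fun b : Batch n N => batchMessage g α x b i := by
  refine Finset.measurable_sum _ fun l _ => ?_
  have h : Measurable fun b : Batch n N =>
      byLabel (fun i j => g i j x) (b (l, ⟨i, Finset.mem_univ i⟩)) :=
    (measurable_byLabel _).comp (measurable_pi_apply _)
  exact h.const_smul α

lemma measurable_state (X : ℕ → Vec d) (t : ℕ) :
    Measurable[batchFiltration n N t] fun ω => X (balancedCount t ω) :=
  (measurable_of_countable X).comp (measurable_balancedCount t)

lemma measurable_message (g : Fin n → Fin (N + 1) → Vec d → Vec d) (α : ℝ) (X : ℕ → Vec d)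
    (t : ℕ) (i : Fin n) : Measurable[batchFiltration n N (t + 1)] fun ω =>
      batchMessage g α (X (balancedCount t ω)) (ω t) i := by
  have h : Measurable fun q : ℕ × Batch n N => batchMessage g α (X q.1) q.2 i := by
    refine measurable_from_prod_countable_right fun k => ?_
    exact measurable_batchMessage g α (X k) i
  have h1 : Measurable[batchFiltration n N (t + 1)] (balancedCount (n := n) (N := N) t) :=
    (measurable_balancedCount t).mono ((batchFiltration n N).mono t.le_succ) le_rfl
  have h2 : Measurable[batchFiltration n N (t + 1)] fun ω : ℕ → Batch n N => ω t :=
    measurable_batch t.lt_succ_self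
  have h3 : Measurable[batchFiltration n N (t + 1)]
      fun ω : ℕ → Batch n N => (balancedCount t ω, ω t) := h1.prodMk h2
  have h4 := h.comp h3
  simp only [Function.comp_def] at h4
  exact h4

/-- The iterates of `waitingRun`. -/
def waitingIterate (x0 : Vec d) (p : ℕ → Vec d) (K k : ℕ) : Vec d :=
  if k = 0 then x0 else p (min k K)

/-- At count zero the iterate has to be `x0`, whereas the query is `p 0`, which only lies in its
span. -/
lemma mem_span_waitingIterate {p : ℕ → Vec d} {K : ℕ} (hp0 : p 0 ∈ Submodule.span ℝ {x0})
    (t : ℕ) (ω : ℕ → Batch n N) :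
    p (min (balancedCount t ω) K) ∈
      Submodule.span ℝ {v | ∃ s ≤ t, v = waitingIterate x0 p K (balancedCount s ω)} := by
  by_cases h : balancedCount t ω = 0
  · simp only [h, Nat.zero_min]
    refine Submodule.span_mono ?_ hp0
    rintro _ rfl
    exact ⟨0, Nat.zero_le _, by simp [balancedCount, waitingIterate]⟩
  · exact Submodule.subset_span ⟨t, le_rfl, by simp [h, waitingIterate]⟩

/-- Every count `j ≤ k` was left at a balanced batch, whose messages are the noise-free ones at `p
j`; so all vectors needed for `p (k + 1)` have been aggregated by then. -/
lemma waitingIterate_succ_mem {p : ℕ → Vec d} {K : ℕ} (hK0 : 0 < K)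
    {A : (Fin n → Vec d) → Vec d} {α : ℝ}
    (hp : ∀ k < K, p (k + 1) ∈ Submodule.span ℝ
      {v | ∃ j ≤ k, v = A fun i => ∑ l, α • g i l (p j)}) (t : ℕ) (ω : ℕ → Batch n N) :
    waitingIterate x0 p K (balancedCount (t + 1) ω) ∈ Submodule.span ℝ
      ({v | ∃ s ≤ t, v = waitingIterate x0 p K (balancedCount s ω)} ∪
        {v | ∃ s ≤ t, v = A fun i =>
          batchMessage g α (p (min (balancedCount s ω) K)) (ω s) i}) := by
  by_cases h : ω t = balanced n N ∧ balancedCount t ω < K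
  · obtain ⟨hω, hK⟩ := h
    have hsucc : balancedCount (t + 1) ω = balancedCount t ω + 1 := by
      rw [balancedCount_succ, Set.indicator_of_mem (by simpa using hω)]
    simp only [hsucc, waitingIterate, Nat.add_eq_zero_iff, one_ne_zero, and_false, if_false,
      min_eq_left (Nat.succ_le_of_lt hK)]
    refine Submodule.span_mono ?_ (hp _ hK)
    rintro _ ⟨j, hj, rfl⟩
    obtain ⟨s, hs, hsj, hsb⟩ := exists_of_lt_balancedCount (t := t + 1) (k := j) (ω := ω)
      (by omega)
    refine Or.inr ⟨s, by omega, ?_⟩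
    simp only [hsj, hsb, batchMessage_balanced, min_eq_left (hj.trans hK.le)]
  · refine Submodule.subset_span (Or.inl ⟨t, le_rfl, ?_⟩)
    by_cases hω : ω t = balanced n N
    · have hK : K ≤ balancedCount t ω := by
        by_contra hc; exact h ⟨hω, by omega⟩
      have hsucc : balancedCount (t + 1) ω = balancedCount t ω + 1 := by
        rw [balancedCount_succ, Set.indicator_of_mem (by simpa using hω)]
      have h0 : balancedCount t ω ≠ 0 := by omega
      simp only [hsucc, waitingIterate, h0, min_eq_right hK,
        min_eq_right (hK.trans (Nat.le_succ _))]
      simp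
    · rw [balancedCount_succ, Set.indicator_of_notMem (by simpa using hω), add_zero]

lemma sum_weights {αmin : ℝ} (hα : 0 < αmin) (t : ℕ) :
    αmin ≤ ∑ j ∈ Finset.range (t + 1), ∑ _l : Fin (N + 1), if j = t then αmin else 0 := by
  rw [Finset.sum_eq_single t]
  · simp only [if_true, Finset.sum_const, Finset.card_univ, Fintype.card_fin, nsmul_eq_mul]
    push_cast
    nlinarith [Nat.cast_nonneg (α := ℝ) N]
  · intro j _ hj; simp [hj]
  · simp

lemma batchMessage_eq_sum (hg : ∀ i j x, HasGradientAt (φ i j) (g i j x) x) (α : ℝ)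
    (X : ℕ → Vec d) (t : ℕ) (ω : ℕ → Batch n N)
    (i : ↥(Finset.univ : Finset (Fin n))) :
    batchMessage g α (X t) (ω t) i = ∑ j ∈ Finset.range (t + 1), ∑ l : Fin (N + 1),
      (if j = t then α else 0) •
        (finiteProblem hd φ hφ x0).stochGrad (X j) (ω j (l, i)) := by
  rw [Finset.sum_eq_single t]
  · unfold batchMessage
    refine Finset.sum_congr rfl fun l _ => ?_
    rw [if_pos rfl]
    exact congrArg (α • ·) (finiteProblem_stochGrad hd hφ x0 hg _ _).symm
  · intro j _ hj; simp [hj]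
  · simp

/-- The method that queries the points of the path `p` one after the other, advancing whenever
a batch is balanced. -/
def waitingRun (hg : ∀ i j x, HasGradientAt (φ i j) (g i j x) x)
    (A : (Fin n → Vec d) → Vec d) {αmin : ℝ} (hα : 0 < αmin) (p : ℕ → Vec d) {K : ℕ} (hK0 : 0 < K)
    (hp0 : p 0 ∈ Submodule.span ℝ {x0})
    (hp : ∀ k < K, p (k + 1) ∈ Submodule.span ℝ
      {v | ∃ j ≤ k, v = A fun i => ∑ l, αmin • g i l (p j)}) :
    MethodRun (finiteProblem hd φ hφ x0) A αmin where
  Ω := ℕ → Batch n N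
  mΩ := inferInstance
  Pr := batchesLaw n N
  prob := inferInstance
  m := N + 1
  m_pos := N.succ_pos
  ℱ := batchFiltration n N
  ξ t l i ω := ω t (l, i)
  x t ω := waitingIterate x0 p K (balancedCount t ω)
  query t _ ω := p (min (balancedCount t ω) K)
  α t j _ _ := if j = t then αmin else 0
  w t i ω := batchMessage g αmin (p (min (balancedCount t ω) K)) (ω t) i
  out t ω := p (min (balancedCount t ω) K)
  law_ξ t := map_batch t
  indep_ξ t := indep_batch t
  measurable_ξ t l i := (measurable_pi_apply (l, i)).comp (measurable_batch t.lt_succ_self)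
  measurable_x t := measurable_state (waitingIterate x0 p K) t
  measurable_query t _ := measurable_state (fun k => p (min k K)) t
  measurable_α _ _ _ := measurable_const
  measurable_w t i := measurable_message g αmin (fun k => p (min k K)) t i
  measurable_out t := measurable_state (fun k => p (min k K)) t
  x_zero _ := rfl
  query_mem t _ ω := mem_span_waitingIterate hp0 t ω
  α_nonneg _ _ _ _ := ite_nonneg hα.le le_rfl
  α_sum t _ := sum_weights hα t
  w_honest t i ω := batchMessage_eq_sum hg αmin (fun t => p (min (balancedCount t ω) K)) t ω i
  x_succ_mem t ω := waitingIterate_succ_mem hK0 hp t ω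
  out_mem t ω := mem_span_waitingIterate hp0 t ω

/-- Almost surely the output is eventually `p K`. Only finitely many gradient norms occur before,
which gives the domination needed to pass to the limit in the expectation. -/
lemma byzantineError_le_of_path (hg : ∀ i j x, HasGradientAt (φ i j) (g i j x) x)
    (A : (Fin n → Vec d) → Vec d) {αmin : ℝ} (hα : 0 < αmin) (p : ℕ → Vec d) {K : ℕ} (hK0 : 0 < K)
    (hp0 : p 0 ∈ Submodule.span ℝ {x0})
    (hp : ∀ k < K, p (k + 1) ∈ Submodule.span ℝ
      {v | ∃ j ≤ k, v = A fun i => ∑ l, αmin • g i l (p j)}) :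
    byzantineError (finiteProblem hd φ hφ x0) A αmin
      ≤ ‖gradient (finiteProblem hd φ hφ x0).loss (p K)‖ₑ := by
  set G : ℕ → ℝ≥0∞ := fun k => ‖gradient (finiteProblem hd φ hφ x0).loss (p (min k K))‖ₑ with hG
  have hlim : Tendsto (fun t => ∫⁻ ω, G (balancedCount t ω) ∂(batchesLaw n N)) atTop
      (𝓝 (∫⁻ _, G K ∂(batchesLaw n N))) := by
    refine tendsto_lintegral_of_dominated_convergence
      (fun _ => ∑ k ∈ Finset.range (K + 1), G k) (fun t => ?_) (fun t => ?_) ?_ ?_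
    · exact (measurable_of_countable G).comp
        ((measurable_balancedCount t).mono ((batchFiltration n N).le t) le_rfl)
    · refine Eventually.of_forall fun ω => ?_
      have : G (balancedCount t ω) = G (min (balancedCount t ω) K) := by simp [hG]
      simp only [this]
      exact Finset.single_le_sum (f := G) (fun _ _ => zero_le)
        (Finset.mem_range.2 (by omega))
    · rw [lintegral_const, measure_univ, mul_one]
      exact (ENNReal.sum_lt_top.2 fun k _ => enorm_lt_top).ne
    · filter_upwards [ae_balancedCount_tendsto (n := n) (N := N)] with ω hω
      refine tendsto_const_nhds.congr' ?_
      filter_upwards [hω.eventually_ge_atTop K] with t ht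
      simp [hG, ht]
  rw [lintegral_const, measure_univ, mul_one] at hlim
  have hK : G K = ‖gradient (finiteProblem hd φ hφ x0).loss (p K)‖ₑ := by simp [hG]
  rw [← hK]
  refine ge_of_tendsto' hlim fun t => ?_
  refine (iInf_le _ (waitingRun hg A hα p hK0 hp0 hp)).trans ?_
  exact iInf_le (fun t => (waitingRun hg A hα p hK0 hp0 hp).expGradNorm t) t

end Waiting

/-! ### Messages of the honest nodes -/

namespace Design

variable {n T N : ℕ} {D : Design n T N}

/-- The message of node `i` that combines the gradients at the points `q s` with weights `c s`,
where `J s i` is the sample of node `i` at `q s`. -/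
def message (D : Design n T N) {ι : Type*} (S : Finset ι) (c : ι → ℝ)
    (q : ι → Vec (dim n T N)) (J : ι → Fin n → Fin (N + 1)) (i : Fin n) : Vec (dim n T N) :=
  ∑ s ∈ S, c s • D.sampleGrad i (J s i) (q s)

section Message

variable {ι : Type*} {S : Finset ι} {c : ι → ℝ} {q : ι → Vec (dim n T N)}
  {J : ι → Fin n → Fin (N + 1)}

lemma message_apply (i : Fin n) (k : Fin (dim n T N)) :
    D.message S c q J i k = ∑ s ∈ S, c s * D.sampleGrad i (J s i) (q s) k := by
  simp [message]

/-- The floor parts of the messages are `U + τ i * C` with a common `U` and the total weight `C`.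
Nonnegative weights give `|U| ≤ (b + θ) * C`, while the variance is `C ^ 2` times the mean of `τ i ^
2`; the weights therefore cancel out of the comparison. -/
lemma Regular.floor_erased (hD : D.Regular) {κ : ℝ} (hθ : 0 ≤ D.θ) (hb : D.θ ≤ D.b)
    (hτ : (D.b + D.θ) ^ 2 ≤ κ * ((n : ℝ)⁻¹ * ∑ i, D.τ i ^ 2))
    (hc : ∀ s ∈ S, 0 ≤ c s) (hq : ∀ s ∈ S, q s fl = 0) :
    honestMean Finset.univ (D.message S c q J) fl ^ 2
      ≤ κ * floorVar (D.message S c q J) := by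
  have hn : (n : ℝ) ≠ 0 := by exact_mod_cast hD.n_pos.ne'
  set C := ∑ s ∈ S, c s with hC
  set U := ∑ s ∈ S, c s * (D.b - D.θ * Real.sin (q s (ch (Fin.last T)) / D.lam)) with hU
  have hw : ∀ i, D.message S c q J i fl = U + D.τ i * C := by
    intro i
    rw [message_apply, hU, hC, Finset.mul_sum, ← Finset.sum_add_distrib]
    refine Finset.sum_congr rfl fun s hs => ?_
    simp [sampleGrad, baseGrad, noiseGrad, hq s hs]
    ring
  have hmean : honestMean Finset.univ (D.message S c q J) fl = U := by
    rw [honestMean_univ_apply]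
    simp only [hw, Finset.sum_add_distrib, ← Finset.sum_mul, hD.sum_τ, Finset.sum_const,
      Finset.card_univ, Fintype.card_fin, nsmul_eq_mul]
    field_simp
    ring
  have hvar : floorVar (D.message S c q J) = C ^ 2 * ((n : ℝ)⁻¹ * ∑ i, D.τ i ^ 2) := by
    unfold floorVar
    simp only [hmean, hw, add_sub_cancel_left, mul_pow, ← Finset.sum_mul]
    ring
  have hC0 : 0 ≤ C := Finset.sum_nonneg hc
  have hUC : |U| ≤ (D.b + D.θ) * C := by
    rw [hU, hC, Finset.mul_sum]
    refine (Finset.abs_sum_le_sum_abs _ _).trans (Finset.sum_le_sum fun s hs => ?_)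
    rw [abs_mul, abs_of_nonneg (hc s hs), mul_comm]
    refine mul_le_mul_of_nonneg_right (abs_le.2 ⟨?_, ?_⟩) (hc s hs)
    · nlinarith [Real.sin_le_one (q s (ch (Fin.last T)) / D.lam)]
    · nlinarith [Real.neg_one_le_sin (q s (ch (Fin.last T)) / D.lam)]
  rw [hmean, hvar, ← sq_abs]
  calc |U| ^ 2 ≤ ((D.b + D.θ) * C) ^ 2 := pow_le_pow_left₀ (abs_nonneg _) hUC 2
    _ = C ^ 2 * (D.b + D.θ) ^ 2 := by ring
    _ ≤ C ^ 2 * (κ * ((n : ℝ)⁻¹ * ∑ i, D.τ i ^ 2)) :=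
      mul_le_mul_of_nonneg_left hτ (sq_nonneg _)
    _ = _ := by ring

/-- At zero floor coordinate the coupling has no chain derivative, and the additive noise lives in
other coordinates. -/
lemma chain_sampleGrad {x : Vec (dim n T N)} (hx : x fl = 0) (i : Fin n) (j : Fin (N + 1)) :
    chain (D.sampleGrad i j x)
      = D.gH (chain x) + (D.ω * switch N j) • D.gψ (chain x) := by
  ext k
  simp [sampleGrad, baseGrad, noiseGrad, hx]

lemma chain_message_mem {V : Submodule ℝ (Vec (T + 1))} {i : Fin n}
    (h : ∀ s ∈ S, chain (D.sampleGrad i (J s i) (q s)) ∈ V) :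
    chain (D.message S c q J i) ∈ V := by
  rw [message, map_sum]
  refine Submodule.sum_mem _ fun s hs => ?_
  rw [map_smul]
  exact Submodule.smul_mem _ _ (h s hs)

/-- The gradients of a chain propagate by at most one coordinate. -/
structure IsZeroChain (D : Design n T N) : Prop where
  gH_mem : ∀ k z, z ∈ initial T k → D.gH z ∈ initial T (k + 1)
  gψ_mem : ∀ k z, z ∈ initial T k → D.gψ z ∈ initial T (k + 1)

lemma IsZeroChain.sampleGrad_mem (hZ : D.IsZeroChain) {k : ℕ} {x : Vec (dim n T N)}
    (hx : x ∈ reached n T N k) (i : Fin n) (j : Fin (N + 1)) :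
    chain (D.sampleGrad i j x) ∈ initial T (k + 1) := by
  rw [chain_sampleGrad hx.1]
  exact add_mem (hZ.gH_mem k _ hx.2) (Submodule.smul_mem _ _ (hZ.gψ_mem k _ hx.2))

/-- For `j ≠ 0` the switch is `-1`, so the chain part is `gH - gψ`, in which the frontier cancels.
-/
lemma sampleGrad_mem_of_masked (hω : D.ω = 1)
    (hmask : ∀ k z, z ∈ initial T k → D.gH z - D.gψ z ∈ initial T k) {k : ℕ}
    {x : Vec (dim n T N)} (hx : x ∈ reached n T N k) (i : Fin n) {j : Fin (N + 1)}
    (hj : j ≠ 0) : chain (D.sampleGrad i j x) ∈ initial T k := by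
  rw [chain_sampleGrad hx.1, hω, switch, if_neg hj]
  have := hmask k _ hx.2
  convert this using 1
  module

/-- Nonnegative weights that fall on the same noise direction add up without cancellation. -/
lemma sum_sq_fiber_le {m : ℕ} (hc : ∀ s ∈ S, 0 ≤ c s) (J : ι → Fin m) :
    ∑ s ∈ S, c s ^ 2 ≤ ∑ j, (∑ s ∈ S, if j = J s then c s else 0) ^ 2 := by
  have h : ∀ j, ∑ s ∈ S, (if j = J s then c s else 0) ^ 2
      ≤ (∑ s ∈ S, if j = J s then c s else 0) ^ 2 := by
    intro j
    refine Finset.sum_sq_le_sq_sum_of_nonneg fun s hs => ?_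
    split_ifs
    exacts [hc s hs, le_rfl]
  refine le_trans (le_of_eq ?_) (Finset.sum_le_sum fun j _ => h j)
  rw [Finset.sum_comm]
  refine Finset.sum_congr rfl fun s _ => ?_
  simp [ite_pow]

/-- Centring costs `C ^ 2 / (N + 1)`, which by Cauchy–Schwarz is at most `S.card / (N + 1) ≤ 1 / 2`
of the sum of squares. The bound holds for every `J`, so the noise is large surely, not just on
average. -/
lemma half_sum_sq_le (hc : ∀ s ∈ S, 0 ≤ c s) (hS : 2 * S.card ≤ N + 1)
    (J : ι → Fin (N + 1)) :
    1 / 2 * ∑ s ∈ S, c s ^ 2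
      ≤ ∑ j, (∑ s ∈ S, c s * ((if j = J s then 1 else 0) - ((N : ℝ) + 1)⁻¹)) ^ 2 := by
  have hN : 0 < (N : ℝ) + 1 := by positivity
  set C := ∑ s ∈ S, c s with hC
  have h1 : ∀ j, ∑ s ∈ S, c s * ((if j = J s then 1 else 0) - ((N : ℝ) + 1)⁻¹)
      = (∑ s ∈ S, if j = J s then c s else 0) - C * ((N : ℝ) + 1)⁻¹ := by
    intro j
    simp only [mul_sub, Finset.sum_sub_distrib, mul_ite, mul_one, mul_zero, ← Finset.sum_mul, hC]
  have h2 : ∑ j, ∑ s ∈ S, (if j = J s then c s else 0) = C := by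
    rw [Finset.sum_comm]; simp [hC]
  have h3 : ∑ j, ((∑ s ∈ S, if j = J s then c s else 0) - C * ((N : ℝ) + 1)⁻¹) ^ 2
      = ∑ j, (∑ s ∈ S, if j = J s then c s else 0) ^ 2 - C ^ 2 / (N + 1) := by
    simp only [sub_sq, Finset.sum_add_distrib, Finset.sum_sub_distrib, ← Finset.sum_mul,
      ← Finset.mul_sum, h2, Finset.sum_const, Finset.card_univ, Fintype.card_fin, nsmul_eq_mul]
    push_cast
    field_simp
    ring
  have h4 := sum_sq_fiber_le hc J
  have h5 : C ^ 2 ≤ S.card * ∑ s ∈ S, c s ^ 2 := sq_sum_le_card_mul_sum_sq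
  have h6 : C ^ 2 / (N + 1) ≤ 1 / 2 * ∑ s ∈ S, c s ^ 2 := by
    rw [div_le_iff₀ hN]
    have h7 : (2 : ℝ) * S.card ≤ N + 1 := by exact_mod_cast hS
    have h8 : 0 ≤ ∑ s ∈ S, c s ^ 2 := Finset.sum_nonneg fun _ _ => sq_nonneg _
    nlinarith
  simp only [h1]
  rw [h3]
  linarith

lemma sum_sq_delta (hn : 0 < n) (i : Fin n) :
    ∑ i' : Fin n, ((if i = i' then 1 else 0) - (n : ℝ)⁻¹) ^ 2 = 1 - (n : ℝ)⁻¹ := by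
  have hn' : (n : ℝ) ≠ 0 := by exact_mod_cast hn.ne'
  have : ∀ i' : Fin n, ((if i = i' then 1 else 0) - (n : ℝ)⁻¹) ^ 2
      = (if i = i' then 1 - 2 * (n : ℝ)⁻¹ else 0) + (n : ℝ)⁻¹ ^ 2 := by
    intro i'
    split_ifs <;> ring
  simp only [this, Finset.sum_add_distrib, Finset.sum_ite_eq, Finset.mem_univ, if_true,
    Finset.sum_const, Finset.card_univ, Fintype.card_fin, nsmul_eq_mul]
  field_simp
  ring

/-- The part `e * x` is common to all nodes and drops out of the variance. The noise of a node sits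
in coordinates that no other node perturbs, so centring keeps the fraction `1 - 1 / n ≥ 1 / 2` of
it; the other factor `1 / 2` comes from `half_sum_sq_le`. -/
lemma le_noiseVar_message (hn : 2 ≤ n) (hc : ∀ s ∈ S, 0 ≤ c s) (hS : 2 * S.card ≤ N + 1) :
    D.s ^ 2 / 4 * ∑ s ∈ S, c s ^ 2 ≤ noiseVar (D.message S c q J) := by
  have hn0 : 0 < n := by omega
  have hnr : (2 : ℝ) ≤ n := by exact_mod_cast hn
  have hn' : (n : ℝ) ≠ 0 := by positivity
  set Y : Fin n → Fin (N + 1) → ℝ := fun i j =>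
    ∑ s ∈ S, c s * ((if j = J s i then 1 else 0) - ((N : ℝ) + 1)⁻¹) with hY
  set Q : Fin n → Fin (N + 1) → ℝ := fun i j => ∑ s ∈ S, c s * (D.e * q s (no i j)) with hQ
  have hw : ∀ i' i j, D.message S c q J i' (no i j)
      = Q i j + (if i = i' then 1 else 0) * (D.s * Y i j) := by
    intro i' i j
    rw [message_apply]
    simp only [sampleGrad, baseGrad, noiseGrad, PiLp.add_apply, mkPt_no, mul_add,
      Finset.sum_add_distrib, hQ, hY, Finset.mul_sum]
    congr 1
    refine Finset.sum_congr rfl fun s _ => ?_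
    unfold noise
    by_cases h : i = i'
    · subst h; simp only [if_true]; ring
    · simp [h]
  have hmean : ∀ i j, honestMean Finset.univ (D.message S c q J) (no i j)
      = Q i j + (n : ℝ)⁻¹ * (D.s * Y i j) := by
    intro i j
    rw [honestMean_univ_apply]
    simp only [hw, Finset.sum_add_distrib, ← Finset.sum_mul, Finset.sum_ite_eq, Finset.mem_univ,
      if_true, Finset.sum_const, Finset.card_univ, Fintype.card_fin, nsmul_eq_mul]
    field_simp
  have hvar : noiseVar (D.message S c q J)
      = (n : ℝ)⁻¹ * (D.s ^ 2 * (1 - (n : ℝ)⁻¹) * ∑ i, ∑ j, Y i j ^ 2) := by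
    unfold noiseVar
    congr 1
    rw [Finset.sum_comm, Finset.mul_sum]
    refine Finset.sum_congr rfl fun i _ => ?_
    have hj : ∀ i', ∑ j, (D.message S c q J i' (no i j)
          - honestMean Finset.univ (D.message S c q J) (no i j)) ^ 2
        = ((if i = i' then 1 else 0) - (n : ℝ)⁻¹) ^ 2 * (D.s ^ 2 * ∑ j, Y i j ^ 2) := by
      intro i'
      rw [Finset.mul_sum, Finset.mul_sum]
      refine Finset.sum_congr rfl fun j _ => ?_
      rw [hmean, hw]
      ring
    simp only [hj]
    rw [← Finset.sum_mul, sum_sq_delta hn0 i]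
    ring
  have hY2 : ∀ i, 1 / 2 * ∑ s ∈ S, c s ^ 2 ≤ ∑ j, Y i j ^ 2 :=
    fun i => half_sum_sq_le hc hS fun s => J s i
  have hsum : n * (1 / 2 * ∑ s ∈ S, c s ^ 2) ≤ ∑ i, ∑ j, Y i j ^ 2 := by
    have := Finset.sum_le_sum fun i (_ : i ∈ (Finset.univ : Finset (Fin n))) => hY2 i
    simpa using this
  have hinv : (1 : ℝ) / 2 ≤ 1 - (n : ℝ)⁻¹ := by
    have : (n : ℝ)⁻¹ ≤ 2⁻¹ := inv_anti₀ (by norm_num) hnr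
    linarith
  have h0 : 0 ≤ ∑ s ∈ S, c s ^ 2 := Finset.sum_nonneg fun _ _ => sq_nonneg _
  rw [hvar]
  calc D.s ^ 2 / 4 * ∑ s ∈ S, c s ^ 2
      = (n : ℝ)⁻¹ * (D.s ^ 2 * (1 / 2) * (n * (1 / 2 * ∑ s ∈ S, c s ^ 2))) := by
        field_simp; ring
    _ ≤ _ := by gcongr

/-- Only the samples in `S'` see the frontier. Cauchy–Schwarz bounds the squared mean by `K * G ^ 2`
times the sum of squared weights, and the noise variance is at least `s ^ 2 / 4` times the same sum.
-/
lemma frontier_erased (hn : 2 ≤ n) {κ G : ℝ} (hκ : 0 ≤ κ) (hω : D.ω = 0)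
    (hc : ∀ s ∈ S, 0 ≤ c s) (hS : 2 * S.card ≤ N + 1) {K : ℕ}
    (hG : 4 * K * G ^ 2 ≤ κ * D.s ^ 2) (hq : ∀ s ∈ S, q s fl = 0) {k : Fin (T + 1)}
    {S' : Finset ι} (hS' : S' ⊆ S) (hcard : S'.card ≤ K)
    (h0 : ∀ s ∈ S, s ∉ S' → D.gH (chain (q s)) k = 0)
    (h1 : ∀ s ∈ S', |D.gH (chain (q s)) k| ≤ G) :
    honestMean Finset.univ (D.message S c q J) (ch k) ^ 2
      ≤ κ * noiseVar (D.message S c q J) := by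
  have hn' : (n : ℝ) ≠ 0 := by positivity
  have hw : ∀ i, D.message S c q J i (ch k) = ∑ s ∈ S', c s * D.gH (chain (q s)) k := by
    intro i
    rw [message_apply]
    have : ∀ s ∈ S, c s * D.sampleGrad i (J s i) (q s) (ch k)
        = c s * D.gH (chain (q s)) k := by
      intro s hs
      have := congrArg (fun v : Vec (T + 1) => v k)
        (chain_sampleGrad (D := D) (hq s hs) i (J s i))
      simp only [chain_apply, hω, zero_mul, zero_smul, add_zero] at this
      rw [this]
    rw [Finset.sum_congr rfl this]
    refine (Finset.sum_subset hS' fun s hs hs' => ?_).symm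
    rw [h0 s hs hs', mul_zero]
  have hmean : honestMean Finset.univ (D.message S c q J) (ch k)
      = ∑ s ∈ S', c s * D.gH (chain (q s)) k := by
    rw [honestMean_univ_apply]
    simp only [hw, Finset.sum_const, Finset.card_univ, Fintype.card_fin, nsmul_eq_mul]
    field_simp
  have hsq : ∑ s ∈ S', c s ^ 2 ≤ ∑ s ∈ S, c s ^ 2 :=
    Finset.sum_le_sum_of_subset_of_nonneg hS' fun _ _ _ => sq_nonneg _
  have h0' : 0 ≤ ∑ s ∈ S', c s ^ 2 := Finset.sum_nonneg fun _ _ => sq_nonneg _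
  have hle : (∑ s ∈ S', c s * D.gH (chain (q s)) k) ^ 2 ≤ K * G ^ 2 * ∑ s ∈ S, c s ^ 2 := by
    calc (∑ s ∈ S', c s * D.gH (chain (q s)) k) ^ 2
        ≤ S'.card * ∑ s ∈ S', (c s * D.gH (chain (q s)) k) ^ 2 := sq_sum_le_card_mul_sum_sq
      _ ≤ K * ∑ s ∈ S', G ^ 2 * c s ^ 2 := by
        have hcard' : (S'.card : ℝ) ≤ K := by exact_mod_cast hcard
        refine mul_le_mul hcard' (Finset.sum_le_sum fun s hs => ?_)
          (Finset.sum_nonneg fun _ _ => sq_nonneg _) (by positivity)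
        rw [mul_pow, mul_comm]
        exact mul_le_mul_of_nonneg_right (sq_le_sq' (abs_le.1 (h1 s hs)).1
          (abs_le.1 (h1 s hs)).2) (sq_nonneg _)
      _ = K * G ^ 2 * ∑ s ∈ S', c s ^ 2 := by rw [← Finset.mul_sum]; ring
      _ ≤ _ := by gcongr
  rw [hmean]
  calc _ ≤ K * G ^ 2 * ∑ s ∈ S, c s ^ 2 := hle
    _ ≤ κ * D.s ^ 2 / 4 * ∑ s ∈ S, c s ^ 2 := by
      refine mul_le_mul_of_nonneg_right ?_ (h0'.trans hsq)
      linarith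
    _ = κ * (D.s ^ 2 / 4 * ∑ s ∈ S, c s ^ 2) := by ring
    _ ≤ _ := mul_le_mul_of_nonneg_left (le_noiseVar_message hn hc hS) hκ

end Message

end Design

/-! ### Bounds for the methods on a hard instance -/

namespace Design

variable {n T N : ℕ} {D : Design n T N}

/-- The conditions under which a design is hard for optimization error `ε` when the aggregator
is `erasingMean κ`. -/
structure Hard (D : Design n T N) (κ ε : ℝ) : Prop where
  regular : D.Regular
  two_le : 2 ≤ n
  κ_nonneg : 0 ≤ κ
  θ_nonneg : 0 ≤ D.θ
  θ_le : D.θ ≤ D.b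
  tilt : (D.b + D.θ) ^ 2 ≤ κ * ((n : ℝ)⁻¹ * ∑ i, D.τ i ^ 2)
  ε_pos : 0 < ε
  -- With the factor 3, a lock of probability one half still leaves an excess of `3 / 2 * ε > ε`.
  lock : ∀ z, z (Fin.last T) = 0 → (D.b - D.θ + 3 * ε) ^ 2 ≤ D.b ^ 2 + ‖D.gH z‖ ^ 2
  zeroChain : D.IsZeroChain
  -- This and `target` serve the upper bound on the Byzantine error: a noise-free method can travel
  -- along the chain to its end.
  progress : ∀ k : Fin (T + 1), ∃ z ∈ initial T k, D.gH z k ≠ 0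
  target : ∃ z, D.gH z = 0 ∧ Real.sin (z (Fin.last T) / D.lam) = 1

section Bounds

variable {κ ε r αmin : ℝ}

lemma abs_le_norm_coord {d : ℕ} (x : Vec d) (k : Fin d) : |x k| ≤ ‖x‖ :=
  PiLp.norm_apply_le x k

lemma Hard.floor_le_norm (h : D.Hard κ ε) {x : Vec (dim n T N)} (hx : x fl = 0) :
    D.b - D.θ ≤ ‖D.baseGrad 0 x‖ := by
  have h1 := (le_abs_self _).trans (abs_le_norm_coord (D.baseGrad 0 x) fl)
  refine le_trans ?_ h1
  simp only [baseGrad, mkPt_fl, hx]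
  simp only [mul_zero, zero_add, zero_div, Real.cos_zero, one_mul, add_zero]
  nlinarith [Real.sin_le_one (x (ch (Fin.last T)) / D.lam), h.θ_nonneg]

lemma Hard.locked_le_norm (h : D.Hard κ ε) {x : Vec (dim n T N)} (hx : x ∈ reached n T N T) :
    D.b - D.θ + 3 * ε ≤ ‖D.baseGrad 0 x‖ := by
  have hlast : x (ch (Fin.last T)) = 0 := hx.2 (Fin.last T) le_rfl
  refine abs_le_of_sq_le_sq' ?_ (norm_nonneg _) |>.2
  refine (h.lock (chain x) hlast).trans ?_
  rw [norm_sq_coord, EuclideanSpace.real_norm_sq_eq]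
  simp only [baseGrad, mkPt_fl, mkPt_du, mkPt_ch, mkPt_no, hx.1, hlast]
  simp only [mul_zero, zero_add, zero_div, Real.cos_zero, add_zero, Real.sin_zero, zero_mul,
    ite_self, sub_zero]
  have : 0 ≤ ∑ i, ∑ j, (D.e * x (no i j)) ^ 2 := by positivity
  nlinarith [sq_nonneg (D.e * x du)]

/-- Triangular elimination: `g k` has no entries beyond coordinate `k` and a nonzero entry there. -/
lemma initial_le_span {g : ℕ → Vec (T + 1)} (hg : ∀ k, g k ∈ initial T (k + 1))
    (h0 : ∀ k : Fin (T + 1), g k k ≠ 0) {k : ℕ} (hk : k ≤ T + 1) :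
    initial T k ≤ Submodule.span ℝ {v | ∃ j < k, v = g j} := by
  induction k with
  | zero =>
    intro v hv
    have : v = 0 := by ext i; exact hv i (Nat.zero_le _)
    rw [this]; exact zero_mem _
  | succ k ih =>
    intro v hv
    set i : Fin (T + 1) := ⟨k, hk⟩ with hi
    have hgi : g k i ≠ 0 := h0 i
    have h1 : v - (v i / g k i) • g k ∈ initial T k := by
      intro i' hi'
      rcases Nat.eq_or_lt_of_le hi' with h | h
      · have : i' = i := Fin.ext h.symm
        subst this
        simp [hgi]
      · simp [hv i' h, hg k i' h]
    have h2 := Submodule.span_mono (R := ℝ) (s := {v | ∃ j < k, v = g j})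
      (t := {v | ∃ j < k + 1, v = g j}) (by
        rintro _ ⟨j, hj, rfl⟩; exact ⟨j, by omega, rfl⟩) (ih (by omega) h1)
    have h3 : g k ∈ Submodule.span ℝ {v | ∃ j < k + 1, v = g j} :=
      Submodule.subset_span ⟨k, by omega, rfl⟩
    have := add_mem h2 (Submodule.smul_mem _ (v i / g k i) h3)
    rwa [sub_add_cancel] at this

/-- The embedding of the chain coordinates. -/
def embChain (n T N : ℕ) : Vec (T + 1) →ₗ[ℝ] Vec (dim n T N) where
  toFun z := mkPt 0 0 z fun _ _ => 0
  map_add' x y := by refine ext_coord ?_ ?_ ?_ ?_ <;> simp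
  map_smul' c x := by refine ext_coord ?_ ?_ ?_ ?_ <;> simp

lemma embChain_apply (z : Vec (T + 1)) : embChain n T N z = mkPt 0 0 z fun _ _ => 0 := rfl

/-- The noise cancels, so `noiseVar` is zero and only tails that already vanish are erased: the
chain gradient passes unharmed. -/
lemma Hard.aggregate_balanced (h : D.Hard κ ε) (hα : 0 ≤ αmin) (z : Vec (T + 1)) :
    erasingMean κ (fun i => ∑ l, αmin • D.sampleGrad i l (embChain n T N z))
      = embChain n T N ((αmin * (N + 1)) • D.gH z) := by
  have hn : (n : ℝ) ≠ 0 := by exact_mod_cast h.regular.n_pos.ne'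
  have hfl := h.regular.floor_erased (S := (Finset.univ : Finset (Fin (N + 1))))
    (c := fun _ => αmin) (q := fun _ => embChain n T N z) (J := fun l _ => l)
    h.θ_nonneg h.θ_le h.tilt (fun _ _ => hα) (fun _ _ => by simp [embChain_apply])
  set w : Fin n → Vec (dim n T N) := fun i => ∑ l, αmin • D.sampleGrad i l (embChain n T N z)
    with hw
  have hmsg : (D.message Finset.univ (fun _ => αmin) (fun _ => embChain n T N z)
      fun l _ => l) = w := rfl
  rw [hmsg] at hfl
  have hwi : ∀ i, w i = (αmin * (N + 1)) • D.baseGrad (D.τ i) (embChain n T N z) := by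
    intro i
    simp only [hw]
    rw [← Finset.smul_sum, sum_sampleGrad, smul_smul]
  have hno : ∀ i i' j, w i (no i' j) = 0 := by
    intro i i' j
    simp [hwi, baseGrad, embChain_apply]
  have hdu : ∀ i, w i du = 0 := by
    intro i
    simp [hwi, baseGrad, embChain_apply]
  have hch : ∀ i k, w i (ch k) = αmin * (N + 1) * D.gH z k := by
    intro i k
    have : chain (mkPt 0 0 z fun _ _ => 0 : Vec (dim n T N)) = z := chain_mkPt _ _ _ _
    simp [hwi, baseGrad, embChain_apply]
  have hmch : ∀ k, honestMean Finset.univ w (ch k) = αmin * (N + 1) * D.gH z k := by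
    intro k
    rw [honestMean_univ_apply]
    simp only [hch, Finset.sum_const, Finset.card_univ, Fintype.card_fin, nsmul_eq_mul]
    field_simp
  have hmno : ∀ i j, honestMean Finset.univ w (no i j) = 0 := by
    intro i j; rw [honestMean_univ_apply]; simp [hno]
  have hvar : noiseVar w = 0 := by simp [noiseVar, hno, hmno]
  refine ext_coord ?_ ?_ ?_ ?_
  · rw [erasingMean_fl_eq_zero hfl]; simp [embChain_apply]
  · simp [erasingMean, honestMean_univ_apply, hdu, embChain_apply]
  · intro k
    simp only [erasingMean, mkPt_ch, embChain_apply, hvar, mul_zero]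
    split_ifs with hle
    · have h1 := Finset.single_le_sum (f := fun k' => honestMean Finset.univ w (ch k') ^ 2)
        (s := Finset.univ.filter (k ≤ ·)) (fun _ _ => sq_nonneg _)
        (Finset.mem_filter.2 ⟨Finset.mem_univ k, le_rfl⟩)
      have h2 : honestMean Finset.univ w (ch k) = 0 := by
        have := h1.trans hle
        exact pow_eq_zero_iff (two_ne_zero) |>.1 (le_antisymm this (sq_nonneg _))
      rw [hmch] at h2
      simp [h2]
    · rw [hmch]; simp
  · intro i j
    simp only [erasingMean, mkPt_no, hmno, embChain_apply]

/-- The aggregates at the points of `progress` span the spaces `initial T k`, so the path can end at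
the target. There the chain is stationary, the slope has dropped, and only `b - θ` remains. -/
lemma Hard.byzantineError_le (h : D.Hard κ ε) (hα : 0 < αmin) :
    byzantineError (problem h.regular r) (erasingMean κ) αmin ≤ ENNReal.ofReal (D.b - D.θ) := by
  choose z hz hz0 using h.progress
  obtain ⟨y, hy, hsin⟩ := h.target
  set g : ℕ → Vec (T + 1) := fun k => if hk : k < T + 1 then D.gH (z ⟨k, hk⟩) else 0 with hg
  have hgk : ∀ k : Fin (T + 1), g k = D.gH (z k) := by intro k; simp only [hg, k.2, dif_pos]
  have hgm : ∀ k, g k ∈ initial T (k + 1) := by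
    intro k
    by_cases hk : k < T + 1
    · rw [show g k = D.gH (z ⟨k, hk⟩) from hgk ⟨k, hk⟩]
      exact h.zeroChain.gH_mem k _ (hz ⟨k, hk⟩)
    · simp only [hg, hk, dif_neg, not_false_eq_true]; exact zero_mem _
  -- The path visits one point per chain coordinate and then, at index `T + 1`, the target.
  set u : ℕ → Vec (T + 1) := fun k => if hk : k < T + 1 then z ⟨k, hk⟩ else y with hu
  have hum : ∀ k, u k ∈ initial T k := by
    intro k
    by_cases hk : k < T + 1
    · simp only [hu, hk, dif_pos]; exact hz ⟨k, hk⟩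
    · intro i hi
      have := i.2; omega
  have hgu : ∀ k < T + 1, g k = D.gH (u k) := by
    intro k hk; simp only [hg, hu, hk, dif_pos]
  have key := byzantineError_le_of_path (hd := dim_pos) (hφ := h.regular.continuous_sample)
    (x0 := mkPt 0 r (fun _ => 0) fun _ _ => 0)
    h.regular.hasGradientAt_sample (erasingMean κ) hα (fun k => embChain n T N (u k))
    (K := T + 1) T.succ_pos (by
      have : u 0 = 0 := by ext i; exact hum 0 i (Nat.zero_le _)
      simp only [this, map_zero]; exact zero_mem _) (by
      intro k hk
      have h1 : u (k + 1) ∈ Submodule.span ℝ {v | ∃ j < k + 1, v = g j} :=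
        initial_le_span hgm (fun k => by rw [hgk]; exact hz0 k) hk (hum (k + 1))
      have h2 := Submodule.mem_map_of_mem (f := embChain n T N) h1
      rw [Submodule.map_span] at h2
      refine (Submodule.span_le.2 ?_ : _ ≤ _) h2
      rintro _ ⟨_, ⟨j, hj, rfl⟩, rfl⟩
      have hc : αmin * ((N : ℝ) + 1) ≠ 0 := by positivity
      have h3 : embChain n T N (g j) = (αmin * ((N : ℝ) + 1))⁻¹ •
          embChain n T N ((αmin * (N + 1)) • D.gH (u j)) := by
        rw [map_smul, smul_smul, inv_mul_cancel₀ hc, one_smul, hgu j (by omega)]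
      rw [h3]
      refine Submodule.smul_mem _ _ (Submodule.subset_span ⟨j, by omega, ?_⟩)
      exact (h.aggregate_balanced hα.le (u j)).symm)
  refine key.trans ?_
  change ‖gradient (problem h.regular r).loss (embChain n T N (u (T + 1)))‖ₑ ≤ _
  rw [h.regular.gradient_loss]
  have hu1 : u (T + 1) = y := by simp [hu]
  have hgrad : D.baseGrad 0 (embChain n T N y)
      = mkPt (D.b - D.θ) 0 (fun _ => 0) fun _ _ => 0 := by
    refine ext_coord ?_ ?_ ?_ ?_ <;> simp [baseGrad, embChain_apply, hy, hsin]
  rw [hu1, hgrad, ← ofReal_norm]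
  refine ENNReal.ofReal_le_ofReal
    (abs_le_of_sq_le_sq ?_ (sub_nonneg.2 h.θ_le) |> (le_abs_self _).trans)
  rw [norm_sq_coord]
  simp

/-- The batch index and the iteration of the samples up to iteration `t`. -/
def past (m t : ℕ) : Finset (ℕ × Fin m) := Finset.range (t + 1) ×ˢ Finset.univ

lemma mem_past {m t : ℕ} {s : ℕ × Fin m} : s ∈ past m t ↔ s.1 ≤ t := by
  simp [past]

variable {hD : D.Regular} {A : (Fin n → Vec (dim n T N)) → Vec (dim n T N)}

lemma w_eq_message {M : MethodRun (problem hD r) A αmin} {ω : M.Ω}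
    {J : ℕ → Fin M.m → Fin n → Fin (N + 1)}
    (hJ : ∀ t l i, M.ξ t l i ω = label i.1 (J t l i.1)) (t : ℕ) :
    (fun i => M.w t i ω) = D.message (past M.m t) (fun s => M.α t s.1 s.2 ω)
      (fun s => M.query s.1 s.2 ω) (fun s i => J s.1 s.2 i) := by
  funext i
  rw [M.w_honest t ⟨i, Finset.mem_univ i⟩ ω, message, past, Finset.sum_product]
  refine Finset.sum_congr rfl fun j _ => Finset.sum_congr rfl fun l _ => ?_
  rw [hJ]
  exact congrArg _ (hD.stochGrad_label _ _ _)

lemma x0_mem_reached (k : ℕ) :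
    (mkPt 0 r (fun _ => 0) fun _ _ => 0 : Vec (dim n T N)) ∈ reached n T N k :=
  ⟨by simp, fun i _ => by simp⟩

/-- The outputs are confined to the points that the aggregated messages can reach. -/
lemma Hard.out_mem_reached (h : D.Hard κ ε)
    {M : MethodRun (problem h.regular r) (erasingMean κ) αmin}
    {ω : M.Ω} {J : ℕ → Fin M.m → Fin n → Fin (N + 1)}
    (hJ : ∀ t l i, M.ξ t l i ω = label i.1 (J t l i.1)) {v : ℕ → ℕ} (hv : Monotone v)
    (hstep : ∀ t, (∀ s ∈ past M.m t, M.query s.1 s.2 ω ∈ reached n T N (v s.1)) →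
      honestMean Finset.univ (D.message (past M.m t) (fun s => M.α t s.1 s.2 ω)
        (fun s => M.query s.1 s.2 ω) (fun s i => J s.1 s.2 i)) fl ^ 2
        ≤ κ * floorVar (D.message (past M.m t) (fun s => M.α t s.1 s.2 ω)
        (fun s => M.query s.1 s.2 ω) (fun s i => J s.1 s.2 i)) →
      erasingMean κ (D.message (past M.m t) (fun s => M.α t s.1 s.2 ω)
        (fun s => M.query s.1 s.2 ω) (fun s i => J s.1 s.2 i)) ∈ reached n T N (v (t + 1)))
    (t : ℕ) : M.out t ω ∈ reached n T N (v t) := by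
  refine MethodRun.out_mem_of_confined (M := M) (W := fun t => reached n T N (v t))
    (reached_mono.comp hv) (x0_mem_reached _) fun s _ hq => ?_
  rw [w_eq_message hJ]
  have hq' : ∀ p ∈ past M.m s, M.query p.1 p.2 ω ∈ reached n T N (v p.1) :=
    fun p hp => hq p.1 (mem_past.1 hp) p.2
  exact hstep s hq' (h.regular.floor_erased h.θ_nonneg h.θ_le h.tilt
    (fun _ _ => M.α_nonneg _ _ _ _) fun p hp => (hq' p hp).1)

lemma Hard.ae_out_mem_reached (h : D.Hard κ ε)
    (M : MethodRun (problem h.regular r) (erasingMean κ) αmin) :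
    let _ := M.mΩ
    ∀ᵐ ω ∂M.Pr, ∀ t, M.out t ω ∈ reached n T N t := by
  intro _
  filter_upwards [M.ae_label] with ω ⟨J, hJ⟩ t
  refine h.out_mem_reached hJ (v := id) monotone_id (fun t hq hfl => ?_) t
  refine erasingMean_mem_reached hfl fun i => chain_message_mem fun s hs => ?_
  exact initial_mono (Nat.succ_le_succ (mem_past.1 hs)) (h.zeroChain.sampleGrad_mem (hq s hs) _ _)

/-- Almost surely the floor coordinate is zero, which gives `b - θ` everywhere; the locked event
adds `3 * ε`. -/
lemma Hard.le_expGradNorm (h : D.Hard κ ε)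
    (M : MethodRun (problem h.regular r) (erasingMean κ) αmin) (t : ℕ) :
    ENNReal.ofReal (D.b - D.θ) + ENNReal.ofReal (3 * ε) * (let _ := M.mΩ
      M.Pr {ω | M.out t ω ∈ reached n T N T}) ≤ M.expGradNorm t := by
  let _ := M.mΩ
  have := M.prob
  have hmeas : MeasurableSet {ω | M.out t ω ∈ reached n T N T} :=
    ((M.measurable_out t).mono (M.ℱ.le t) le_rfl)
      (Submodule.closed_of_finiteDimensional (reached n T N T)).measurableSet
  calc ENNReal.ofReal (D.b - D.θ) + ENNReal.ofReal (3 * ε) *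
        M.Pr {ω | M.out t ω ∈ reached n T N T}
      = ∫⁻ ω, (ENNReal.ofReal (D.b - D.θ) + {ω | M.out t ω ∈ reached n T N T}.indicator
          (fun _ => ENNReal.ofReal (3 * ε)) ω) ∂M.Pr := by
        rw [lintegral_add_left measurable_const, lintegral_const, measure_univ, mul_one,
          lintegral_indicator_const hmeas]
    _ ≤ M.expGradNorm t := by
      refine lintegral_mono_ae ?_
      filter_upwards [h.ae_out_mem_reached M] with ω hω
      rw [h.regular.gradient_loss, ← ofReal_norm]
      by_cases hr : M.out t ω ∈ reached n T N T
      · rw [Set.indicator_of_mem (by exact hr), ← ENNReal.ofReal_add (sub_nonneg.2 h.θ_le)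
          (by linarith [h.ε_pos])]
        exact ENNReal.ofReal_le_ofReal (h.locked_le_norm hr)
      · rw [Set.indicator_of_notMem (by exact hr), add_zero]
        exact ENNReal.ofReal_le_ofReal (h.floor_le_norm (hω t).1)

lemma Hard.le_byzantineError (h : D.Hard κ ε) :
    ENNReal.ofReal (D.b - D.θ) ≤ byzantineError (problem h.regular r) (erasingMean κ) αmin :=
  le_iInf fun M => le_iInf fun t => le_trans le_self_add (h.le_expGradNorm M t)

/-- Before `B` queries the expected norm is at least `b - θ + 3 / 2 * ε`, while the tolerance is at
most `b - θ + ε` by `Hard.byzantineError_le`. -/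
lemma Hard.le_queryComplexity (h : D.Hard κ ε) (hα : 0 < αmin)
    (M : MethodRun (problem h.regular r) (erasingMean κ) αmin) {B : ℝ}
    (hB : ∀ K : ℕ, (K : ℝ) < B → 1 / 2 ≤ (let _ := M.mΩ
      M.Pr {ω | M.out (K / M.m) ω ∈ reached n T N T})) :
    ENNReal.ofReal B ≤ M.queryComplexity
      (byzantineError (problem h.regular r) (erasingMean κ) αmin + ENNReal.ofReal ε) := by
  refine le_iInf₂ fun K hK => ?_
  by_contra hlt
  have hKB : (K : ℝ) < B := by
    by_contra hc
    exact hlt (ENNReal.ofReal_le_of_le_toReal (by simpa using hc))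
  have h1 := (h.le_expGradNorm M (K / M.m)).trans hK
  have h2 := h1.trans (add_le_add_left (h.byzantineError_le (r := r) hα) _)
  have h3 := (ENNReal.add_le_add_iff_left ENNReal.ofReal_ne_top).1 h2
  have h4 := (mul_le_mul_right (hB K hKB) (ENNReal.ofReal (3 * ε))).trans h3
  have h5 : (1 / 2 : ℝ≥0∞) = ENNReal.ofReal (1 / 2) := by
    rw [ENNReal.ofReal_div_of_pos two_pos]; simp
  rw [h5, ← ENNReal.ofReal_mul (by linarith [h.ε_pos]),
    ENNReal.ofReal_le_ofReal_iff h.ε_pos.le] at h4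
  linarith [h.ε_pos]

lemma half_le_of_ae {Ω : Type*} {_ : MeasurableSpace Ω} {μ : Measure Ω} [IsProbabilityMeasure μ]
    {s : Set Ω} (h : ∀ᵐ ω ∂μ, ω ∈ s) : 1 / 2 ≤ μ s := by
  have h1 : μ Set.univ ≤ μ s := measure_mono_ae (h.mono fun _ hω _ => hω)
  rw [measure_univ] at h1
  refine le_trans ?_ h1
  simp

/-- An iteration opens at most one coordinate and uses at least one query. -/
lemma Hard.le_queryComplexity_chain (h : D.Hard κ ε) (hα : 0 < αmin)
    (M : MethodRun (problem h.regular r) (erasingMean κ) αmin) :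
    ENNReal.ofReal (T + 1) ≤ M.queryComplexity
      (byzantineError (problem h.regular r) (erasingMean κ) αmin + ENNReal.ofReal ε) := by
  refine h.le_queryComplexity hα M fun K hK => ?_
  have := M.prob
  let _ := M.mΩ
  have hKT : K ≤ T := Nat.lt_succ_iff.1 (by exact_mod_cast hK)
  have h1 : ∀ᵐ ω ∂M.Pr, ω ∈ {ω | M.out (K / M.m) ω ∈ reached n T N T} := by
    filter_upwards [h.ae_out_mem_reached M] with ω hω
    exact reached_mono ((Nat.div_le_self _ _).trans hKT) (hω _)
  exact half_le_of_ae h1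

end Bounds

end Design

/-! ### Query bounds from additive noise and from rare switching -/

namespace Design

variable {n T N : ℕ} {D : Design n T N} {κ ε r αmin : ℝ}

/-- Numbered consecutively by `s.1 * m + s.2`, the samples in question lie in an interval of length
`K`. -/
lemma card_filter_past_le {m t K k : ℕ} (hk : (t + 1) * m < (k + 1) * K) :
    ((past m t).filter fun s => k ≤ s.1 * m / K).card ≤ K := by
  have hK : 0 < K := by
    rcases Nat.eq_zero_or_pos K with h | h
    · simp [h] at hk
    · exact h
  refine (Finset.card_le_card_of_injOn (t := Finset.Ico (k * K) ((k + 1) * K))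
    (fun s => s.1 * m + s.2) (fun s hs => ?_) ?_).trans (by
      rw [Nat.card_Ico]; exact le_of_eq (by rw [Nat.add_mul]; omega))
  · have hs' := Finset.mem_filter.1 (Finset.mem_coe.1 hs)
    have h1 := (Nat.le_div_iff_mul_le hK).1 hs'.2
    have h2 := mem_past.1 hs'.1
    have h3 : s.1 * m + m ≤ (t + 1) * m := by
      rw [← Nat.succ_mul]; exact Nat.mul_le_mul_right _ (Nat.succ_le_succ h2)
    have h4 := s.2.2
    exact Finset.mem_coe.2 (Finset.mem_Ico.2 ⟨by dsimp only; omega, by dsimp only; omega⟩)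
  · rintro ⟨a, b⟩ _ ⟨a', b'⟩ _ hab
    simp only at hab
    have hb := b.2
    have hb' := b'.2
    have hm : 0 < m := by omega
    have h1 : a = a' := by
      have e1 : (a * m + b) / m = a := by
        rw [mul_comm, Nat.mul_add_div hm, Nat.div_eq_of_lt hb, add_zero]
      have e2 : (a' * m + b') / m = a' := by
        rw [mul_comm, Nat.mul_add_div hm, Nat.div_eq_of_lt hb', add_zero]
      rw [← e1, ← e2, hab]
    subst h1
    have : (b : ℕ) = b' := by omega
    exact Prod.ext rfl (Fin.ext this)

/-- With additive noise, every step along the chain takes many samples, because the aggregator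
hides the frontier in the noise. -/
lemma Hard.le_queryComplexity_noise (h : D.Hard κ ε) (hα : 0 < αmin)
    (M : MethodRun (problem h.regular r) (erasingMean κ) αmin) (hω : D.ω = 0) {K₁ : ℕ} {G : ℝ}
    (hK₁ : 0 < K₁) (hG : 4 * K₁ * G ^ 2 ≤ κ * D.s ^ 2) (hN : 2 * ((T + 1) * K₁) ≤ N + 1)
    (hGz : ∀ i : Fin (T + 1), ∀ z ∈ initial T i, |D.gH z i| ≤ G) :
    ENNReal.ofReal ((T + 1) * K₁) ≤ M.queryComplexity
      (byzantineError (problem h.regular r) (erasingMean κ) αmin + ENNReal.ofReal ε) := by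
  refine h.le_queryComplexity hα M fun K hK => ?_
  have := M.prob
  let _ := M.mΩ
  have hKT : K < (T + 1) * K₁ := by exact_mod_cast hK
  refine half_le_of_ae ?_
  filter_upwards [M.ae_label] with ω ⟨J, hJ⟩
  -- The claim is that one coordinate is opened per `K₁` samples: before iteration `t` at most `t *
  -- M.m / K₁` of them.
  have hv : Monotone fun t => t * M.m / K₁ := fun a b hab =>
    Nat.div_le_div_right (Nat.mul_le_mul_right _ hab)
  have hout := h.out_mem_reached hJ hv (fun t hq hfl => ?_) (K / M.m)
  · refine reached_mono ?_ hout
    have h1 := Nat.div_mul_le_self K M.m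
    exact Nat.lt_succ_iff.1 (Nat.div_lt_of_lt_mul (lt_of_le_of_lt h1 (by rwa [mul_comm] at hKT)))
  · have hchain : ∀ i, chain (D.message (past M.m t) (fun s => M.α t s.1 s.2 ω)
        (fun s => M.query s.1 s.2 ω) (fun s i => J s.1 s.2 i) i)
          ∈ initial T (t * M.m / K₁ + 1) := fun i => chain_message_mem fun s hs =>
      initial_mono (Nat.succ_le_succ (hv (mem_past.1 hs)))
        (h.zeroChain.sampleGrad_mem (hq s hs) _ _)
    -- If the allowance grows, propagation by one coordinate is harmless. Otherwise at most `K₁`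
    -- samples were taken where the frontier is visible, and the aggregator erases it.
    rcases (hv t.le_succ).lt_or_eq with hlt | heq
    · exact erasingMean_mem_reached hfl fun i => initial_mono hlt (hchain i)
    · simp only at heq
      rw [heq] at hchain
      refine erasingMean_mem_reached_of_frontier hfl hchain fun i hi => ?_
      have hlt : (t + 1) * M.m < ((i : ℕ) + 1) * K₁ := by
        rw [hi, mul_comm _ K₁]; exact Nat.lt_mul_div_succ _ hK₁
      refine frontier_erased h.two_le h.κ_nonneg hω (fun _ _ => M.α_nonneg _ _ _ _) ?_ hG
        (fun s hs => (hq s hs).1) (Finset.filter_subset (fun s => (i : ℕ) ≤ s.1 * M.m / K₁) _)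
        (card_filter_past_le hlt) (fun s hs hs' => ?_) (fun s hs => ?_)
      · have hcard : (past M.m t).card = (t + 1) * M.m := by simp [past]
        have : ((i : ℕ) + 1) * K₁ ≤ (T + 1) * K₁ := Nat.mul_le_mul_right _ (by omega)
        rw [hcard]; omega
      · have hlt' : s.1 * M.m / K₁ < i := by
          by_contra hc
          exact hs' (Finset.mem_filter.2 ⟨hs, not_lt.1 hc⟩)
        exact h.zeroChain.gH_mem _ _ (hq s hs).2 i hlt'
      · have hs' := (Finset.mem_filter.1 hs).1
        refine hGz i _ (initial_mono ?_ (hq s hs').2)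
        have : s.1 * M.m / K₁ ≤ t * M.m / K₁ := hv (mem_past.1 hs')
        rw [hi]; exact this.trans heq.le

/-- The number of samples before iteration `t` that switch `ψ` on. -/
def hits {hD : D.Regular} {A : (Fin n → Vec (dim n T N)) → Vec (dim n T N)}
    (M : MethodRun (problem hD r) A αmin) (t : ℕ) (ω : M.Ω) : ℕ :=
  ∑ s ∈ Finset.range t, ∑ l, ∑ i : Fin n,
    {ω | M.ξ s l ⟨i, Finset.mem_univ i⟩ ω = label i (0 : Fin (N + 1))}.indicator (fun _ => 1) ω

lemma measurableSet_hit {hD : D.Regular} {A : (Fin n → Vec (dim n T N)) → Vec (dim n T N)}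
    (M : MethodRun (problem hD r) A αmin) (s : ℕ) (l : Fin M.m) (i : Fin n) :
    let _ := M.mΩ
    MeasurableSet {ω | M.ξ s l ⟨i, Finset.mem_univ i⟩ ω = label i (0 : Fin (N + 1))} := by
  intro _
  exact (((M.measurable_ξ s l ⟨i, Finset.mem_univ i⟩).mono (M.ℱ.le _) le_rfl))
    (measurableSet_singleton _)

/-- Linearity of expectation; independence plays no role. -/
lemma lintegral_hits {hD : D.Regular} {A : (Fin n → Vec (dim n T N)) → Vec (dim n T N)}
    (M : MethodRun (problem hD r) A αmin) (t : ℕ) :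
    (@lintegral M.Ω M.mΩ M.Pr fun ω => (hits M t ω : ℝ≥0∞))
      = ((t * M.m * n : ℕ) : ℝ≥0∞) * ((N : ℝ≥0∞) + 1)⁻¹ := by
  let _ := M.mΩ
  have hm := measurableSet_hit M
  have h1 : ∀ ω, (hits M t ω : ℝ≥0∞) = ∑ s ∈ Finset.range t, ∑ l, ∑ i : Fin n,
      {ω | M.ξ s l ⟨i, Finset.mem_univ i⟩ ω = label i (0 : Fin (N + 1))}.indicator
        (fun _ => 1) ω := by
    intro ω
    unfold hits
    push_cast
    refine Finset.sum_congr rfl fun s _ => Finset.sum_congr rfl fun l _ =>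
      Finset.sum_congr rfl fun i _ => ?_
    by_cases hω : ω ∈ {ω | M.ξ s l ⟨i, Finset.mem_univ i⟩ ω = label i (0 : Fin (N + 1))}
    · rw [Set.indicator_of_mem hω, Set.indicator_of_mem hω, Nat.cast_one]
    · rw [Set.indicator_of_notMem hω, Set.indicator_of_notMem hω, Nat.cast_zero]
  have hi : ∀ s l (i : Fin n), Measurable
      ({ω | M.ξ s l ⟨i, Finset.mem_univ i⟩ ω = label i (0 : Fin (N + 1))}.indicator
        (fun _ => (1 : ℝ≥0∞))) := fun s l i => measurable_const.indicator (hm s l i)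
  simp only [h1]
  rw [lintegral_finsetSum _ fun s _ => Finset.measurable_fun_sum _ fun l _ =>
    Finset.measurable_fun_sum _ fun i _ => hi s l i]
  have h2 : ∀ s, ∫⁻ ω, ∑ l, ∑ i : Fin n,
      {ω | M.ξ s l ⟨i, Finset.mem_univ i⟩ ω = label i (0 : Fin (N + 1))}.indicator
        (fun _ => (1 : ℝ≥0∞)) ω ∂M.Pr = M.m * (n * ((N : ℝ≥0∞) + 1)⁻¹) := by
    intro s
    rw [lintegral_finsetSum _ fun l _ => Finset.measurable_fun_sum _ fun i _ => hi s l i]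
    have h3 : ∀ l, ∫⁻ ω, ∑ i : Fin n,
        {ω | M.ξ s l ⟨i, Finset.mem_univ i⟩ ω = label i (0 : Fin (N + 1))}.indicator
          (fun _ => (1 : ℝ≥0∞)) ω ∂M.Pr = n * ((N : ℝ≥0∞) + 1)⁻¹ := by
      intro l
      rw [lintegral_finsetSum _ fun i _ => hi s l i]
      have h4 : ∀ i, ∫⁻ ω, {ω | M.ξ s l ⟨i, Finset.mem_univ i⟩ ω
          = label i (0 : Fin (N + 1))}.indicator (fun _ => (1 : ℝ≥0∞)) ω ∂M.Pr
            = ((N : ℝ≥0∞) + 1)⁻¹ := by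
        intro i
        rw [lintegral_indicator_const (hm s l i), one_mul]
        exact M.measure_sample_eq s l i 0
      simp [h4]
    simp [h3]
  simp only [h2, Finset.sum_const, Finset.card_range, nsmul_eq_mul]
  push_cast
  ring

/-- If `ψ` hides the progress along the chain unless it is switched on, then every step along the
chain takes as many samples as it takes to switch `ψ` on. -/
lemma Hard.le_queryComplexity_switch (h : D.Hard κ ε) (hα : 0 < αmin)
    (M : MethodRun (problem h.regular r) (erasingMean κ) αmin) (hω : D.ω = 1)
    (hmask : ∀ k z, z ∈ initial T k → D.gH z - D.gψ z ∈ initial T k) :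
    ENNReal.ofReal ((T + 1) * (N + 1) / (2 * n)) ≤ M.queryComplexity
      (byzantineError (problem h.regular r) (erasingMean κ) αmin + ENNReal.ofReal ε) := by
  have hn0 : (0 : ℝ) < n := by exact_mod_cast h.regular.n_pos
  refine h.le_queryComplexity hα M fun K hK => ?_
  have := M.prob
  let _ := M.mΩ
  set t := K / M.m with ht
  change 1 / 2 ≤ M.Pr {ω | M.out t ω ∈ reached n T N T}
  have hmono : ∀ ω, Monotone fun t => hits M t ω := fun ω => monotone_nat_of_le_succ fun t => by
    simp only [hits]
    rw [Finset.sum_range_succ]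
    exact Nat.le_add_right _ _
  have hsub : ∀ᵐ ω ∂M.Pr, hits M t ω < T + 1 → M.out t ω ∈ reached n T N T := by
    filter_upwards [M.ae_label] with ω ⟨J, hJ⟩ hlt
    refine reached_mono (Nat.lt_succ_iff.1 hlt) (h.out_mem_reached hJ (hmono ω)
      (fun t hq hfl => erasingMean_mem_reached hfl fun i => chain_message_mem fun s hs => ?_) t)
    have hs' : s.1 + 1 ≤ t + 1 := Nat.succ_le_succ (mem_past.1 hs)
    -- A hit may open a coordinate but raises the count as well; any other sample is masked and
    -- opens nothing.
    by_cases hJs : J s.1 s.2 i = 0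
    · refine initial_mono (le_trans ?_ (hmono ω hs')) (h.zeroChain.sampleGrad_mem (hq s hs) _ _)
      simp only [hits]
      rw [Finset.sum_range_succ]
      refine Nat.add_le_add_left ?_ _
      have h1 : ω ∈ {ω | M.ξ s.1 s.2 ⟨i, Finset.mem_univ i⟩ ω = label i (0 : Fin (N + 1))} := by
        rw [Set.mem_ofPred_eq, hJ, ← hJs]
      refine le_trans (le_of_eq (Set.indicator_of_mem h1 fun _ => 1).symm) ?_
      refine le_trans (Finset.single_le_sum (f := fun i : Fin n =>
        {ω | M.ξ s.1 s.2 ⟨i, Finset.mem_univ i⟩ ω = label i (0 : Fin (N + 1))}.indicator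
          (fun _ => 1) ω) (fun _ _ => Nat.zero_le _) (Finset.mem_univ i)) ?_
      exact Finset.single_le_sum (f := fun l => ∑ i : Fin n,
        {ω | M.ξ s.1 l ⟨i, Finset.mem_univ i⟩ ω = label i (0 : Fin (N + 1))}.indicator
          (fun _ => 1) ω) (fun _ _ => Nat.zero_le _) (Finset.mem_univ s.2)
    · exact initial_mono (hmono ω ((Nat.le_succ _).trans hs'))
        (sampleGrad_mem_of_masked hω hmask (hq s hs) _ hJs)
  have hmeas : Measurable fun ω => (hits M t ω : ℝ≥0∞) := by
    have hm := measurableSet_hit M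
    have : Measurable fun ω => hits M t ω := by
      unfold hits
      exact Finset.measurable_fun_sum _ fun s _ => Finset.measurable_fun_sum _ fun l _ =>
        Finset.measurable_fun_sum _ fun i _ => measurable_const.indicator (hm s l i)
    exact (measurable_of_countable _).comp this
  -- By Markov's inequality: fewer than `(T + 1) * (N + 1) / (2 * n)` queries give at most `(T + 1)
  -- / 2` hits on average.
  have hmarkov := meas_ge_le_lintegral_div (μ := M.Pr) hmeas.aemeasurable
    (ε := ((T + 1 : ℕ) : ℝ≥0∞)) (by simp) (by simp)
  have hle : M.Pr {ω | ((T + 1 : ℕ) : ℝ≥0∞) ≤ hits M t ω} ≤ 1 / 2 := by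
    refine hmarkov.trans ?_
    rw [lintegral_hits]
    have h1 : (t * M.m : ℕ) ≤ K := Nat.div_mul_le_self K M.m
    have h2 : ((t * M.m * n : ℕ) : ℝ) * ((N : ℝ) + 1)⁻¹ / ((T + 1 : ℕ) : ℝ) ≤ 1 / 2 := by
      have h3 : ((t * M.m : ℕ) : ℝ) ≤ K := by exact_mod_cast h1
      rw [Nat.cast_mul (t * M.m) n, div_le_iff₀ (by positivity), ← div_eq_mul_inv,
        div_le_iff₀ (by positivity)]
      rw [lt_div_iff₀ (by positivity)] at hK
      push_cast at h3 ⊢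
      nlinarith
    have h4 : ENNReal.ofReal (((t * M.m * n : ℕ) : ℝ) * ((N : ℝ) + 1)⁻¹ / ((T + 1 : ℕ) : ℝ))
        = ((t * M.m * n : ℕ) : ℝ≥0∞) * ((N : ℝ≥0∞) + 1)⁻¹ / ((T + 1 : ℕ) : ℝ≥0∞) := by
      rw [ENNReal.ofReal_div_of_pos (by positivity), ENNReal.ofReal_mul (by positivity),
        ENNReal.ofReal_inv_of_pos (by positivity), ENNReal.ofReal_natCast, ENNReal.ofReal_natCast]
      congr 3
      rw [show (N : ℝ) + 1 = ((N + 1 : ℕ) : ℝ) by push_cast; rfl, ENNReal.ofReal_natCast]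
      push_cast; rfl
    have h5 : (1 / 2 : ℝ≥0∞) = ENNReal.ofReal (1 / 2) := by
      rw [ENNReal.ofReal_div_of_pos two_pos]; simp
    rw [← h4, h5]
    exact ENNReal.ofReal_le_ofReal h2
  have hcover : M.Pr Set.univ ≤ M.Pr {ω | M.out t ω ∈ reached n T N T}
      + M.Pr {ω | ((T + 1 : ℕ) : ℝ≥0∞) ≤ hits M t ω} := by
    refine le_trans (measure_mono_ae ?_) (measure_union_le _ _)
    filter_upwards [hsub] with ω hω _
    by_cases hlt : hits M t ω < T + 1
    · exact Or.inl (hω hlt)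
    · exact Or.inr (by
        have : T + 1 ≤ hits M t ω := not_lt.1 hlt
        change ((T + 1 : ℕ) : ℝ≥0∞) ≤ (hits M t ω : ℝ≥0∞)
        exact_mod_cast this)
  rw [measure_univ] at hcover
  by_contra hc
  have hlt : M.Pr {ω | M.out t ω ∈ reached n T N T}
      + M.Pr {ω | ((T + 1 : ℕ) : ℝ≥0∞) ≤ hits M t ω} < 1 / 2 + 1 / 2 :=
    ENNReal.add_lt_add_of_lt_of_le (ne_top_of_le_ne_top (by simp) hle) (not_le.1 hc) hle
  rw [ENNReal.add_halves] at hlt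
  exact absurd hcover (not_le.2 hlt)

end Design

/-! ### Tilts, slopes and neighbours -/

/-- Tilts of the local losses that average to zero and have variance `ζ ^ 2`. -/
def tilt (n : ℕ) (ζ : ℝ) (i : Fin n) : ℝ :=
  if (i : ℕ) = 0 then ζ * √(n / 2) else if (i : ℕ) = 1 then -(ζ * √(n / 2)) else 0

lemma sum_tilt {n : ℕ} (hn : 2 ≤ n) (ζ : ℝ) : ∑ i, tilt n ζ i = 0 := by
  obtain ⟨m, rfl⟩ := Nat.exists_eq_add_of_le' hn
  rw [Fin.sum_univ_succ, Fin.sum_univ_succ]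
  simp [tilt]

lemma sum_tilt_sq {n : ℕ} (hn : 2 ≤ n) (ζ : ℝ) : (n : ℝ)⁻¹ * ∑ i, tilt n ζ i ^ 2 = ζ ^ 2 := by
  have hn' : (n : ℝ) ≠ 0 := by positivity
  have h : ∑ i, tilt n ζ i ^ 2 = 2 * (ζ * √(n / 2)) ^ 2 := by
    obtain ⟨m, rfl⟩ := Nat.exists_eq_add_of_le' hn
    rw [Fin.sum_univ_succ, Fin.sum_univ_succ]
    simp [tilt]
    ring
  rw [h, mul_pow, Real.sq_sqrt (by positivity)]
  field_simp

/-- The amount by which the slope of the floor coordinate drops at the end of the chain. -/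
def drop (x ε : ℝ) : ℝ := min (x / 4) (4 * ε)

lemma drop_nonneg {x ε : ℝ} (hx : 0 ≤ x) (hε : 0 ≤ ε) : 0 ≤ drop x ε :=
  le_min (by positivity) (by positivity)

lemma drop_le_left (x ε : ℝ) : drop x ε ≤ x / 4 := min_le_left _ _

lemma drop_le_right (x ε : ℝ) : drop x ε ≤ 4 * ε := min_le_right _ _

/-- Explains the minimum in `drop`. For `x ≥ 16 * ε` the left base is `x / 2 - ε`, and the slope
alone locks; for smaller `x` the chain gradient `4 * ε` carries the estimate. -/
lemma slope_lock {x ε : ℝ} (hx : 0 ≤ x) (hε : 0 ≤ ε) :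
    (x / 2 - drop x ε + 3 * ε) ^ 2 ≤ (x / 2) ^ 2 + (4 * ε) ^ 2 := by
  unfold drop
  rcases min_cases (x / 4) (4 * ε) with ⟨h, h'⟩ | ⟨h, h'⟩ <;> rw [h]
  · nlinarith [sq_nonneg (x - 6 * ε), sq_nonneg (x / 4 - ε)]
  · nlinarith

section Neighbours

variable {T : ℕ}

/-- The coordinates shifted to the right, starting with `c`. -/
def lft (c : ℝ) (z : Vec (T + 1)) : Fin (T + 1) → ℝ := Fin.cons c fun j : Fin T => z j.castSucc

/-- The coordinates shifted to the left, ending with `c`. -/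
def rgt (c : ℝ) (z : Vec (T + 1)) : Fin (T + 1) → ℝ :=
  Fin.snoc (α := fun _ => ℝ) (fun j : Fin T => z j.succ) c

@[simp] lemma lft_zero (c : ℝ) (z : Vec (T + 1)) : lft c z 0 = c := rfl

@[simp] lemma lft_succ (c : ℝ) (z : Vec (T + 1)) (j : Fin T) :
    lft c z j.succ = z j.castSucc := rfl

@[simp] lemma rgt_last (c : ℝ) (z : Vec (T + 1)) : rgt c z (Fin.last T) = c := by
  simp [rgt]

@[simp] lemma rgt_castSucc (c : ℝ) (z : Vec (T + 1)) (j : Fin T) :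
    rgt c z j.castSucc = z j.succ := by
  simp [rgt]

lemma sum_lft_sq_le (z : Vec (T + 1)) : ∑ i, lft 0 z i ^ 2 ≤ ‖z‖ ^ 2 := by
  rw [EuclideanSpace.real_norm_sq_eq, Fin.sum_univ_succ, Fin.sum_univ_castSucc (n := T)]
  simp only [lft_zero, lft_succ]
  nlinarith [sq_nonneg (z (Fin.last T))]

lemma sum_rgt_sq_le (c : ℝ) (z : Vec (T + 1)) : ∑ i, rgt c z i ^ 2 ≤ ‖z‖ ^ 2 + c ^ 2 := by
  rw [EuclideanSpace.real_norm_sq_eq, Fin.sum_univ_castSucc,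
    Fin.sum_univ_succ (f := fun i => z i ^ 2)]
  simp only [rgt_last, rgt_castSucc]
  nlinarith [sq_nonneg (z 0)]

lemma lft_eq_zero {k : ℕ} {z : Vec (T + 1)} (hz : z ∈ initial T k) {i : Fin (T + 1)}
    (hi : k + 1 ≤ i) (c : ℝ) : lft c z i = 0 := by
  induction i using Fin.cases with
  | zero => simp at hi
  | succ j =>
    rw [lft_succ]
    exact hz _ (by simpa using hi)

lemma rgt_eq_zero {k : ℕ} {z : Vec (T + 1)} (hz : z ∈ initial T k) {i : Fin (T + 1)}
    (hi : k ≤ i) {c : ℝ} (hc : c = 0) : rgt c z i = 0 := by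
  induction i using Fin.lastCases with
  | last => rw [rgt_last, hc]
  | cast j =>
    rw [rgt_castSucc]
    exact hz _ (by simp at hi ⊢; omega)

end Neighbours

/-! ### A quadratic chain -/

section Quadratic

variable {T : ℕ} {μ β q s : ℝ}

/-- The Hessian of the quadratic chain. -/
def quadMap (T : ℕ) (μ β q : ℝ) : Vec (T + 1) →L[ℝ] Vec (T + 1) :=
  LinearMap.toContinuousLinearMap
    { toFun := fun z => WithLp.toLp 2 fun i =>
        -- The ghost neighbour `q * z_last` on the right replaces an infinite continuation of the
        -- chain and makes the minimizer exactly geometric.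
        μ * z i + β * (2 * z i - lft 0 z i - rgt (q * z (Fin.last T)) z i)
      map_add' := fun x y => by
        ext i
        have h1 : lft 0 (x + y) i = lft 0 x i + lft 0 y i := by
          induction i using Fin.cases <;> simp
        have h2 : rgt (q * (x + y) (Fin.last T)) (x + y) i
            = rgt (q * x (Fin.last T)) x i + rgt (q * y (Fin.last T)) y i := by
          induction i using Fin.lastCases <;> simp
          ring
        simp only [PiLp.add_apply] at h1 h2 ⊢
        rw [h1, h2]; ring
      map_smul' := fun c x => by
        ext i
        have h1 : lft 0 (c • x) i = c * lft 0 x i := by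
          induction i using Fin.cases <;> simp
        have h2 : rgt (q * (c • x) (Fin.last T)) (c • x) i
            = c * rgt (q * x (Fin.last T)) x i := by
          induction i using Fin.lastCases <;> simp
          ring
        simp only [PiLp.smul_apply, smul_eq_mul, RingHom.id_apply] at h1 h2 ⊢
        rw [h1, h2]; ring }

lemma quadMap_apply (z : Vec (T + 1)) (i : Fin (T + 1)) : quadMap T μ β q z i
    = μ * z i + β * (2 * z i - lft 0 z i - rgt (q * z (Fin.last T)) z i) := rfl

lemma inner_quadMap (x y : Vec (T + 1)) : inner ℝ (quadMap T μ β q x) y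
    = (μ + 2 * β) * ∑ i, x i * y i - β * (∑ j : Fin T, x j.castSucc * y j.succ
      + ∑ j : Fin T, x j.succ * y j.castSucc + q * (x (Fin.last T) * y (Fin.last T))) := by
  rw [inner_eq_sum]
  have h1 : ∑ i, lft 0 x i * y i = ∑ j : Fin T, x j.castSucc * y j.succ := by
    rw [Fin.sum_univ_succ]; simp
  have h2 : ∑ i, rgt (q * x (Fin.last T)) x i * y i
      = ∑ j : Fin T, x j.succ * y j.castSucc + q * (x (Fin.last T) * y (Fin.last T)) := by
    rw [Fin.sum_univ_castSucc]; simp; ring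
  have h3 : ∀ i, quadMap T μ β q x i * y i = (μ + 2 * β) * (x i * y i)
      - β * (lft 0 x i * y i) - β * (rgt (q * x (Fin.last T)) x i * y i) := by
    intro i; rw [quadMap_apply]; ring
  simp only [h3, Finset.sum_sub_distrib, ← Finset.mul_sum]
  rw [h1, h2]; ring

lemma inner_quadMap_comm (x y : Vec (T + 1)) :
    inner ℝ (quadMap T μ β q x) y = inner ℝ x (quadMap T μ β q y) := by
  rw [real_inner_comm (quadMap T μ β q y), inner_quadMap, inner_quadMap]
  simp only [mul_comm (y _)]
  ring

/-- The part with factor `β` is the sum of `z 0 ^ 2`, the squared differences and `(1 - q) * z_last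
^ 2`. The last square is kept to pay for the coupling. -/
lemma le_inner_quadMap (hβ : 0 ≤ β) (z : Vec (T + 1)) :
    μ * ‖z‖ ^ 2 + β * (1 - q) * z (Fin.last T) ^ 2 ≤ inner ℝ (quadMap T μ β q z) z := by
  have h1 : ∑ i, z i * z i = ∑ j : Fin T, z j.castSucc ^ 2 + z (Fin.last T) ^ 2 := by
    rw [Fin.sum_univ_castSucc]; simp only [sq]
  have h2 : ∑ i, z i * z i = z 0 ^ 2 + ∑ j : Fin T, z j.succ ^ 2 := by
    rw [Fin.sum_univ_succ]; simp only [sq]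
  have h3 : ∑ i, z i * z i = ‖z‖ ^ 2 := by
    rw [EuclideanSpace.real_norm_sq_eq]; simp only [sq]
  have h4 : 0 ≤ ∑ j : Fin T, (z j.castSucc - z j.succ) ^ 2 := Finset.sum_nonneg fun _ _ =>
    sq_nonneg _
  have h5 : ∑ j : Fin T, (z j.castSucc - z j.succ) ^ 2 = ∑ j : Fin T, z j.castSucc ^ 2
      - 2 * ∑ j : Fin T, z j.castSucc * z j.succ + ∑ j : Fin T, z j.succ ^ 2 := by
    simp only [sub_sq, Finset.sum_add_distrib, Finset.sum_sub_distrib, Finset.mul_sum, mul_assoc]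
  have h6 : ∑ j : Fin T, z j.succ * z j.castSucc = ∑ j : Fin T, z j.castSucc * z j.succ :=
    Finset.sum_congr rfl fun _ _ => mul_comm _ _
  rw [inner_quadMap, h6]
  have h7 : (1 - q) * z (Fin.last T) ^ 2 ≤ 2 * ∑ i, z i * z i
      - (2 * ∑ j : Fin T, z j.castSucc * z j.succ + q * (z (Fin.last T) * z (Fin.last T))) := by
    nlinarith [sq_nonneg (z 0)]
  have := mul_le_mul_of_nonneg_left h7 hβ
  rw [← h3]
  linarith

lemma norm_quadMap_le (hμ : 0 ≤ μ) (hβ : 0 ≤ β) (hq : 0 ≤ q) (hq1 : q ≤ 1) (z : Vec (T + 1)) :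
    ‖quadMap T μ β q z‖ ≤ (μ + 5 * β) * ‖z‖ := by
  set u : Vec (T + 1) := WithLp.toLp 2 fun i =>
    2 * z i - lft 0 z i - rgt (q * z (Fin.last T)) z i with hu
  have h1 : quadMap T μ β q z = μ • z + β • u := by
    ext i; simp [quadMap_apply, hu]
  have h2 : ‖u‖ ≤ 5 * ‖z‖ := by
    refine abs_le_of_sq_le_sq' ?_ (by positivity) |>.2
    -- The right shift contributes twice because of the ghost neighbour, in total `8 + 4 + 2 * 4 ≤
    -- 25`.
    have h3 : ‖u‖ ^ 2 ≤ ∑ i, (8 * z i ^ 2 + 4 * lft 0 z i ^ 2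
        + 4 * rgt (q * z (Fin.last T)) z i ^ 2) := by
      rw [EuclideanSpace.real_norm_sq_eq]
      refine Finset.sum_le_sum fun i _ => ?_
      simp only [hu]
      nlinarith [sq_nonneg (z i + lft 0 z i), sq_nonneg (lft 0 z i - rgt (q * z (Fin.last T)) z i),
        sq_nonneg (z i + rgt (q * z (Fin.last T)) z i),
        sq_nonneg (2 * z i + lft 0 z i + rgt (q * z (Fin.last T)) z i)]
    rw [Finset.sum_add_distrib, Finset.sum_add_distrib, ← Finset.mul_sum, ← Finset.mul_sum,
      ← Finset.mul_sum, ← EuclideanSpace.real_norm_sq_eq] at h3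
    have h4 := sum_lft_sq_le z
    have h5 := sum_rgt_sq_le (q * z (Fin.last T)) z
    have h6 : (q * z (Fin.last T)) ^ 2 ≤ ‖z‖ ^ 2 := by
      rw [← sq_abs, abs_mul, abs_of_nonneg hq]
      refine pow_le_pow_left₀ (by positivity) ?_ 2
      have := Design.abs_le_norm_coord z (Fin.last T)
      nlinarith [abs_nonneg (z (Fin.last T))]
    nlinarith [norm_nonneg z]
  rw [h1]
  refine (norm_add_le _ _).trans ?_
  rw [norm_smul, norm_smul, Real.norm_of_nonneg hμ, Real.norm_of_nonneg hβ]
  nlinarith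

/-- The first unit vector. -/
def firstVec (T : ℕ) : Vec (T + 1) := EuclideanSpace.single 0 1

/-- The quadratic chain. -/
def quad (T : ℕ) (μ β q s : ℝ) (z : Vec (T + 1)) : ℝ :=
  1 / 2 * inner ℝ (quadMap T μ β q z) z - β * s * z 0

/-- The gradient of the quadratic chain. -/
def quadGrad (T : ℕ) (μ β q s : ℝ) (z : Vec (T + 1)) : Vec (T + 1) :=
  quadMap T μ β q z - (β * s) • firstVec T

lemma quad_expand (z z' : Vec (T + 1)) : quad T μ β q s z'
    = quad T μ β q s z + inner ℝ (quadGrad T μ β q s z) (z' - z)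
      + 1 / 2 * inner ℝ (quadMap T μ β q (z' - z)) (z' - z) := by
  have h1 : inner ℝ (firstVec T) (z' - z) = z' 0 - z 0 := by
    simp [firstVec, EuclideanSpace.inner_single_left]
  have h2 := inner_quadMap_comm (μ := μ) (β := β) (q := q) z z'
  have h3 : inner ℝ (quadMap T μ β q z') z = inner ℝ z (quadMap T μ β q z') :=
    real_inner_comm _ _
  unfold quad quadGrad
  rw [inner_sub_left, real_inner_smul_left, h1, map_sub]
  simp only [inner_sub_left, inner_sub_right]
  linarith

end Quadratic

section Quadratic

variable {T : ℕ} {μ β q s : ℝ}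

lemma hasGradientAt_quad (z : Vec (T + 1)) :
    HasGradientAt (quad T μ β q s) (quadGrad T μ β q s z) z := by
  have h := (((quadMap T μ β q).hasFDerivAt.inner ℝ (hasFDerivAt_id z)).const_mul (1 / 2 : ℝ)).sub
    ((Design.hasFDerivAt_coord 0 z).const_mul (β * s))
  refine hasGradientAt_of_forall h fun v => ?_
  have h1 : inner ℝ (firstVec T) v = v 0 := by
    simp [firstVec, EuclideanSpace.inner_single_left]
  have h2 := inner_quadMap_comm (μ := μ) (β := β) (q := q) v z
  rw [← inner_eq_sum, quadGrad, inner_sub_left, real_inner_smul_left, h1]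
  simp only [sub_apply, smul_apply, ContinuousLinearMap.comp_apply,
    ContinuousLinearMap.prod_apply, fderivInnerCLM_apply, ContinuousLinearMap.id_apply,
    smul_eq_mul, id, Design.proj_apply']
  rw [h2, real_inner_comm v]
  have : inner ℝ v (quadMap T μ β q z) = inner ℝ (quadMap T μ β q z) v := real_inner_comm _ _
  linarith

lemma continuous_quadGrad : Continuous (quadGrad T μ β q s) := by
  unfold quadGrad; fun_prop

lemma norm_quadGrad_sub_le (hμ : 0 ≤ μ) (hβ : 0 ≤ β) (hq : 0 ≤ q) (hq1 : q ≤ 1)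
    (z z' : Vec (T + 1)) :
    ‖quadGrad T μ β q s z - quadGrad T μ β q s z'‖ ≤ (μ + 5 * β) * ‖z - z'‖ := by
  have : quadGrad T μ β q s z - quadGrad T μ β q s z' = quadMap T μ β q (z - z') := by
    rw [map_sub]; unfold quadGrad; abel
  rw [this]
  exact norm_quadMap_le hμ hβ hq hq1 _

lemma quad_strongConvex (hβ : 0 ≤ β) (z z' : Vec (T + 1)) :
    quad T μ β q s z + inner ℝ (quadGrad T μ β q s z) (z' - z) + μ / 2 * ‖z' - z‖ ^ 2
      + β * (1 - q) / 2 * (z' (Fin.last T) - z (Fin.last T)) ^ 2 ≤ quad T μ β q s z' := by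
  have := le_inner_quadMap (μ := μ) (q := q) hβ (z' - z)
  rw [PiLp.sub_apply] at this
  rw [quad_expand z z']
  linarith

lemma quadGrad_apply (z : Vec (T + 1)) (i : Fin (T + 1)) : quadGrad T μ β q s z i
    = μ * z i + β * (2 * z i - lft s z i - rgt (q * z (Fin.last T)) z i) := by
  have h : lft s z i = lft 0 z i + s * firstVec T i := by
    induction i using Fin.cases <;> simp [firstVec]
  rw [h]
  simp only [quadGrad, PiLp.sub_apply, PiLp.smul_apply, quadMap_apply, smul_eq_mul]
  ring

lemma quadGrad_mem {k : ℕ} {z : Vec (T + 1)} (hz : z ∈ initial T k) :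
    quadGrad T μ β q s z ∈ initial T (k + 1) := by
  intro i hi
  have h1 : z (Fin.last T) = 0 := hz _ (by have := i.2; simp; omega)
  rw [quadGrad_apply, hz i (by omega), lft_eq_zero hz hi, rgt_eq_zero hz (by omega) (by simp [h1])]
  ring

lemma quadGrad_zero : quadGrad T μ β q s 0 = -(β * s) • firstVec T := by
  simp [quadGrad]

lemma exists_quadGrad_ne_zero (hβ : β ≠ 0) (hs : s ≠ 0) (k : Fin (T + 1)) :
    ∃ z ∈ initial T k, quadGrad T μ β q s z k ≠ 0 := by
  induction k using Fin.cases with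
  | zero =>
    refine ⟨0, zero_mem _, ?_⟩
    simp [quadGrad_zero, firstVec, hβ, hs]
  | succ j =>
    have hz : EuclideanSpace.single j.castSucc (1 : ℝ) ∈ initial T (j.succ : Fin (T + 1)) := by
      intro i hi
      have : i ≠ j.castSucc := by
        intro h; subst h; simp at hi
      simp [this]
    refine ⟨_, hz, ?_⟩
    rw [quadGrad_apply, hz _ le_rfl, rgt_eq_zero hz le_rfl (by simp)]
    simpa using hβ

/-- The minimizer of the quadratic chain. -/
def quadMin (T : ℕ) (q s : ℝ) : Vec (T + 1) := WithLp.toLp 2 fun i => s * q ^ ((i : ℕ) + 1)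

lemma quadMin_last : quadMin T q s (Fin.last T) = s * q ^ (T + 1) := rfl

/-- The condition on `β` says that `q` is a root of the three-term recurrence; the source `s` on the
left and the ghost on the right continue the same geometric sequence. -/
lemma quadGrad_quadMin (h : β * (1 - q) ^ 2 = μ * q) :
    quadGrad T μ β q s (quadMin T q s) = 0 := by
  ext i
  have h1 : lft s (quadMin T q s) i = s * q ^ (i : ℕ) := by
    induction i using Fin.cases <;> simp [quadMin]
  have h2 : rgt (q * quadMin T q s (Fin.last T)) (quadMin T q s) i = s * q ^ ((i : ℕ) + 2) := by
    induction i using Fin.lastCases with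
    | last => rw [rgt_last, quadMin_last]; simp; ring
    | cast j => simp [quadMin]
  rw [quadGrad_apply, h1, h2]
  simp only [quadMin, PiLp.zero_apply]
  linear_combination (-(s * q ^ (i : ℕ))) * h

lemma le_quad (hμ : 0 ≤ μ) (hβ : 0 ≤ β) (hq1 : q ≤ 1) (h : β * (1 - q) ^ 2 = μ * q)
    (z : Vec (T + 1)) : quad T μ β q s (quadMin T q s) ≤ quad T μ β q s z := by
  have := quad_strongConvex (T := T) (μ := μ) (q := q) (s := s) hβ (quadMin T q s) z
  rw [quadGrad_quadMin h, inner_zero_left] at this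
  have h1 : 0 ≤ β * (1 - q) / 2 * (z (Fin.last T) - quadMin T q s (Fin.last T)) ^ 2 :=
    mul_nonneg (by have : 0 ≤ 1 - q := by linarith
                   positivity) (sq_nonneg _)
  have h2 : 0 ≤ μ / 2 * ‖z - quadMin T q s‖ ^ 2 := by positivity
  linarith

lemma geom_sum_mul_le {r : ℝ} (hr : 0 ≤ r) (m : ℕ) :
    (∑ i ∈ Finset.range m, r ^ (i + 1)) * (1 - r) ≤ r := by
  have h : ∀ m : ℕ, (∑ i ∈ Finset.range m, r ^ (i + 1)) * (1 - r) = r - r ^ (m + 1) := by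
    intro m
    induction m with
    | zero => simp
    | succ m ih => rw [Finset.sum_range_succ, add_mul, ih]; ring
  rw [h]
  have : 0 ≤ r ^ (m + 1) := by positivity
  linarith

lemma geom_sum_inv_mul_le {r : ℝ} (hr : 0 < r) (m : ℕ) :
    (∑ i ∈ Finset.range m, r⁻¹ ^ (i + 1)) * (1 - r) ≤ r⁻¹ ^ m := by
  induction m with
  | zero => simp
  | succ m ih =>
    rw [Finset.sum_range_succ, add_mul]
    have : r⁻¹ ^ (m + 1) * (1 - r) = r⁻¹ ^ (m + 1) - r⁻¹ ^ m := by
      rw [mul_sub, pow_succ]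
      field_simp
    linarith

lemma norm_sq_quadMin_le : ‖quadMin T q s‖ ^ 2 * (1 - q ^ 2) ≤ s ^ 2 * q ^ 2 := by
  have h : ‖quadMin T q s‖ ^ 2 = s ^ 2 * ∑ i ∈ Finset.range (T + 1), (q ^ 2) ^ (i + 1) := by
    rw [EuclideanSpace.real_norm_sq_eq, ← Fin.sum_univ_eq_sum_range (fun i => (q ^ 2) ^ (i + 1)),
      Finset.mul_sum]
    refine Finset.sum_congr rfl fun i _ => ?_
    simp only [quadMin]
    ring
  rw [h, mul_assoc]
  exact mul_le_mul_of_nonneg_left (geom_sum_mul_le (sq_nonneg q) _) (sq_nonneg s)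

/-- As long as the last coordinate vanishes, the gradient of the quadratic chain is large. -/
lemma le_norm_sq_quadGrad (hq : 0 < q) (hq1 : q < 1) (h : β * (1 - q) ^ 2 = μ * q)
    {z : Vec (T + 1)} (hz : z (Fin.last T) = 0) :
    (β * s) ^ 2 * (1 - q ^ 2) ^ 3 * (q ^ T) ^ 2 ≤ ‖quadGrad T μ β q s z‖ ^ 2 := by
  -- A solution of the homogeneous recurrence that vanishes just left of the chain: the Hessian maps
  -- it to a multiple of the last unit vector, which is orthogonal to `z`. Pairing it with the
  -- gradient leaves only the source, and Cauchy–Schwarz finishes.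
  set y : Vec (T + 1) := WithLp.toLp 2 fun i => q⁻¹ ^ ((i : ℕ) + 1) - q ^ ((i : ℕ) + 1) with hy
  have hlft : ∀ i, lft 0 y i = q⁻¹ ^ (i : ℕ) - q ^ (i : ℕ) := by
    intro i
    induction i using Fin.cases <;> simp [hy]
  have hAy : ∀ j : Fin T, quadMap T μ β q y j.castSucc = 0 := by
    intro j
    rw [quadMap_apply, hlft, rgt_castSucc]
    simp only [hy, Fin.val_castSucc, Fin.val_succ]
    have e1 : q⁻¹ ^ ((j : ℕ) + 1) = q⁻¹ ^ (j : ℕ) * q⁻¹ := pow_succ _ _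
    have e2 : q⁻¹ ^ ((j : ℕ) + 1 + 1) = q⁻¹ ^ (j : ℕ) * q⁻¹ * q⁻¹ := by rw [pow_succ, pow_succ]
    rw [e2, e1]
    have hqi : q * q⁻¹ = 1 := mul_inv_cancel₀ hq.ne'
    have h1 : β * (1 - q⁻¹) ^ 2 = μ * q⁻¹ := by
      have : (1 - q⁻¹) ^ 2 = (1 - q) ^ 2 * (q⁻¹) ^ 2 := by field_simp; ring
      rw [this, ← mul_assoc, h, mul_assoc, sq, ← mul_assoc q, hqi, one_mul]
    linear_combination (-(q⁻¹ ^ (j : ℕ))) * h1 + q ^ (j : ℕ) * h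
  have hinner : inner ℝ (quadGrad T μ β q s z) y = -(β * s) * (q⁻¹ - q) := by
    rw [quadGrad, inner_sub_left, inner_quadMap_comm, inner_eq_sum, Fin.sum_univ_castSucc,
      real_inner_smul_left]
    simp only [hAy, hz]
    have : inner ℝ (firstVec T) y = q⁻¹ - q := by
      simp [firstVec, EuclideanSpace.inner_single_left, hy]
    rw [this]; simp
  have hy2 : ‖y‖ ^ 2 * (1 - q ^ 2) ≤ (q⁻¹ ^ 2) ^ (T + 1) := by
    have hq2 : 0 ≤ 1 - q ^ 2 := by nlinarith
    have : ‖y‖ ^ 2 ≤ ∑ i ∈ Finset.range (T + 1), ((q ^ 2)⁻¹) ^ (i + 1) := by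
      rw [EuclideanSpace.real_norm_sq_eq,
        ← Fin.sum_univ_eq_sum_range (fun i => ((q ^ 2)⁻¹) ^ (i + 1))]
      refine Finset.sum_le_sum fun i _ => ?_
      simp only [hy]
      have e1 : ((q ^ 2)⁻¹) ^ ((i : ℕ) + 1) = (q⁻¹ ^ ((i : ℕ) + 1)) ^ 2 := by
        rw [← inv_pow, ← pow_mul, ← pow_mul, mul_comm]
      have e2 : q ^ ((i : ℕ) + 1) ≤ q⁻¹ ^ ((i : ℕ) + 1) :=
        pow_le_pow_left₀ hq.le (hq1.le.trans (one_le_inv₀ hq |>.2 hq1.le)) _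
      have e3 : 0 ≤ q ^ ((i : ℕ) + 1) := by positivity
      rw [e1]
      nlinarith
    refine (mul_le_mul_of_nonneg_right this hq2).trans ?_
    rw [inv_pow]
    exact geom_sum_inv_mul_le (by positivity) _
  have hcs := abs_real_inner_le_norm (quadGrad T μ β q s z) y
  rw [hinner] at hcs
  have hcs2 : ((β * s) * (q⁻¹ - q)) ^ 2 ≤ ‖quadGrad T μ β q s z‖ ^ 2 * ‖y‖ ^ 2 := by
    have := pow_le_pow_left₀ (abs_nonneg _) hcs 2
    rw [sq_abs] at this
    rw [← mul_pow]; linarith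
  have hq2 : 0 < 1 - q ^ 2 := by nlinarith
  have h5 : ((β * s) * (q⁻¹ - q)) ^ 2 * (1 - q ^ 2)
      ≤ ‖quadGrad T μ β q s z‖ ^ 2 * (q⁻¹ ^ 2) ^ (T + 1) := by
    calc _ ≤ ‖quadGrad T μ β q s z‖ ^ 2 * ‖y‖ ^ 2 * (1 - q ^ 2) :=
          mul_le_mul_of_nonneg_right hcs2 hq2.le
      _ = ‖quadGrad T μ β q s z‖ ^ 2 * (‖y‖ ^ 2 * (1 - q ^ 2)) := by ring
      _ ≤ _ := mul_le_mul_of_nonneg_left hy2 (sq_nonneg _)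
  have h6 := mul_le_mul_of_nonneg_right h5 (by positivity : 0 ≤ (q ^ 2) ^ (T + 1))
  have h7 : (q⁻¹ ^ 2) ^ (T + 1) * (q ^ 2) ^ (T + 1) = 1 := by
    rw [← mul_pow, ← mul_pow, inv_mul_cancel₀ hq.ne']; simp
  rw [mul_assoc (‖_‖ ^ 2), h7, mul_one] at h6
  refine le_trans (le_of_eq ?_) h6
  have h8 : (q⁻¹ - q) ^ 2 * q ^ 2 = (1 - q ^ 2) ^ 2 := by field_simp
  have h9 : (q ^ 2) ^ (T + 1) = q ^ 2 * (q ^ T) ^ 2 := by ring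
  rw [h9]
  linear_combination (-(β * s) ^ 2 * (1 - q ^ 2) * (q ^ T) ^ 2) * h8

end Quadratic

/-! ### The strongly convex case -/

/-- There is a strongly convex problem with the given parameters on which every method needs at
least `B` queries. -/
def StronglyConvexHard (n : ℕ) (δmax δ ρ σ ζ L μ R ε αmin B : ℝ) : Prop :=
  ∃ (P : Problem n) (A : (Fin n → Vec P.d) → Vec P.d),
    (1 - δ) * n ≤ P.H.card ∧ P.InFunctionClass L ζ ∧ P.InOracleClass σ ∧
    IsRobustAggregator δmax ρ δ P.H A ∧
    P.IsStronglyConvex μ ∧ P.HasInitialDistance R ∧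
    ENNReal.ofReal (1 / 4 * (√ρ * √δ * ζ)) ≤ byzantineError P A αmin ∧
    ∀ M : MethodRun P A αmin,
      ENNReal.ofReal B ≤ M.queryComplexity (byzantineError P A αmin + ENNReal.ofReal ε)

lemma StronglyConvexHard.mono {n : ℕ} {δmax δ ρ σ ζ L μ R ε αmin B B' : ℝ}
    (h : StronglyConvexHard n δmax δ ρ σ ζ L μ R ε αmin B) (hB : B' ≤ B) :
    StronglyConvexHard n δmax δ ρ σ ζ L μ R ε αmin B' := by
  obtain ⟨P, A, h1, h2, h3, h4, h5, h6, h7, h8⟩ := h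
  exact ⟨P, A, h1, h2, h3, h4, h5, h6, h7, fun M => (ENNReal.ofReal_le_ofReal hB).trans (h8 M)⟩

/-- The design of the strongly convex instances. Here `x` is twice the slope of the floor
coordinate and `m` the strong convexity parameter. -/
def quadDesign (n T N : ℕ) (x ε ζ L m β q s v ω : ℝ) : Design n T N where
  a := (m + L) / 2
  b := x / 2
  θ := drop x ε
  -- Puts the last coordinate of the minimizer at a quarter period of the sine.
  lam := 2 / Real.pi * (s * q ^ (T + 1))
  e := m
  s := v
  ω := ω
  τ := tilt n ζ
  H := quad T m β q s
  ψ z := -(β * s) * z 0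
  gH := quadGrad T m β q s
  gψ _ := -(β * s) • firstVec T

section StronglyConvex

variable {n T N : ℕ} {δmax δ ρ σ ζ L μ R ε αmin m β q s v ω : ℝ}

/-- The conditions on the parameters of the strongly convex instances. -/
structure QuadParams (n T : ℕ) (δmax δ ρ ζ L μ R ε m β q s : ℝ) : Prop where
  two_le : 2 ≤ n
  δ_nonneg : 0 ≤ δ
  δ_le : δ ≤ δmax
  δmax_lt : δmax < 1 / 2
  ρ_nonneg : 0 ≤ ρ
  ζ_nonneg : 0 ≤ ζ
  μ_pos : 0 < μ
  le_m : μ ≤ m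
  R_pos : 0 < R
  ε_pos : 0 < ε
  q_pos : 0 < q
  q_lt : q < 1
  s_pos : 0 < s
  β_eq : β * (1 - q) ^ 2 = m * q
  β_le : 8 * β ≤ L - m
  slope_le : √ρ * √δ * ζ ≤ L * R / 3
  -- The locked chain has a gradient of norm at least `4 * ε`, as `slope_lock` requires.
  residual : (4 * ε) ^ 2 ≤ (β * s) ^ 2 * (1 - q ^ 2) ^ 3 * (q ^ T) ^ 2
  -- With `drop ≤ 4 * ε`, the coupling stays within the surplus `β * (1 - q)` of the quadratic
  -- chain.
  drop_le : 4 * Real.pi * ε ≤ β * (1 - q) * (s * q ^ (T + 1))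
  -- Keeps the chain part of the minimizer within `R / 2`; `slope_le` does the same for the floor
  -- part.
  distance : 4 * (s ^ 2 * q ^ 2) ≤ R ^ 2 * (1 - q ^ 2)

lemma QuadParams.β_pos (hQ : QuadParams n T δmax δ ρ ζ L μ R ε m β q s) : 0 < β := by
  have h1 : 0 < m * q := mul_pos (hQ.μ_pos.trans_le hQ.le_m) hQ.q_pos
  rw [← hQ.β_eq] at h1
  exact pos_of_mul_pos_left h1 (sq_nonneg _)

lemma QuadParams.slope_nonneg (hQ : QuadParams n T δmax δ ρ ζ L μ R ε m β q s) :
    0 ≤ √ρ * √δ * ζ := mul_nonneg (by positivity) hQ.ζ_nonneg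

lemma QuadParams.regular (hQ : QuadParams n T δmax δ ρ ζ L μ R ε m β q s) :
    (quadDesign n T N (√ρ * √δ * ζ) ε ζ L m β q s v ω).Regular where
  n_pos := lt_of_lt_of_le two_pos hQ.two_le
  lam_pos := by
    have := hQ.s_pos
    have := hQ.q_pos
    have := Real.pi_pos
    simp only [quadDesign]
    positivity
  hasGradientAt_H := hasGradientAt_quad
  continuous_gH := continuous_quadGrad
  hasGradientAt_ψ z := by
    refine hasGradientAt_of_forall ((Design.hasFDerivAt_coord 0 z).const_mul _) fun v => ?_
    rw [← inner_eq_sum]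
    simp [quadDesign, firstVec, EuclideanSpace.inner_single_left, real_inner_smul_left]
  continuous_gψ := continuous_const
  sum_τ := sum_tilt hQ.two_le ζ

/-- With `x = √ρ * √δ * ζ`, the slopes add up to at most `3 / 4 * x`, while the right-hand side is
`x ^ 2`. -/
lemma tilt_condition (hρ : 0 ≤ ρ) (hδ : 0 ≤ δ) (hζ : 0 ≤ ζ) (hn : 2 ≤ n) (hε : 0 ≤ ε) :
    (√ρ * √δ * ζ / 2 + drop (√ρ * √δ * ζ) ε) ^ 2
      ≤ ρ * δ * ((n : ℝ)⁻¹ * ∑ i, tilt n ζ i ^ 2) := by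
  have hx : 0 ≤ √ρ * √δ * ζ := by positivity
  have h1 := drop_le_left (√ρ * √δ * ζ) ε
  have h2 := drop_nonneg hx hε
  rw [sum_tilt_sq hn]
  have h3 : ρ * δ * ζ ^ 2 = (√ρ * √δ * ζ) ^ 2 := by
    rw [mul_pow, mul_pow, Real.sq_sqrt hρ, Real.sq_sqrt hδ]
  rw [h3]
  exact pow_le_pow_left₀ (by positivity) (by linarith) 2

lemma sin_div_eq_one {y : ℝ} (hy : y ≠ 0) : Real.sin (y / (2 / Real.pi * y)) = 1 := by
  have : y / (2 / Real.pi * y) = Real.pi / 2 := by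
    have := Real.pi_pos.ne'
    field_simp
  rw [this, Real.sin_pi_div_two]

lemma firstVec_mem {k : ℕ} : firstVec T ∈ initial T (k + 1) := by
  intro i hi
  have : i ≠ 0 := by
    intro h; subst h; simp at hi
  simp [firstVec, this]

lemma QuadParams.hard (hQ : QuadParams n T δmax δ ρ ζ L μ R ε m β q s) :
    (quadDesign n T N (√ρ * √δ * ζ) ε ζ L m β q s v ω).Hard (ρ * δ) ε where
  regular := hQ.regular
  two_le := hQ.two_le
  κ_nonneg := mul_nonneg hQ.ρ_nonneg hQ.δ_nonneg
  θ_nonneg := drop_nonneg hQ.slope_nonneg hQ.ε_pos.le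
  θ_le := by
    have := drop_le_left (√ρ * √δ * ζ) ε
    have := hQ.slope_nonneg
    simp only [quadDesign]
    linarith
  tilt := tilt_condition hQ.ρ_nonneg hQ.δ_nonneg hQ.ζ_nonneg hQ.two_le hQ.ε_pos.le
  ε_pos := hQ.ε_pos
  lock z hz := by
    refine (slope_lock hQ.slope_nonneg hQ.ε_pos.le).trans (add_le_add_right ?_ _)
    exact hQ.residual.trans (le_norm_sq_quadGrad hQ.q_pos hQ.q_lt hQ.β_eq hz)
  zeroChain :=
    { gH_mem := fun _ _ hz => quadGrad_mem hz
      gψ_mem := fun _ _ _ => Submodule.smul_mem _ _ firstVec_mem }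
  progress := exists_quadGrad_ne_zero hQ.β_pos.ne' hQ.s_pos.ne'
  target := by
    refine ⟨quadMin T q s, quadGrad_quadMin hQ.β_eq, ?_⟩
    exact sin_div_eq_one (mul_pos hQ.s_pos (pow_pos hQ.q_pos _)).ne'

lemma QuadParams.drop_div_le (hQ : QuadParams n T δmax δ ρ ζ L μ R ε m β q s) :
    2 * (drop (√ρ * √δ * ζ) ε / (2 / Real.pi * (s * q ^ (T + 1)))) ≤ β * (1 - q) := by
  have h1 : 0 < s * q ^ (T + 1) := mul_pos hQ.s_pos (pow_pos hQ.q_pos _)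
  have hpi := Real.pi_pos
  have h2 : 2 * (drop (√ρ * √δ * ζ) ε / (2 / Real.pi * (s * q ^ (T + 1))))
      = Real.pi * drop (√ρ * √δ * ζ) ε / (s * q ^ (T + 1)) := by field_simp
  rw [h2, div_le_iff₀ h1]
  refine le_trans ?_ hQ.drop_le
  have := mul_le_mul_of_nonneg_left (drop_le_right (√ρ * √δ * ζ) ε) hpi.le
  linarith

lemma QuadParams.stronglyConvexHard (hQ : QuadParams n T δmax δ ρ ζ L μ R ε m β q s) {B : ℝ}
    (hσ : ω ^ 2 * N * (β * s) ^ 2 + v ^ 2 ≤ σ ^ 2)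
    (hB : ∀ r (M : MethodRun (Design.problem (hQ.regular (N := N) (v := v) (ω := ω)) r)
      (erasingMean (ρ * δ)) αmin), ENNReal.ofReal B ≤ M.queryComplexity
        (byzantineError (Design.problem (hQ.regular (N := N) (v := v) (ω := ω)) r)
          (erasingMean (ρ * δ)) αmin + ENNReal.ofReal ε)) :
    StronglyConvexHard n δmax δ ρ σ ζ L μ R ε αmin B := by
  have hβ := hQ.β_pos
  have hm : 0 < m := hQ.μ_pos.trans_le hQ.le_m
  have hx := hQ.slope_nonneg
  have hreg := hQ.regular (N := N) (v := v) (ω := ω)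
  have hθ := drop_nonneg hx hQ.ε_pos.le
  have hdrop := hQ.drop_div_le
  have hq1 : β * (1 - q) ≤ β := by nlinarith [hQ.q_pos]
  have hle := hQ.β_le
  have hle_m := hQ.le_m
  have hsc : ∀ z z' : Vec (T + 1), quad T m β q s z + inner ℝ (quadGrad T m β q s z) (z' - z)
      + μ / 2 * ‖z' - z‖ ^ 2 + β * (1 - q) / 2 * (z' (Fin.last T) - z (Fin.last T)) ^ 2
        ≤ quad T m β q s z' := by
    intro z z'
    have h1 := quad_strongConvex (T := T) (μ := m) (q := q) (s := s) hβ.le z z'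
    have h2 : μ / 2 * ‖z' - z‖ ^ 2 ≤ m / 2 * ‖z' - z‖ ^ 2 := by gcongr
    linarith
  have ha : μ + β * (1 - q) ≤ (m + L) / 2 := by linarith
  have hpi := Real.pi_pos
  have hlast : 0 < s * q ^ (T + 1) := mul_pos hQ.s_pos (pow_pos hQ.q_pos _)
  obtain ⟨r, hr⟩ := hreg.exists_hasInitialDistance (μ := μ) (η := β * (1 - q)) (R := R)
    hQ.μ_pos.le (by simp only [quadDesign]; linarith) ha hQ.le_m hθ hdrop hsc
    (z := quadMin T q s) (quadGrad_quadMin hQ.β_eq) (sin_div_eq_one hlast.ne') hQ.hard.θ_le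
    hQ.R_pos.le (by
      have hq2 : 0 < 1 - q ^ 2 := by nlinarith [hQ.q_pos, hQ.q_lt]
      have h1 : ‖quadMin T q s‖ ^ 2 ≤ R ^ 2 / 4 := by
        have h2 := norm_sq_quadMin_le (T := T) (q := q) (s := s)
        have h3 := hQ.distance
        by_contra hc
        have := mul_lt_mul_of_pos_right (not_le.1 hc) hq2
        linarith
      have h4 : (√ρ * √δ * ζ / 2 + drop (√ρ * √δ * ζ) ε) / ((m + L) / 2) ≤ R / 2 := by
        rw [div_le_iff₀ (by linarith)]
        have h5 := drop_le_left (√ρ * √δ * ζ) ε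
        have h6 := hQ.slope_le
        have h7 : 0 ≤ m * R := mul_nonneg hm.le hQ.R_pos.le
        linarith
      have h8 : 0 ≤ (√ρ * √δ * ζ / 2 + drop (√ρ * √δ * ζ) ε) / ((m + L) / 2) :=
        div_nonneg (by linarith) (by linarith)
      have h9 := pow_le_pow_left₀ h8 h4 2
      simp only [quadDesign]
      nlinarith [sq_nonneg R])
  refine ⟨Design.problem hreg r, erasingMean (ρ * δ), ?_, ?_, ?_, ?_, ?_, hr, ?_, hB r⟩
  · change (1 - δ) * n ≤ ((Finset.univ : Finset (Fin n)).card : ℝ)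
    rw [Finset.card_univ, Fintype.card_fin]
    nlinarith [Nat.cast_nonneg (α := ℝ) n, hQ.δ_nonneg]
  · refine hreg.inFunctionClass (M := L - β) (B := quad T m β q s (quadMin T q s)) ?_ ?_ hm.le ?_
      hθ ?_ ?_ ?_ (sum_tilt_sq hQ.two_le ζ).le
    · simp only [quadDesign]; linarith
    · simp only [quadDesign]; linarith
    · simp only [quadDesign]; linarith
    · intro z z'
      refine (norm_quadGrad_sub_le hm.le hβ.le hQ.q_pos.le hQ.q_lt.le z z').trans ?_
      exact mul_le_mul_of_nonneg_right (by linarith) (norm_nonneg _)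
    · exact le_quad hm.le hβ.le hQ.q_lt.le hQ.β_eq
    · simp only [quadDesign]; linarith
  · refine hreg.inOracleClass fun z => ?_
    have : ‖-(β * s) • firstVec T‖ ^ 2 = (β * s) ^ 2 := by
      rw [norm_smul, mul_pow, Real.norm_eq_abs, sq_abs]; simp [firstVec]
    simp only [quadDesign, this]
    exact hσ
  · exact isRobustAggregator_erasingMean hQ.ρ_nonneg hQ.δ_nonneg hQ.δ_le hQ.δmax_lt
  · exact hreg.isStronglyConvex ha hQ.le_m hθ hdrop hsc
  · refine le_trans (ENNReal.ofReal_le_ofReal ?_) hQ.hard.le_byzantineError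
    have := drop_le_left (√ρ * √δ * ζ) ε
    simp only [quadDesign]
    linarith

lemma QuadParams.hard_chain (hQ : QuadParams n T δmax δ ρ ζ L μ R ε m β q s) (hα : 0 < αmin) :
    StronglyConvexHard n δmax δ ρ σ ζ L μ R ε αmin (T + 1) :=
  hQ.stronglyConvexHard (N := 0) (v := 0) (ω := 0) (by simp; positivity)
    fun _ M => hQ.hard.le_queryComplexity_chain hα M

/-- With a single chain coordinate the only gradient to be hidden is the one at zero, of size `β *
s`. -/
lemma QuadParams.hard_noise (hQ : QuadParams n T δmax δ ρ ζ L μ R ε m β q s) (hα : 0 < αmin)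
    (hT : T = 0) {K : ℕ} (hK : 0 < K) (hK' : 4 * K * (β * s) ^ 2 ≤ ρ * δ * σ ^ 2) :
    StronglyConvexHard n δmax δ ρ σ ζ L μ R ε αmin K := by
  subst hT
  refine (hQ.stronglyConvexHard (N := 2 * K) (v := σ) (ω := 0) (B := ((0 : ℕ) + 1) * K) (by simp)
    fun _ M => hQ.hard.le_queryComplexity_noise hα M rfl hK hK' (by omega) ?_).mono (by simp)
  intro i z hz
  have hz0 : z = 0 := by
    ext i'
    exact hz i' (by simp)
  have hi : i = 0 := Fin.ext (by omega)
  have := mul_pos hQ.β_pos hQ.s_pos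
  simp only [quadDesign, hz0, quadGrad_zero, hi]
  simp [firstVec, abs_of_pos hQ.β_pos, abs_of_pos hQ.s_pos]

/-- With a single chain coordinate, masking only matters at zero, where the constant `gψ` equals the
gradient of the chain. -/
lemma QuadParams.hard_switch (hQ : QuadParams n T δmax δ ρ ζ L μ R ε m β q s) (hα : 0 < αmin)
    (hT : T = 0) {N : ℕ} (hN : N * (β * s) ^ 2 ≤ σ ^ 2) :
    StronglyConvexHard n δmax δ ρ σ ζ L μ R ε αmin ((N + 1) / (2 * n)) := by
  subst hT
  refine (hQ.stronglyConvexHard (N := N) (v := 0) (ω := 1)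
    (B := ((0 : ℕ) + 1) * (N + 1) / (2 * n)) (by simpa using hN)
    fun _ M => hQ.hard.le_queryComplexity_switch hα M rfl ?_).mono (by simp)
  intro k z hz i hi
  rcases Nat.eq_zero_or_pos k with rfl | hk
  · have hz0 : z = 0 := by
      ext i'
      exact hz i' (by simp)
    simp [quadDesign, hz0, quadGrad_zero]
  · have := i.2
    omega

end StronglyConvex

/-! ### Choice of the parameters of the quadratic chain -/

section StronglyConvexParameters

variable {n : ℕ} {δmax δ ρ σ ζ L μ R ε αmin : ℝ}

/-- The scale `s` is dictated by the distance condition. The factor 26 is twice 13, where `13 > 4 *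
π` meets `drop_le`; the residual needs less. -/
lemma quadParams_of_long {T : ℕ} {m q : ℝ} (hn : 2 ≤ n) (hδ : 0 ≤ δ) (hδm : δ ≤ δmax)
    (hδmax : δmax < 1 / 2) (hρ : 0 ≤ ρ) (hζ : 0 ≤ ζ) (hμ : 0 < μ) (hR : 0 < R) (hε : 0 < ε)
    (hx : √ρ * √δ * ζ ≤ L * R / 3) (hm : μ ≤ m) (hq : 0 < q) (hq1 : q < 1)
    (hβ : 8 * (m * q / (1 - q) ^ 2) ≤ L - m) (hT : 26 * ε ≤ m * R * q ^ (T + 2)) :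
    QuadParams n T δmax δ ρ ζ L μ R ε m (m * q / (1 - q) ^ 2) q (R / 2 * √(1 - q ^ 2)) := by
  have hq0 : 0 < 1 - q := by linarith
  have hq2 : 0 < 1 - q ^ 2 := by nlinarith
  have hm0 : 0 < m := hμ.trans_le hm
  set β := m * q / (1 - q) ^ 2 with hβ'
  have hβeq : β * (1 - q) ^ 2 = m * q := by rw [hβ']; field_simp
  have hβ0 : 0 < β := by rw [hβ']; positivity
  have hsq : √(1 - q ^ 2) ^ 2 = 1 - q ^ 2 := Real.sq_sqrt hq2.le
  have hpow : 0 < q ^ T := by positivity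
  refine ⟨hn, hδ, hδm, hδmax, hρ, hζ, hμ, hm, hR, hε, hq, hq1, by positivity, hβeq, hβ, hx,
    ?_, ?_, ?_⟩
  · have h1 : (β * (R / 2 * √(1 - q ^ 2))) ^ 2 * (1 - q ^ 2) ^ 3 * (q ^ T) ^ 2
        = (m * q * (1 + q) ^ 2 * (R / 2) * q ^ T) ^ 2 := by
      rw [mul_pow, mul_pow (R / 2), hsq]
      have : m * q * (1 + q) ^ 2 = β * (1 - q ^ 2) ^ 2 := by
        rw [← hβeq]; ring
      rw [this]; ring
    rw [h1]
    refine pow_le_pow_left₀ (by positivity) ?_ 2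
    have h2 : m * R * q ^ (T + 2) ≤ m * R * q ^ (T + 1) :=
      mul_le_mul_of_nonneg_left (pow_le_pow_of_le_one hq.le hq1.le (by omega)) (by positivity)
    have h3 : m * q * (1 + q) ^ 2 * (R / 2) * q ^ T = m * R * q ^ (T + 1) * ((1 + q) ^ 2 / 2) := by
      ring
    have h4 : (1 : ℝ) / 2 ≤ (1 + q) ^ 2 / 2 := by nlinarith
    rw [h3]
    have h5 : 0 ≤ m * R * q ^ (T + 1) := by positivity
    nlinarith
  · have h1 : 1 - q ≤ √(1 - q ^ 2) := Real.le_sqrt_of_sq_le (by nlinarith)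
    have h2 : m * R * q ^ (T + 2) / 2 ≤ β * (1 - q) * (R / 2 * √(1 - q ^ 2) * q ^ (T + 1)) := by
      calc m * R * q ^ (T + 2) / 2 = β * (1 - q) * (R / 2 * (1 - q) * q ^ (T + 1)) := by
            linear_combination (-(R / 2 * q ^ (T + 1))) * hβeq
        _ ≤ _ := by gcongr
    have h3 := Real.pi_lt_d2
    nlinarith
  · rw [mul_pow, hsq]
    have : q ^ 2 ≤ 1 := by nlinarith
    have h2 : 0 ≤ R ^ 2 * (1 - q ^ 2) := by positivity
    nlinarith

/-- The distance parameter of the instances with a chain of length one. -/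
def shortScale (q : ℝ) : ℝ := 13 / ((1 - q) * q)

/-- Here `s` makes `β * s` a fixed multiple of `ε`: a small gradient at the start is easy to hide,
which yields the terms of order `σ ^ 2 / ε ^ 2`. The 13 in `shortScale` again stands for `13 > 4 *
π`. -/
lemma quadParams_of_short {m q : ℝ} (hn : 2 ≤ n) (hδ : 0 ≤ δ) (hδm : δ ≤ δmax)
    (hδmax : δmax < 1 / 2) (hρ : 0 ≤ ρ) (hζ : 0 ≤ ζ) (hμ : 0 < μ) (hR : 0 < R) (hε : 0 < ε)
    (hx : √ρ * √δ * ζ ≤ L * R / 3) (hm : μ ≤ m) (hq : 0 < q) (hq1 : q ≤ 1 / 2)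
    (hβ : 8 * (m * q / (1 - q) ^ 2) ≤ L - m) (hεR : 40 * ε ≤ q * (m * R)) :
    QuadParams n 0 δmax δ ρ ζ L μ R ε m (m * q / (1 - q) ^ 2) q
      (shortScale q * ε / (m * q / (1 - q) ^ 2)) := by
  have hq0 : 0 < 1 - q := by linarith
  have hq2 : 3 / 4 ≤ 1 - q ^ 2 := by nlinarith
  have hm0 : 0 < m := hμ.trans_le hm
  set β := m * q / (1 - q) ^ 2 with hβ'
  have hβeq : β * (1 - q) ^ 2 = m * q := by rw [hβ']; field_simp
  have hβ0 : 0 < β := by rw [hβ']; positivity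
  have hC0 : 0 < shortScale q := by unfold shortScale; positivity
  have hC : 52 ≤ shortScale q := by
    unfold shortScale
    rw [le_div_iff₀ (by positivity)]
    nlinarith [sq_nonneg (1 - 2 * q)]
  have hs : β * (shortScale q * ε / β) = shortScale q * ε := by field_simp
  refine ⟨hn, hδ, hδm, hδmax, hρ, hζ, hμ, hm, hR, hε, hq, by linarith, by positivity, hβeq, hβ, hx,
    ?_, ?_, ?_⟩
  · rw [hs, pow_zero, one_pow, mul_one]
    have h1 : (27 / 64 : ℝ) ≤ (1 - q ^ 2) ^ 3 := by
      calc (27 / 64 : ℝ) = (3 / 4) ^ 3 := by norm_num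
        _ ≤ _ := pow_le_pow_left₀ (by norm_num) hq2 3
    have h2 : (52 * ε) ^ 2 ≤ (shortScale q * ε) ^ 2 :=
      pow_le_pow_left₀ (by positivity) (by gcongr) 2
    nlinarith [sq_nonneg ε]
  · have h1 : β * (1 - q) * (shortScale q * ε / β * q ^ (0 + 1)) = 13 * ε := by
      unfold shortScale; field_simp; ring
    rw [h1]
    have := Real.pi_lt_d2
    nlinarith
  · have h1 : shortScale q * ε / β * q = 13 * ε * (1 - q) / (m * q) := by
      rw [hβ']; unfold shortScale; field_simp
    have h2 : shortScale q * ε / β * q ≤ 13 / 40 * R := by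
      rw [h1, div_le_iff₀ (by positivity)]
      nlinarith
    have h3 : 0 ≤ shortScale q * ε / β * q := by positivity
    have h4 := pow_le_pow_left₀ h3 h2 2
    rw [mul_pow] at h4
    nlinarith [sq_nonneg R]

lemma exp_two_le_eight : Real.exp 2 ≤ 8 := by
  have h1 := Real.exp_one_lt_d9
  have h2 : Real.exp 2 = Real.exp 1 ^ 2 := by rw [← Real.exp_nat_mul]; norm_num
  rw [h2]
  nlinarith [Real.exp_pos 1]

/-- Combines `1 + 2 * γ ≤ exp (2 * γ)` with `(1 - γ) * (1 + 2 * γ) ≥ 1`. -/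
lemma exp_neg_two_mul_le {γ : ℝ} (h0 : 0 ≤ γ) (h1 : γ ≤ 1 / 2) :
    Real.exp (-(2 * γ)) ≤ 1 - γ := by
  rw [Real.exp_neg, inv_le_comm₀ (Real.exp_pos _) (by linarith)]
  have h2 := Real.add_one_le_exp (2 * γ)
  refine le_trans ?_ h2
  rw [inv_le_iff_one_le_mul₀ (by linarith)]
  nlinarith

/-- If the condition number is large, then a long chain with ratio close to one is hard. -/
lemma hard_of_large_condition (hn : 2 ≤ n) (hδ : 0 ≤ δ) (hδm : δ ≤ δmax)
    (hδmax : δmax < 1 / 2) (hρ : 0 ≤ ρ) (hζ : 0 ≤ ζ) (hμ : 0 < μ) (hR : 0 < R) (hε : 0 < ε)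
    (hα : 0 < αmin) (hx : √ρ * √δ * ζ ≤ L * R / 3) (hL : 13312 * μ ≤ L)
    (hlog : 0 ≤ Real.log (μ * R / ε)) :
    StronglyConvexHard n δmax δ ρ σ ζ L μ R ε αmin
      (√(L / μ) * Real.log (μ * R / ε) / 116) := by
  have hL0 : 0 < L := lt_of_lt_of_le (by positivity) hL
  set Λ := Real.log (μ * R / ε) with hΛ
  -- The ratio is `q = 1 - γ` with `γ` of order `κ ^ (-1 / 2)`. Since `3328 = 16 * 208`, taking `m =
  -- 208 * μ` gives `β = L * q / 16`; and `13312 = 4 * 3328` gives `γ ≤ 1 / 2`.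
  set γ := √(3328 * (μ / L)) with hγ
  have hγ2 : γ ^ 2 = 3328 * (μ / L) := Real.sq_sqrt (by positivity)
  have hγ0 : 0 < γ := Real.sqrt_pos.2 (by positivity)
  have hγ1 : γ ≤ 1 / 2 := by
    refine abs_le_of_sq_le_sq' ?_ (by norm_num) |>.2
    rw [hγ2]
    have : μ / L ≤ 1 / 13312 := by rw [div_le_div_iff₀ hL0 (by norm_num)]; linarith
    linarith
  -- For this length `q ^ (T + 2) ≥ exp (-(Λ + 2)) ≥ ε / (8 * μ * R)`, and `m = 8 * 26 * μ`
  -- compensates for the constants.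
  set T := ⌊Λ / (2 * γ)⌋₊ with hT
  have hT1 : (T : ℝ) ≤ Λ / (2 * γ) := Nat.floor_le (by positivity)
  have hT2 : Λ / (2 * γ) < T + 1 := Nat.lt_floor_add_one _
  have hpow : ε / (8 * (μ * R)) ≤ (1 - γ) ^ (T + 2) := by
    have h1 := pow_le_pow_left₀ (Real.exp_pos _).le (exp_neg_two_mul_le hγ0.le hγ1) (T + 2)
    refine le_trans ?_ h1
    rw [← Real.exp_nat_mul]
    have h2 : -(Λ + 2) ≤ ((T + 2 : ℕ) : ℝ) * -(2 * γ) := by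
      rw [le_div_iff₀ (by positivity)] at hT1
      push_cast
      linarith
    refine le_trans ?_ (Real.exp_le_exp.2 h2)
    rw [neg_add, Real.exp_add, ← Real.log_inv, Real.exp_log (by positivity), Real.exp_neg 2,
      inv_div]
    have h3 : (8 : ℝ)⁻¹ ≤ (Real.exp 2)⁻¹ := inv_anti₀ (Real.exp_pos _) exp_two_le_eight
    calc ε / (8 * (μ * R)) = ε / (μ * R) * 8⁻¹ := by field_simp
      _ ≤ _ := by gcongr
  have hparams := quadParams_of_long (L := L) (T := T) (m := 208 * μ) (q := 1 - γ) hn hδ hδm hδmax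
    hρ hζ hμ hR hε hx (by linarith) (by linarith) (by linarith) (by
      rw [sub_sub_cancel, hγ2]
      have h1 : 208 * μ * (1 - γ) / (3328 * (μ / L)) = L * (1 - γ) / 16 := by
        field_simp; ring
      rw [h1]
      nlinarith) (by
      rw [div_le_iff₀ (by positivity)] at hpow
      linarith)
  refine (hparams.hard_chain hα).mono ?_
  refine le_trans ?_ hT2.le
  rw [div_le_div_iff₀ (by norm_num) (by positivity)]
  have h1 : √(L / μ) * γ = √3328 := by
    rw [hγ, ← Real.sqrt_mul (by positivity)]
    congr 1
    field_simp
  have h2 : √3328 ≤ 58 := Real.sqrt_le_iff.2 ⟨by norm_num, by norm_num⟩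
  calc √(L / μ) * Λ * (2 * γ) = 2 * (√(L / μ) * γ) * Λ := by ring
    _ ≤ 2 * 58 * Λ := by rw [h1]; gcongr
    _ = Λ * 116 := by ring

end StronglyConvexParameters

/-! ### Assembly of the strongly convex bounds -/

section StronglyConvexCase

variable {n : ℕ} {δmax δ ρ σ ζ L μ R ε αmin : ℝ}

lemma half_le_floor {x : ℝ} (hx : 1 ≤ x) : x / 2 ≤ ⌊x⌋₊ := by
  have h1 := Nat.lt_floor_add_one x
  have h2 : (1 : ℝ) ≤ ⌊x⌋₊ := by exact_mod_cast (Nat.one_le_floor_iff x).2 hx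
  linarith

lemma QuadParams.hard_of_noise {m β q s C : ℝ}
    (hQ : QuadParams n 0 δmax δ ρ ζ L μ R ε m β q s) (hα : 0 < αmin) (hC : 0 < C)
    (hs : β * s = C * ε) :
    StronglyConvexHard n δmax δ ρ σ ζ L μ R ε αmin (ρ * δ * σ ^ 2 / ε ^ 2 / (8 * C ^ 2)) := by
  have hε := hQ.ε_pos
  set x := ρ * δ * σ ^ 2 / ε ^ 2 / (4 * C ^ 2) with hx
  have hB : ρ * δ * σ ^ 2 / ε ^ 2 / (8 * C ^ 2) = x / 2 := by rw [hx]; field_simp; ring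
  have hx0 : 0 ≤ x := by
    have := hQ.ρ_nonneg
    have := hQ.δ_nonneg
    positivity
  rw [hB]
  -- If the noise hides less than one sample, the trivial bound of one query is enough.
  rcases lt_or_ge x 1 with h | h
  · exact (hQ.hard_chain hα).mono (by push_cast; linarith)
  · refine (hQ.hard_noise hα rfl (K := ⌊x⌋₊) (Nat.floor_pos.2 h) ?_).mono (half_le_floor h)
    have h1 := Nat.floor_le hx0
    rw [hs]
    calc 4 * (⌊x⌋₊ : ℝ) * (C * ε) ^ 2 ≤ 4 * x * (C * ε) ^ 2 := by gcongr
      _ = ρ * δ * σ ^ 2 := by rw [hx]; field_simp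

/-- The instances have `n` honest nodes, the claim counts only `(1 - δ) * n`; for `δ < 1 / 2` these
are comparable. -/
lemma inv_card_le {t : ℝ} (ht : 0 ≤ t) (hδ : δ < 1 / 2) (hn : 2 ≤ n) :
    t / ((1 - δ) * n) ≤ 4 * (t / (2 * n)) := by
  have hn' : (0 : ℝ) < n := by positivity
  have h1 : t / ((1 - δ) * n) = t / n / (1 - δ) := by rw [div_div, mul_comm]
  have h2 : 4 * (t / (2 * n)) = 2 * (t / n) := by field_simp; ring
  rw [h1, h2, div_le_iff₀ (by linarith)]
  have h3 : 0 ≤ t / n := by positivity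
  nlinarith

lemma QuadParams.hard_of_switch {m β q s C : ℝ}
    (hQ : QuadParams n 0 δmax δ ρ ζ L μ R ε m β q s) (hα : 0 < αmin) (hC : 0 < C)
    (hs : β * s = C * ε) :
    StronglyConvexHard n δmax δ ρ σ ζ L μ R ε αmin
      (σ ^ 2 / ((1 - δ) * n * ε ^ 2) / (8 * C ^ 2)) := by
  have hε := hQ.ε_pos
  set x := σ ^ 2 / (C * ε) ^ 2 with hx
  have hx0 : 0 ≤ x := by positivity
  refine (hQ.hard_switch hα rfl (N := ⌊x⌋₊) ?_).mono ?_
  · rw [hs]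
    have h1 := Nat.floor_le hx0
    calc (⌊x⌋₊ : ℝ) * (C * ε) ^ 2 ≤ x * (C * ε) ^ 2 := by gcongr
      _ = σ ^ 2 := by rw [hx]; field_simp
  · have h1 : x ≤ (⌊x⌋₊ : ℝ) + 1 := (Nat.lt_floor_add_one x).le
    have h2 : σ ^ 2 / ((1 - δ) * n * ε ^ 2) / (8 * C ^ 2) = x / ((1 - δ) * n) / 8 := by
      have : 1 - δ ≠ 0 := by linarith [hQ.δ_le, hQ.δmax_lt]
      rw [hx]; field_simp
    have h3 := inv_card_le (n := n) hx0 (hQ.δ_le.trans_lt hQ.δmax_lt) hQ.two_le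
    have h4 : x / (2 * n) ≤ ((⌊x⌋₊ : ℝ) + 1) / (2 * n) := by gcongr
    have h5 : 0 ≤ x / (2 * n) := by positivity
    rw [h2]
    linarith

/-- If the condition number is bounded, then a long chain with a fixed ratio is hard. -/
lemma hard_of_small_condition {κ₀ q : ℝ} (hn : 2 ≤ n) (hδ : 0 ≤ δ) (hδm : δ ≤ δmax)
    (hδmax : δmax < 1 / 2) (hρ : 0 ≤ ρ) (hζ : 0 ≤ ζ) (hμ : 0 < μ) (hR : 0 < R) (hε : 0 < ε)
    (hα : 0 < αmin) (hx : √ρ * √δ * ζ ≤ L * R / 3) (hκ₀ : 1 < κ₀) (hL : L ≤ 13312 * μ)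
    (hm : μ ≤ L / κ₀) (hq : 0 < q) (hq1 : q ≤ 1 / 2)
    (hβ : 8 * (L / κ₀ * q / (1 - q) ^ 2) ≤ L - L / κ₀)
    (hεR : ε ≤ Real.exp (-(2 * Real.log (26 * κ₀ / q ^ 2))) * (L * R))
    (hlog : 0 ≤ Real.log (μ * R / ε)) :
    StronglyConvexHard n δmax δ ρ σ ζ L μ R ε αmin
      (√(L / μ) * Real.log (μ * R / ε) / (232 * Real.log q⁻¹)) := by
  have hμL : μ ≤ L := hm.trans (div_le_self (by
    by_contra h
    have : L / κ₀ < 0 := div_neg_of_neg_of_pos (not_le.1 h) (by linarith)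
    linarith) hκ₀.le)
  have hL0 : 0 < L := hμ.trans_le hμL
  -- The number of logarithmic units lost to constants. The bound on `ε` gives `2 * C₀ ≤ Λ`, so at
  -- least half of `Λ` is left for the chain.
  set C₀ := Real.log (26 * κ₀ / q ^ 2) with hC₀
  set l := Real.log q⁻¹ with hl
  have hl0 : 0 < l := Real.log_pos ((one_lt_inv₀ hq).2 (by linarith))
  have hC₀0 : 0 ≤ C₀ := Real.log_nonneg (by
    rw [le_div_iff₀ (by positivity)]
    nlinarith)
  have hLRε : 0 < L * R / ε := by positivity
  set Λ := Real.log (L * R / ε) with hΛ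
  have hΛ2 : 2 * C₀ ≤ Λ := by
    rw [hΛ, Real.le_log_iff_exp_le hLRε, le_div_iff₀ hε]
    have h1 : Real.exp (2 * C₀) * Real.exp (-(2 * C₀)) = 1 := by
      rw [← Real.exp_add]; simp
    calc Real.exp (2 * C₀) * ε ≤ Real.exp (2 * C₀) * (Real.exp (-(2 * C₀)) * (L * R)) := by gcongr
      _ = L * R := by rw [← mul_assoc, h1, one_mul]
  set T := ⌊(Λ - C₀) / l⌋₊ with hT
  have hT1 : (T : ℝ) ≤ (Λ - C₀) / l := Nat.floor_le (div_nonneg (by linarith) hl0.le)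
  have hT2 : (Λ - C₀) / l < T + 1 := Nat.lt_floor_add_one _
  have hpow : ε / (L * R) * (26 * κ₀ / q ^ 2) ≤ q ^ T := by
    have h1 : q ^ T = Real.exp (-(T * l)) := by
      rw [hl, Real.log_inv, mul_neg, neg_neg, Real.exp_nat_mul, Real.exp_log hq]
    rw [le_div_iff₀ hl0] at hT1
    rw [h1]
    refine le_trans (le_of_eq ?_) (Real.exp_le_exp.2 (neg_le_neg hT1))
    rw [neg_sub, sub_eq_add_neg, Real.exp_add, hC₀, Real.exp_log (by positivity), hΛ,
      ← Real.log_inv, Real.exp_log (by positivity), inv_div, mul_comm]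
  have hparams := quadParams_of_long (L := L) (T := T) (m := L / κ₀) (q := q) hn hδ hδm hδmax
    hρ hζ hμ hR hε hx hm hq (by linarith) hβ (by
      calc 26 * ε = L / κ₀ * R * q ^ 2 * (ε / (L * R) * (26 * κ₀ / q ^ 2)) := by field_simp
        _ ≤ L / κ₀ * R * q ^ 2 * q ^ T := by gcongr
        _ = _ := by ring)
  refine (hparams.hard_chain hα).mono ?_
  refine le_trans ?_ hT2.le
  rw [div_le_div_iff₀ (by positivity) hl0]
  have h1 : √(L / μ) ≤ 116 := by
    refine Real.sqrt_le_iff.2 ⟨by norm_num, ?_⟩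
    rw [div_le_iff₀ hμ]; linarith
  have h2 : Real.log (μ * R / ε) ≤ Λ := Real.log_le_log (by positivity) (by gcongr)
  have h3 : √(L / μ) * Real.log (μ * R / ε) ≤ 116 * Λ := by gcongr
  nlinarith

lemma max_cases_three (a b c : ℝ) :
    (b ≤ a ∧ c ≤ a) ∨ (a ≤ b ∧ c ≤ b) ∨ (a ≤ c ∧ b ≤ c) := by
  grind

lemma stronglyConvex_case {κ₀ : ℝ} (hκ₀ : 1 < κ₀) : ∃ c : ℝ, 0 < c ∧ c ≤ 1 / 4 ∧
    ∀ (n : ℕ) (δmax δ ρ σ ζ L μ R ε αmin : ℝ),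
      2 ≤ n → 0 ≤ δ → δ ≤ δmax → δmax < 1 / 2 → 0 ≤ ρ → 0 ≤ ζ →
      0 < μ → κ₀ * μ ≤ L → 0 < ε → 0 < αmin →
      ε ≤ c * (L * R) → √ρ * √δ * ζ ≤ c * (L * R) →
      StronglyConvexHard n δmax δ ρ σ ζ L μ R ε αmin
        (c * (ρ * δ * σ ^ 2 / ε ^ 2 + σ ^ 2 / ((1 - δ) * n * ε ^ 2)
          + √(L / μ) * Real.log (μ * R / ε))) := by
  -- For `m = L / κ₀`, the bounds `(1 - q) ^ 2 ≥ 1 / 4` and `q ≤ (κ₀ - 1) / 32` give `8 * β ≤ L - L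
  -- / κ₀`.
  set q : ℝ := min (1 / 2) ((κ₀ - 1) / 32) with hq'
  have hq : 0 < q := lt_min (by norm_num) (by linarith)
  have hq1 : q ≤ 1 / 2 := min_le_left _ _
  have hq2 : q ≤ (κ₀ - 1) / 32 := min_le_right _ _
  have hl0 : 0 < Real.log q⁻¹ := Real.log_pos ((one_lt_inv₀ hq).2 (by linarith))
  have hC0 : 0 < shortScale q := by
    have : 0 < 1 - q := by linarith
    unfold shortScale; positivity
  obtain ⟨c, hc0, hc1, hc2, hc3, hc4, hc5, hc6⟩ : ∃ c : ℝ, 0 < c ∧ c ≤ 1 / 4 ∧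
      c ≤ q / (40 * κ₀) ∧ c ≤ 1 / (24 * shortScale q ^ 2) ∧ c ≤ 1 / 348 ∧
      c ≤ 1 / (696 * Real.log q⁻¹) ∧ c ≤ Real.exp (-(2 * Real.log (26 * κ₀ / q ^ 2))) := by
    refine ⟨min (1 / 4) (min (q / (40 * κ₀)) (min (1 / (24 * shortScale q ^ 2)) (min (1 / 348)
      (min (1 / (696 * Real.log q⁻¹)) (Real.exp (-(2 * Real.log (26 * κ₀ / q ^ 2)))))))),
      ?_, ?_, ?_, ?_, ?_, ?_, ?_⟩
    · have : 0 < κ₀ := by linarith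
      positivity
    all_goals simp
  refine ⟨c, hc0, hc1, ?_⟩
  intro n δmax δ ρ σ ζ L μ R ε αmin hn hδ hδm hδmax hρ hζ hμ hL hε hα hεR hx
  have hκ₀0 : 0 < κ₀ := by linarith
  have hm : μ ≤ L / κ₀ := by rw [le_div_iff₀ hκ₀0]; linarith
  have hL0 : 0 < L := lt_of_lt_of_le (by positivity) hL
  have hLR : 0 < L * R := pos_of_mul_pos_right (hε.trans_le hεR) hc0.le
  have hR : 0 < R := pos_of_mul_pos_right hLR hL0.le
  have hx3 : √ρ * √δ * ζ ≤ L * R / 3 := by nlinarith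
  have hβ : 8 * (L / κ₀ * q / (1 - q) ^ 2) ≤ L - L / κ₀ := by
    have h1 : (1 : ℝ) / 4 ≤ (1 - q) ^ 2 := by nlinarith
    have h2 : L / κ₀ * q / (1 - q) ^ 2 ≤ L / κ₀ * q / (1 / 4) := by gcongr
    have h3 : L / κ₀ * q ≤ L / κ₀ * ((κ₀ - 1) / 32) := by gcongr
    have h4 : L / κ₀ * ((κ₀ - 1) / 32) = (L - L / κ₀) / 32 := by field_simp
    linarith
  have hshort := quadParams_of_short (n := n) (δmax := δmax) (L := L) hn hδ hδm hδmax hρ hζ hμ hR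
    hε hx3 hm hq hq1 hβ (by
      have h1 : c * (L * R) ≤ q / (40 * κ₀) * (L * R) := by gcongr
      have h2 : q / (40 * κ₀) * (L * R) = q * (L / κ₀ * R) / 40 := by field_simp
      linarith)
  have hs : L / κ₀ * q / (1 - q) ^ 2 * (shortScale q * ε / (L / κ₀ * q / (1 - q) ^ 2))
      = shortScale q * ε := by
    have : 0 < 1 - q := by linarith
    field_simp
  set t₁ := ρ * δ * σ ^ 2 / ε ^ 2 with ht₁
  set t₂ := σ ^ 2 / ((1 - δ) * n * ε ^ 2) with ht₂
  set t₃ := √(L / μ) * Real.log (μ * R / ε) with ht₃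
  have ht₁0 : 0 ≤ t₁ := by positivity
  have ht₂0 : 0 ≤ t₂ := by
    have : 0 < 1 - δ := by linarith
    positivity
  have hc3' : c * (24 * shortScale q ^ 2) ≤ 1 := by rwa [← le_div_iff₀ (by positivity)]
  have hnoise : ∀ t, 0 ≤ t → c * (3 * t) ≤ t / (8 * shortScale q ^ 2) := by
    intro t ht
    rw [le_div_iff₀ (by positivity)]
    calc c * (3 * t) * (8 * shortScale q ^ 2) = c * (24 * shortScale q ^ 2) * t := by ring
      _ ≤ 1 * t := by gcongr
      _ = t := one_mul t
  have hle : ∀ t, t₁ + t₂ + t₃ ≤ t → c * (t₁ + t₂ + t₃) ≤ c * t := fun t ht =>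
    mul_le_mul_of_nonneg_left ht hc0.le
  -- The largest term selects the instance. The logarithm in `t₃` may be negative, but not when `t₃`
  -- is the largest.
  rcases max_cases_three t₁ t₂ t₃ with h1 | h2 | h3
  · exact (hshort.hard_of_noise hα hC0 hs).mono
      ((hle (3 * t₁) (by linarith)).trans (hnoise t₁ ht₁0))
  · exact (hshort.hard_of_switch hα hC0 hs).mono
      ((hle (3 * t₂) (by linarith)).trans (hnoise t₂ ht₂0))
  have ht₃0 : 0 ≤ t₃ := ht₁0.trans h3.1
  have hlog : 0 ≤ Real.log (μ * R / ε) :=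
    nonneg_of_mul_nonneg_right ht₃0 (Real.sqrt_pos.2 (by positivity))
  rcases le_total (13312 * μ) L with hbig | hsmall
  · refine (hard_of_large_condition hn hδ hδm hδmax hρ hζ hμ hR hε hα hx3 hbig hlog).mono ?_
    refine (hle (3 * t₃) (by linarith)).trans ?_
    rw [← ht₃]
    calc c * (3 * t₃) ≤ 1 / 348 * (3 * t₃) := by gcongr
      _ = t₃ / 116 := by ring
  · refine (hard_of_small_condition hn hδ hδm hδmax hρ hζ hμ hR hε hα hx3 hκ₀ hsmall hm hq hq1 hβ
      (hεR.trans (by gcongr)) hlog).mono ?_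
    refine (hle (3 * t₃) (by linarith)).trans ?_
    rw [← ht₃, le_div_iff₀ (by positivity)]
    have : c * (696 * Real.log q⁻¹) ≤ 1 := by rwa [← le_div_iff₀ (by positivity)]
    calc c * (3 * t₃) * (232 * Real.log q⁻¹) = c * (696 * Real.log q⁻¹) * t₃ := by ring
      _ ≤ 1 * t₃ := by gcongr
      _ = t₃ := one_mul _

end StronglyConvexCase

/-! ### A smooth step -/

section SmoothStep

lemma hasDerivAt_of_sq_bound {f : ℝ → ℝ} {f' C x : ℝ}
    (h : ∀ y, |f y - f x - (y - x) * f'| ≤ C * (y - x) ^ 2) : HasDerivAt f f' x := by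
  rw [hasDerivAt_iff_isLittleO]
  refine Asymptotics.IsBigO.trans_isLittleO (g := fun y => (y - x) ^ 2)
    (Asymptotics.IsBigO.of_bound C (Eventually.of_forall fun y => ?_)) ?_
  · simpa [Real.norm_eq_abs] using h y
  · have h1 : Tendsto (fun y => y - x) (𝓝 x) (𝓝 0) := by
      have : Tendsto (fun y => y - x) (𝓝 x) (𝓝 (x - x)) := tendsto_id.sub_const x
      rwa [sub_self] at this
    have h2 : (fun y : ℝ => y ^ 2) =o[𝓝 0] fun y : ℝ => y :=
      Asymptotics.isLittleO_pow_id one_lt_two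
    exact h2.comp_tendsto h1

lemma hasDerivAt_max_sq (x : ℝ) :
    HasDerivAt (fun y : ℝ => max y 0 ^ 2) (2 * max x 0) x := by
  refine hasDerivAt_of_sq_bound (C := 1) fun y => abs_le.2 ⟨?_, ?_⟩ <;>
  rcases max_cases y 0 with ⟨h, h'⟩ | ⟨h, h'⟩ <;>
  rcases max_cases x 0 with ⟨k, k'⟩ | ⟨k, k'⟩ <;> rw [h, k] <;> nlinarith

/-- A continuously differentiable function that rises from zero to one on the unit interval. -/
def step (x : ℝ) : ℝ := 2 * max x 0 ^ 2 - 4 * max (x - 1 / 2) 0 ^ 2 + 2 * max (x - 1) 0 ^ 2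

/-- The derivative of `step`. -/
def stepDeriv (x : ℝ) : ℝ := 4 * max x 0 - 8 * max (x - 1 / 2) 0 + 4 * max (x - 1) 0

lemma hasDerivAt_step (x : ℝ) : HasDerivAt step (stepDeriv x) x := by
  have h := (((hasDerivAt_max_sq x).const_mul 2).sub
    (((hasDerivAt_max_sq (x - 1 / 2)).comp x ((hasDerivAt_id x).sub_const (1 / 2))).const_mul
      4)).add (((hasDerivAt_max_sq (x - 1)).comp x ((hasDerivAt_id x).sub_const 1)).const_mul 2)
  refine h.congr_deriv ?_
  unfold stepDeriv
  ring

lemma continuous_step : Continuous step := by unfold step; fun_prop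

lemma continuous_stepDeriv : Continuous stepDeriv := by unfold stepDeriv; fun_prop

/-- The derivative is a hat on the unit interval, and its sign, height and Lipschitz constant can be
read off. -/
lemma stepDeriv_eq (x : ℝ) : stepDeriv x = 4 * max (min x (1 - x)) 0 := by
  unfold stepDeriv
  rcases max_cases x 0 with ⟨h, h'⟩ | ⟨h, h'⟩ <;>
  rcases max_cases (x - 1 / 2) 0 with ⟨k, k'⟩ | ⟨k, k'⟩ <;>
  rcases max_cases (x - 1) 0 with ⟨l, l'⟩ | ⟨l, l'⟩ <;>
  rcases min_cases x (1 - x) with ⟨m, m'⟩ | ⟨m, m'⟩ <;>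
  rcases max_cases (min x (1 - x)) 0 with ⟨n, n'⟩ | ⟨n, n'⟩ <;>
  rw [h, k, l, n] <;> linarith

lemma stepDeriv_nonneg (x : ℝ) : 0 ≤ stepDeriv x := by
  rw [stepDeriv_eq]; positivity

lemma stepDeriv_le (x : ℝ) : stepDeriv x ≤ 2 := by
  rw [stepDeriv_eq]
  have : max (min x (1 - x)) 0 ≤ 1 / 2 := by
    refine max_le ?_ (by norm_num)
    rcases min_cases x (1 - x) with ⟨m, m'⟩ | ⟨m, m'⟩ <;> linarith
  linarith

lemma abs_stepDeriv_sub_le (x y : ℝ) : |stepDeriv x - stepDeriv y| ≤ 4 * |x - y| := by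
  rw [stepDeriv_eq, stepDeriv_eq, ← mul_sub, abs_mul, abs_of_pos (by norm_num : (0 : ℝ) < 4)]
  refine mul_le_mul_of_nonneg_left ((abs_max_sub_max_le_abs _ _ _).trans ?_) (by norm_num)
  refine (abs_min_sub_min_le_max _ _ _ _).trans (max_le le_rfl ?_)
  rw [sub_sub_sub_cancel_left, abs_sub_comm]

lemma abs_step_sub_le (x y : ℝ) : |step x - step y| ≤ 2 * |x - y| :=
  Convex.norm_image_sub_le_of_norm_hasDerivWithin_le (s := Set.univ) (f := step)
    (fun x _ => (hasDerivAt_step x).hasDerivWithinAt)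
    (fun x _ => by
      rw [Real.norm_of_nonneg (stepDeriv_nonneg x)]; exact stepDeriv_le x)
    convex_univ (Set.mem_univ y) (Set.mem_univ x)

lemma step_of_nonpos {x : ℝ} (h : x ≤ 0) : step x = 0 := by
  unfold step
  rw [max_eq_right h, max_eq_right (by linarith), max_eq_right (by linarith)]
  norm_num

lemma step_of_one_le {x : ℝ} (h : 1 ≤ x) : step x = 1 := by
  unfold step
  rw [max_eq_left (by linarith), max_eq_left (by linarith), max_eq_left (by linarith)]
  ring

lemma stepDeriv_of_nonpos {x : ℝ} (h : x ≤ 0) : stepDeriv x = 0 := by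
  rw [stepDeriv_eq, max_eq_right ((min_le_left _ _).trans h), mul_zero]

lemma stepDeriv_of_one_le {x : ℝ} (h : 1 ≤ x) : stepDeriv x = 0 := by
  rw [stepDeriv_eq, max_eq_right ((min_le_right _ _).trans (by linarith)), mul_zero]

lemma monotone_step : Monotone step :=
  monotone_of_deriv_nonneg (fun x => (hasDerivAt_step x).differentiableAt)
    fun x => by rw [(hasDerivAt_step x).deriv]; exact stepDeriv_nonneg x

lemma step_nonneg (x : ℝ) : 0 ≤ step x := by
  rcases le_total x 0 with h | h
  · exact (step_of_nonpos h).ge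
  · exact (step_of_nonpos le_rfl).ge.trans (monotone_step h)

lemma step_le_one (x : ℝ) : step x ≤ 1 := by
  rcases le_total 1 x with h | h
  · exact (step_of_one_le h).le
  · exact (monotone_step h).trans (step_of_one_le le_rfl).le

/-- The step that switches a coordinate on once its predecessor has passed one half. -/
def gate (x : ℝ) : ℝ := step (2 * x - 1)

/-- The derivative of `gate`. -/
def gateDeriv (x : ℝ) : ℝ := 2 * stepDeriv (2 * x - 1)

/-- The gain of a coordinate. -/
def gain (x : ℝ) : ℝ := step ((x + 2) / 4)

/-- The derivative of `gain`. -/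
def gainDeriv (x : ℝ) : ℝ := stepDeriv ((x + 2) / 4) / 4

/-- A penalty for negative coordinates. -/
def penalty (x : ℝ) : ℝ := max (-x) 0 ^ 2 / 16

/-- The derivative of `penalty`. -/
def penaltyDeriv (x : ℝ) : ℝ := -(max (-x) 0 / 8)

lemma hasDerivAt_gate (x : ℝ) : HasDerivAt gate (gateDeriv x) x := by
  have h := (hasDerivAt_step (2 * x - 1)).comp x
    (((hasDerivAt_id x).const_mul 2).sub_const 1)
  exact h.congr_deriv (by unfold gateDeriv; ring)

lemma hasDerivAt_gain (x : ℝ) : HasDerivAt gain (gainDeriv x) x := by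
  have h := (hasDerivAt_step ((x + 2) / 4)).comp x
    (((hasDerivAt_id x).add_const 2).div_const 4)
  exact h.congr_deriv (by unfold gainDeriv; ring)

lemma hasDerivAt_penalty (x : ℝ) : HasDerivAt penalty (penaltyDeriv x) x := by
  have h := ((hasDerivAt_max_sq (-x)).comp x (hasDerivAt_id x).neg).div_const 16
  exact h.congr_deriv (by unfold penaltyDeriv; ring)

lemma continuous_gate : Continuous gate := by
  have := continuous_step
  unfold gate; fun_prop

lemma continuous_gateDeriv : Continuous gateDeriv := by
  have := continuous_stepDeriv
  unfold gateDeriv; fun_prop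

lemma continuous_gain : Continuous gain := by
  have := continuous_step
  unfold gain; fun_prop

lemma continuous_gainDeriv : Continuous gainDeriv := by
  have := continuous_stepDeriv
  unfold gainDeriv; fun_prop

lemma continuous_penaltyDeriv : Continuous penaltyDeriv := by
  unfold penaltyDeriv; fun_prop

lemma gate_nonneg (x : ℝ) : 0 ≤ gate x := step_nonneg _

lemma gate_le_one (x : ℝ) : gate x ≤ 1 := step_le_one _

lemma gate_of_le {x : ℝ} (h : x ≤ 1 / 2) : gate x = 0 := step_of_nonpos (by linarith)

lemma gate_of_one_le {x : ℝ} (h : 1 ≤ x) : gate x = 1 := step_of_one_le (by linarith)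

lemma gateDeriv_nonneg (x : ℝ) : 0 ≤ gateDeriv x := mul_nonneg two_pos.le (stepDeriv_nonneg _)

lemma gateDeriv_le (x : ℝ) : gateDeriv x ≤ 4 := by
  have := stepDeriv_le (2 * x - 1)
  unfold gateDeriv; linarith

lemma gateDeriv_of_le {x : ℝ} (h : x ≤ 1 / 2) : gateDeriv x = 0 := by
  rw [gateDeriv, stepDeriv_of_nonpos (by linarith), mul_zero]

lemma gateDeriv_of_one_le {x : ℝ} (h : 1 ≤ x) : gateDeriv x = 0 := by
  rw [gateDeriv, stepDeriv_of_one_le (by linarith), mul_zero]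

lemma gain_nonneg (x : ℝ) : 0 ≤ gain x := step_nonneg _

lemma gain_le_one (x : ℝ) : gain x ≤ 1 := step_le_one _

lemma gainDeriv_nonneg (x : ℝ) : 0 ≤ gainDeriv x := div_nonneg (stepDeriv_nonneg _) (by norm_num)

lemma gainDeriv_le (x : ℝ) : gainDeriv x ≤ 1 / 2 := by
  have := stepDeriv_le ((x + 2) / 4)
  unfold gainDeriv; linarith

lemma gainDeriv_zero : gainDeriv 0 = 1 / 2 := by
  rw [gainDeriv, stepDeriv_eq]
  norm_num

lemma le_gainDeriv {x : ℝ} (h1 : -1 ≤ x) (h2 : x ≤ 1) : 1 / 4 ≤ gainDeriv x := by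
  have : 1 / 4 ≤ max (min ((x + 2) / 4) (1 - (x + 2) / 4)) 0 :=
    le_max_of_le_left (le_min (by linarith) (by linarith))
  rw [gainDeriv, stepDeriv_eq]
  linarith

lemma abs_gate_sub_le (x y : ℝ) : |gate x - gate y| ≤ 4 * |x - y| := by
  refine (abs_step_sub_le _ _).trans (le_of_eq ?_)
  rw [show 2 * x - 1 - (2 * y - 1) = 2 * (x - y) by ring, abs_mul, abs_two]
  ring

lemma abs_gateDeriv_sub_le (x y : ℝ) : |gateDeriv x - gateDeriv y| ≤ 16 * |x - y| := by
  have h := abs_stepDeriv_sub_le (2 * x - 1) (2 * y - 1)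
  rw [show 2 * x - 1 - (2 * y - 1) = 2 * (x - y) by ring, abs_mul, abs_two] at h
  unfold gateDeriv
  rw [← mul_sub, abs_mul, abs_two]
  linarith

lemma abs_gain_sub_le (x y : ℝ) : |gain x - gain y| ≤ 1 / 2 * |x - y| := by
  refine (abs_step_sub_le _ _).trans (le_of_eq ?_)
  rw [show (x + 2) / 4 - (y + 2) / 4 = (1 / 4) * (x - y) by ring, abs_mul,
    abs_of_pos (by norm_num : (0 : ℝ) < 1 / 4)]
  ring

lemma abs_gainDeriv_sub_le (x y : ℝ) : |gainDeriv x - gainDeriv y| ≤ 1 / 4 * |x - y| := by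
  have h := abs_stepDeriv_sub_le ((x + 2) / 4) ((y + 2) / 4)
  rw [show (x + 2) / 4 - (y + 2) / 4 = (1 / 4) * (x - y) by ring, abs_mul,
    abs_of_pos (by norm_num : (0 : ℝ) < 1 / 4)] at h
  unfold gainDeriv
  rw [← sub_div, abs_div, abs_of_pos (by norm_num : (0 : ℝ) < 4)]
  linarith

lemma penalty_nonneg (x : ℝ) : 0 ≤ penalty x := by unfold penalty; positivity

lemma penaltyDeriv_nonpos (x : ℝ) : penaltyDeriv x ≤ 0 := by
  unfold penaltyDeriv
  have : 0 ≤ max (-x) 0 := le_max_right _ _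
  linarith

lemma penaltyDeriv_of_nonneg {x : ℝ} (h : 0 ≤ x) : penaltyDeriv x = 0 := by
  rw [penaltyDeriv, max_eq_right (by linarith)]; simp

lemma penaltyDeriv_le {x : ℝ} (h : x ≤ -1) : penaltyDeriv x ≤ -(1 / 8) := by
  rw [penaltyDeriv, max_eq_left (by linarith)]; linarith

lemma abs_penaltyDeriv_sub_le (x y : ℝ) :
    |penaltyDeriv x - penaltyDeriv y| ≤ 1 / 8 * |x - y| := by
  have h := abs_max_sub_max_le_abs (-x) (-y) 0
  rw [neg_sub_neg, abs_sub_comm y] at h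
  have h1 : penaltyDeriv x - penaltyDeriv y = -(1 / 8) * (max (-x) 0 - max (-y) 0) := by
    unfold penaltyDeriv; ring
  rw [h1, abs_mul, abs_neg, abs_of_pos (by norm_num : (0 : ℝ) < 1 / 8)]
  linarith

end SmoothStep

/-! ### A non-convex chain -/

section NonconvexChain

variable {T : ℕ}

/-- The non-convex chain. -/
def stair (T : ℕ) (z : Vec (T + 1)) : ℝ :=
  -- The ghost predecessor 1 keeps the first gate open.
  ∑ i, (penalty (z i) - gate (lft 1 z i) * gain (z i))

/-- The gradient of `stair`. -/
def stairGrad (T : ℕ) (z : Vec (T + 1)) : Vec (T + 1) := WithLp.toLp 2 fun i =>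
  penaltyDeriv (z i) - gate (lft 1 z i) * gainDeriv (z i)
    -- As `gain (-2) = 0`, the last coordinate feels no successor.
    - gateDeriv (z i) * gain (rgt (-2) z i)

lemma stairGrad_apply (z : Vec (T + 1)) (i : Fin (T + 1)) : stairGrad T z i
    = penaltyDeriv (z i) - gate (lft 1 z i) * gainDeriv (z i)
      - gateDeriv (z i) * gain (rgt (-2) z i) := rfl

lemma hasGradientAt_stair (z : Vec (T + 1)) : HasGradientAt (stair T) (stairGrad T z) z := by
  have hstair : stair T = fun z => ∑ i, penalty (z i) - (gain (z 0)
      + ∑ j : Fin T, gate (z j.castSucc) * gain (z j.succ)) := by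
    ext z
    rw [stair, Finset.sum_sub_distrib, Fin.sum_univ_succ (f := fun i => gate (lft 1 z i) * _)]
    simp [gate_of_one_le]
  have hc := fun i => Design.hasFDerivAt_coord i z
  have h := (HasFDerivAt.fun_sum (u := Finset.univ) fun i _ =>
    (hasDerivAt_penalty (z i)).comp_hasFDerivAt z (hc i)).sub
    (((hasDerivAt_gain (z 0)).comp_hasFDerivAt z (hc 0)).add
      (HasFDerivAt.fun_sum (u := Finset.univ) fun (j : Fin T) _ =>
        ((hasDerivAt_gate (z j.castSucc)).comp_hasFDerivAt z (hc j.castSucc)).mul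
          ((hasDerivAt_gain (z j.succ)).comp_hasFDerivAt z (hc j.succ))))
  rw [hstair]
  refine hasGradientAt_of_forall h fun v => ?_
  have h1 : ∑ i, gate (lft 1 z i) * gainDeriv (z i) * v i = gainDeriv (z 0) * v 0
      + ∑ j : Fin T, gate (z j.castSucc) * gainDeriv (z j.succ) * v j.succ := by
    rw [Fin.sum_univ_succ]; simp [gate_of_one_le]
  have h2 : ∑ i, gateDeriv (z i) * gain (rgt (-2) z i) * v i
      = ∑ j : Fin T, gateDeriv (z j.castSucc) * gain (z j.succ) * v j.castSucc := by
    have h3 : gain (-2) = 0 := step_of_nonpos (by norm_num)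
    rw [Fin.sum_univ_castSucc]; simp [h3]
  simp only [stairGrad_apply, sub_mul, Finset.sum_sub_distrib]
  rw [h1, h2]
  simp only [add_apply, sub_apply, smul_apply, sum_apply, Design.proj_apply', smul_eq_mul,
    Function.comp_apply, Finset.sum_add_distrib]
  have h4 : ∀ j : Fin T, gain (z j.succ) * (gateDeriv (z j.castSucc) * v j.castSucc)
      = gateDeriv (z j.castSucc) * gain (z j.succ) * v j.castSucc := fun j => by ring
  simp only [h4, mul_assoc]
  ring

lemma continuous_lft (c : ℝ) (i : Fin (T + 1)) : Continuous fun z : Vec (T + 1) => lft c z i := by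
  induction i using Fin.cases with
  | zero => exact continuous_const
  | succ j => simp only [lft_succ]; fun_prop

lemma continuous_rgt (c : ℝ) (i : Fin (T + 1)) : Continuous fun z : Vec (T + 1) => rgt c z i := by
  induction i using Fin.lastCases with
  | last => simp only [rgt_last]; exact continuous_const
  | cast j => simp only [rgt_castSucc]; fun_prop

lemma continuous_stairGrad : Continuous (stairGrad T) := by
  refine (PiLp.continuous_toLp 2 _).comp (continuous_pi fun i => ?_)
  have hz : Continuous fun z : Vec (T + 1) => z i := by fun_prop
  exact ((continuous_penaltyDeriv.comp hz).sub ((continuous_gate.comp (continuous_lft 1 i)).mul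
    (continuous_gainDeriv.comp hz))).sub ((continuous_gateDeriv.comp hz).mul
    (continuous_gain.comp (continuous_rgt (-2) i)))

lemma abs_mul_sub_mul_le {a b a' b' : ℝ} :
    |a * b - a' * b'| ≤ |a - a'| * |b| + |a'| * |b - b'| := by
  rw [← abs_mul, ← abs_mul]
  calc |a * b - a' * b'| = |(a - a') * b + a' * (b - b')| := by ring_nf
    _ ≤ _ := abs_add_le _ _

/-- A component depends on three neighbouring coordinates only; 17 covers `1 / 8 + 1 / 4 + 16`. -/
lemma abs_stairGrad_sub_le (z z' : Vec (T + 1)) (i : Fin (T + 1)) :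
    |stairGrad T z i - stairGrad T z' i|
      ≤ 2 * |lft 0 (z - z') i| + 17 * |z i - z' i| + 2 * |rgt 0 (z - z') i| := by
  have hl : lft 0 (z - z') i = lft 1 z i - lft 1 z' i := by
    induction i using Fin.cases <;> simp
  have hr : rgt 0 (z - z') i = rgt (-2) z i - rgt (-2) z' i := by
    induction i using Fin.lastCases <;> simp
  have h1 : |gate (lft 1 z i) * gainDeriv (z i) - gate (lft 1 z' i) * gainDeriv (z' i)|
      ≤ 2 * |lft 1 z i - lft 1 z' i| + 1 / 4 * |z i - z' i| := by
    refine abs_mul_sub_mul_le.trans (add_le_add ?_ ?_)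
    · rw [abs_of_nonneg (gainDeriv_nonneg _)]
      have := mul_le_mul (abs_gate_sub_le (lft 1 z i) (lft 1 z' i)) (gainDeriv_le (z i))
        (gainDeriv_nonneg _) (by positivity)
      linarith
    · rw [abs_of_nonneg (gate_nonneg _)]
      have := mul_le_mul (gate_le_one (lft 1 z' i)) (abs_gainDeriv_sub_le (z i) (z' i))
        (abs_nonneg _) zero_le_one
      linarith
  have h2 : |gateDeriv (z i) * gain (rgt (-2) z i) - gateDeriv (z' i) * gain (rgt (-2) z' i)|
      ≤ 16 * |z i - z' i| + 2 * |rgt (-2) z i - rgt (-2) z' i| := by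
    refine abs_mul_sub_mul_le.trans (add_le_add ?_ ?_)
    · rw [abs_of_nonneg (gain_nonneg _)]
      have := mul_le_mul (abs_gateDeriv_sub_le (z i) (z' i)) (gain_le_one (rgt (-2) z i))
        (gain_nonneg _) (by positivity)
      linarith
    · rw [abs_of_nonneg (gateDeriv_nonneg _)]
      have := mul_le_mul (gateDeriv_le (z' i)) (abs_gain_sub_le (rgt (-2) z i) (rgt (-2) z' i))
        (abs_nonneg _) (by norm_num)
      linarith
  have h3 := abs_penaltyDeriv_sub_le (z i) (z' i)
  rw [hl, hr, stairGrad_apply, stairGrad_apply]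
  have h4 : ∀ a b c a' b' c' : ℝ, |a - b - c - (a' - b' - c')|
      ≤ |a - a'| + |b - b'| + |c - c'| := by
    intro a b c a' b' c'
    calc |a - b - c - (a' - b' - c')| = |(a - a') - (b - b') - (c - c')| := by ring_nf
      _ ≤ |(a - a') - (b - b')| + |c - c'| := abs_sub _ _
      _ ≤ _ := by gcongr; exact abs_sub _ _
  refine (h4 _ _ _ _ _ _).trans ?_
  have := abs_nonneg (z i - z' i)
  linarith

/-- Cauchy–Schwarz with the weights `2, 17, 2` gives their sum as a Lipschitz constant, independent
of `T`. -/
lemma norm_stairGrad_sub_le (z z' : Vec (T + 1)) :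
    ‖stairGrad T z - stairGrad T z'‖ ≤ 21 * ‖z - z'‖ := by
  refine abs_le_of_sq_le_sq' ?_ (by positivity) |>.2
  have h : ∀ i, (stairGrad T z - stairGrad T z') i ^ 2 ≤ 21 * (2 * lft 0 (z - z') i ^ 2
      + 17 * (z - z') i ^ 2 + 2 * rgt 0 (z - z') i ^ 2) := by
    intro i
    have h1 := pow_le_pow_left₀ (abs_nonneg _) (abs_stairGrad_sub_le z z' i) 2
    rw [sq_abs] at h1
    rw [PiLp.sub_apply, PiLp.sub_apply, ← sq_abs (lft _ _ _), ← sq_abs (rgt _ _ _),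
      ← sq_abs (z i - z' i)]
    refine h1.trans ?_
    have h2 : ∀ a b c : ℝ, (2 * a + 17 * b + 2 * c) ^ 2
        ≤ 21 * (2 * a ^ 2 + 17 * b ^ 2 + 2 * c ^ 2) := fun a b c => by
      linarith [mul_nonneg (by norm_num : (0 : ℝ) ≤ 34) (sq_nonneg (a - b)),
        mul_nonneg (by norm_num : (0 : ℝ) ≤ 4) (sq_nonneg (a - c)),
        mul_nonneg (by norm_num : (0 : ℝ) ≤ 34) (sq_nonneg (b - c))]
    exact h2 _ _ _
  rw [EuclideanSpace.real_norm_sq_eq]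
  refine (Finset.sum_le_sum fun i _ => h i).trans ?_
  rw [← Finset.mul_sum, Finset.sum_add_distrib, Finset.sum_add_distrib, ← Finset.mul_sum,
    ← Finset.mul_sum, ← Finset.mul_sum, ← EuclideanSpace.real_norm_sq_eq]
  have h1 := sum_lft_sq_le (z - z')
  have h2 := sum_rgt_sq_le 0 (z - z')
  nlinarith

lemma le_stair (z : Vec (T + 1)) : -((T : ℝ) + 1) ≤ stair T z := by
  have h : ∀ i, -1 ≤ penalty (z i) - gate (lft 1 z i) * gain (z i) := by
    intro i
    have h1 := penalty_nonneg (z i)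
    have h2 := mul_le_mul (gate_le_one (lft 1 z i)) (gain_le_one (z i)) (gain_nonneg _) zero_le_one
    linarith
  have := Finset.sum_le_sum fun i (_ : i ∈ (Finset.univ : Finset (Fin (T + 1)))) => h i
  simpa [stair] using this

lemma stair_zero_nonpos : stair T 0 ≤ 0 := by
  refine Finset.sum_nonpos fun i _ => ?_
  have h1 : penalty ((0 : Vec (T + 1)) i) = 0 := by simp [penalty]
  have h2 := mul_nonneg (gate_nonneg (lft 1 (0 : Vec (T + 1)) i))
    (gain_nonneg ((0 : Vec (T + 1)) i))
  linarith

/-- At an untouched coordinate the penalty and its own gate are flat, so only the pull of the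
predecessor is felt. -/
lemma stairGrad_of_mem_initial {k : ℕ} {z : Vec (T + 1)} (hz : z ∈ initial T k) {i : Fin (T + 1)}
    (hi : k ≤ i) : stairGrad T z i = -(1 / 2) * gate (lft 1 z i) := by
  rw [stairGrad_apply, hz i hi, penaltyDeriv_of_nonneg le_rfl, gainDeriv_zero,
    gateDeriv_of_le (by norm_num)]
  ring

lemma stairGrad_mem {k : ℕ} {z : Vec (T + 1)} (hz : z ∈ initial T k) :
    stairGrad T z ∈ initial T (k + 1) := by
  intro i hi
  rw [stairGrad_of_mem_initial hz (by omega), lft_eq_zero hz hi, gate_of_le (by norm_num)]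
  ring

lemma exists_stairGrad_ne_zero (k : Fin (T + 1)) :
    ∃ z ∈ initial T k, stairGrad T z k ≠ 0 := by
  set z : Vec (T + 1) := WithLp.toLp 2 fun i => if i < k then 1 else 0 with hz'
  have hz : z ∈ initial T k := by
    intro i hi
    have : ¬ i < k := not_lt.2 hi
    simp [hz', this]
  refine ⟨z, hz, ?_⟩
  have h : lft 1 z k = 1 := by
    clear hz
    induction k using Fin.cases with
    | zero => rfl
    | succ j => simp [hz']
  rw [stairGrad_of_mem_initial hz le_rfl, h, gate_of_one_le le_rfl]
  norm_num

lemma stairGrad_const : stairGrad T (WithLp.toLp 2 fun _ => 2) = 0 := by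
  ext i
  have h : lft 1 (WithLp.toLp 2 fun _ => 2 : Vec (T + 1)) i ≥ 1 := by
    induction i using Fin.cases <;> simp
  have h1 : gainDeriv 2 = 0 := by
    rw [gainDeriv, stepDeriv_of_one_le (by norm_num)]; simp
  rw [stairGrad_apply]
  simp [h1, penaltyDeriv_of_nonneg, gateDeriv_of_one_le]

/-- As long as the last coordinate is small, the gradient of `stair` is not small. -/
lemma le_norm_stairGrad {z : Vec (T + 1)} (hz : z (Fin.last T) < 1) :
    1 / 8 ≤ ‖stairGrad T z‖ := by
  -- At the first coordinate below 1 the gate is open and all contributions have the same sign;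
  -- below `-1` the penalty gives at least `1 / 8`, above it the gain does.
  have hex : ∃ k : ℕ, ∃ h : k < T + 1, z ⟨k, h⟩ < 1 := ⟨T, T.lt_succ_self, hz⟩
  classical
  obtain ⟨hk, hzk⟩ := Nat.find_spec hex
  set i : Fin (T + 1) := ⟨Nat.find hex, hk⟩ with hi
  have hl : 1 ≤ lft 1 z i := by
    rcases Fin.eq_zero_or_eq_succ i with h0 | ⟨j, hj⟩
    · rw [h0, lft_zero]
    · rw [hj, lft_succ]
      have hlt : (j : ℕ) < Nat.find hex := by
        have : Nat.find hex = (j : ℕ) + 1 := congrArg Fin.val hj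
        omega
      by_contra hc
      exact Nat.find_min hex hlt ⟨by omega, not_le.1 hc⟩
  have h1 : stairGrad T z i ≤ -(1 / 8) := by
    rw [stairGrad_apply, gate_of_one_le hl]
    have h2 := mul_nonneg (gateDeriv_nonneg (z i)) (gain_nonneg (rgt (-2) z i))
    rcases le_total (z i) (-1) with h | h
    · have := penaltyDeriv_le h
      have := gainDeriv_nonneg (z i)
      linarith
    · have := penaltyDeriv_nonpos (z i)
      have := le_gainDeriv h (le_of_lt hzk)
      linarith
  have h3 := Design.abs_le_norm_coord (stairGrad T z) i
  rw [abs_of_nonpos (by linarith)] at h3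
  linarith

lemma not_convexOn_stair : ¬ ConvexOn ℝ Set.univ (stair T) := by
  intro h
  set p : ℝ → Vec (T + 1) := fun x => EuclideanSpace.single 0 x with hp
  have hval : ∀ x : ℝ, x ≤ 1 / 2 → stair T (p x) = penalty x - gain x := by
    intro x hx
    rw [stair, Fin.sum_univ_succ, Finset.sum_eq_zero]
    · simp [hp, gate_of_one_le]
    · intro j _
      have h1 : lft 1 (p x) j.succ ≤ 1 / 2 := by
        rw [lft_succ]
        by_cases hj : j.castSucc = 0
        · simpa [hp, hj] using hx
        · simp [hp, hj]
      have h2 : p x j.succ = 0 := by simp [hp]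
      rw [gate_of_le h1, h2]
      simp [penalty]
  -- Along the first axis the values at `-2, -1, 0` are `1/4, -1/16, -1/2`, so the midpoint lies
  -- above the chord.
  have h1 := h.2 (Set.mem_univ (p (-2))) (Set.mem_univ (p 0)) (by norm_num : (0 : ℝ) ≤ 1 / 2)
    (by norm_num : (0 : ℝ) ≤ 1 / 2) (by norm_num)
  have h2 : (1 / 2 : ℝ) • p (-2) + (1 / 2 : ℝ) • p 0 = p (-1) := by
    ext i
    by_cases hi : i = 0 <;> simp [hp, hi]
  rw [h2, hval _ (by norm_num), hval _ (by norm_num), hval _ (by norm_num)] at h1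
  norm_num [penalty, gain, step] at h1

end NonconvexChain

/-! ### A function that hides the frontier of the non-convex chain -/

section Mask

variable {T : ℕ}

/-- The squared norm of the coordinates from `i` on. -/
def tailSq (i : Fin (T + 1)) (z : Vec (T + 1)) : ℝ := ∑ k, if i ≤ k then z k ^ 2 else 0

/-- The part of a vector that consists of the coordinates from `i` on. -/
def tailVec (i : Fin (T + 1)) (z : Vec (T + 1)) : Vec (T + 1) :=
  WithLp.toLp 2 fun k => if i ≤ k then z k else 0

/-- The unit vector of the predecessor of `i`, if there is one. -/
def prevVec (i : Fin (T + 1)) : Vec (T + 1) :=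
  Fin.cases 0 (fun j => EuclideanSpace.single j.castSucc 1) i

lemma prevVec_apply_eq_zero {i k : Fin (T + 1)} (h : i ≤ k) : prevVec i k = 0 := by
  induction i using Fin.cases with
  | zero => rfl
  | succ j =>
    have : k ≠ j.castSucc := by
      intro hk; subst hk
      exact absurd h (not_le.2 (Fin.castSucc_lt_succ))
    simp [prevVec, this]

lemma norm_prevVec_le (i : Fin (T + 1)) : ‖prevVec i‖ ≤ 1 := by
  induction i using Fin.cases with
  | zero => simp [prevVec]
  | succ j => simp [prevVec]

lemma hasGradientAt_lft (c : ℝ) (i : Fin (T + 1)) (z : Vec (T + 1)) :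
    HasGradientAt (fun z => lft c z i) (prevVec i) z := by
  induction i using Fin.cases with
  | zero => exact hasGradientAt_const z c
  | succ j =>
    refine hasGradientAt_of_forall (Design.hasFDerivAt_coord j.castSucc z) fun v => ?_
    rw [← inner_eq_sum]
    simp [prevVec, EuclideanSpace.inner_single_left]

lemma norm_sq_tailVec (i : Fin (T + 1)) (z : Vec (T + 1)) : ‖tailVec i z‖ ^ 2 = tailSq i z := by
  rw [EuclideanSpace.real_norm_sq_eq, tailSq]
  refine Finset.sum_congr rfl fun k _ => ?_
  simp only [tailVec]
  split_ifs <;> simp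

lemma hasGradientAt_tailSq (i : Fin (T + 1)) (z : Vec (T + 1)) :
    HasGradientAt (tailSq i) ((2 : ℝ) • tailVec i z) z := by
  have h : HasFDerivAt (tailSq i) (∑ k, if i ≤ k then (2 * z k) •
      (EuclideanSpace.proj k : Vec (T + 1) →L[ℝ] ℝ) else 0) z := by
    unfold tailSq
    refine HasFDerivAt.fun_sum fun k _ => ?_
    split_ifs
    · have := (Design.hasFDerivAt_coord k z).pow 2
      simpa using this
    · exact hasFDerivAt_const _ _
  refine hasGradientAt_of_forall h fun v => ?_
  rw [sum_apply]
  refine Finset.sum_congr rfl fun k _ => ?_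
  simp only [tailVec, PiLp.smul_apply, smul_eq_mul]
  split_ifs <;> simp

lemma sq_le_tailSq {i k : Fin (T + 1)} (h : i ≤ k) (z : Vec (T + 1)) : z k ^ 2 ≤ tailSq i z := by
  have := Finset.single_le_sum (f := fun k => if i ≤ k then z k ^ 2 else 0)
    (fun k _ => by dsimp only; split_ifs; exacts [sq_nonneg _, le_rfl]) (Finset.mem_univ k)
  simp only [h, if_true] at this
  exact this

/-- One summand of `mask`. -/
def maskTerm (i : Fin (T + 1)) (z : Vec (T + 1)) : ℝ :=
  -- The cutoff is one while the tail from `i` has squared norm at most `1 / 8`, and zero from `1 /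
  -- 4` on.
  gate (lft 1 z i) * (z i * step (2 - 8 * tailSq i z))

/-- The gradient of `maskTerm`. -/
def maskTermGrad (i : Fin (T + 1)) (z : Vec (T + 1)) : Vec (T + 1) :=
  (gateDeriv (lft 1 z i) * (z i * step (2 - 8 * tailSq i z))) • prevVec i
    + (gate (lft 1 z i) * step (2 - 8 * tailSq i z)) • EuclideanSpace.single i (1 : ℝ)
    + (gate (lft 1 z i) * z i * stepDeriv (2 - 8 * tailSq i z) * (-16)) • tailVec i z

/-- A function whose gradient agrees with that of `stair` at the frontier of the chain. -/
def mask (T : ℕ) (z : Vec (T + 1)) : ℝ := -(1 / 2) * ∑ i, maskTerm i z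

/-- The gradient of `mask`. -/
def maskGrad (T : ℕ) (z : Vec (T + 1)) : Vec (T + 1) := -(1 / 2 : ℝ) • ∑ i, maskTermGrad i z

lemma hasGradientAt_maskTerm (i : Fin (T + 1)) (z : Vec (T + 1)) :
    HasGradientAt (maskTerm i) (maskTermGrad i z) z := by
  have h1 := (hasDerivAt_gate (lft 1 z i)).comp_hasFDerivAt z (hasGradientAt_lft 1 i z).hasFDerivAt
  have h2 := (hasDerivAt_step (2 - 8 * tailSq i z)).comp_hasFDerivAt z
    (((hasGradientAt_tailSq i z).hasFDerivAt.const_mul 8).const_sub 2)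
  have h := h1.mul ((Design.hasFDerivAt_coord i z).mul h2)
  refine hasGradientAt_of_forall h fun v => ?_
  have h3 : inner ℝ (EuclideanSpace.single i (1 : ℝ)) v = v i := by
    simp [EuclideanSpace.inner_single_left]
  rw [← inner_eq_sum, maskTermGrad, inner_add_left, inner_add_left, real_inner_smul_left,
    real_inner_smul_left, real_inner_smul_left, h3]
  simp only [add_apply, smul_apply, neg_apply, smul_eq_mul,
    InnerProductSpace.toDual_apply_apply, Design.proj_apply', real_inner_smul_left,
    Function.comp_apply, Pi.mul_apply]
  ring

lemma hasGradientAt_mask (z : Vec (T + 1)) : HasGradientAt (mask T) (maskGrad T z) z :=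
  HasGradientAt.const_mul' _ (HasGradientAt.sum' fun i _ => hasGradientAt_maskTerm i z)

lemma continuous_maskGrad : Continuous (maskGrad T) := by
  have hstep := continuous_step
  have hstepD := continuous_stepDeriv
  have hgate := continuous_gate
  have hgateD := continuous_gateDeriv
  have hlft := fun i : Fin (T + 1) => continuous_lft 1 i
  have htail : ∀ i : Fin (T + 1), Continuous (tailSq i) := fun i =>
    continuous_iff_continuousAt.2 fun z => (hasGradientAt_tailSq i z).continuousAt
  have htailVec : ∀ i : Fin (T + 1), Continuous (tailVec i) := by
    intro i
    refine (PiLp.continuous_toLp 2 _).comp (continuous_pi fun k => ?_)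
    split_ifs
    · fun_prop
    · exact continuous_const
  have hin : ∀ i : Fin (T + 1), Continuous fun z => 2 - 8 * tailSq i z := fun i =>
    continuous_const.sub ((htail i).const_mul 8)
  have hterm : ∀ i : Fin (T + 1), Continuous (maskTermGrad i) := by
    intro i
    have h1 := hgate.comp (hlft i)
    have h2 := hgateD.comp (hlft i)
    have h3 := hstep.comp (hin i)
    have h4 := hstepD.comp (hin i)
    have hz : Continuous fun z : Vec (T + 1) => z i := by fun_prop
    exact (((h2.mul (hz.mul h3)).smul continuous_const).add
      ((h1.mul h3).smul continuous_const)).add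
      ((((h1.mul hz).mul h4).mul continuous_const).smul (htailVec i))
  have hsum : Continuous fun z : Vec (T + 1) => ∑ i, maskTermGrad i z :=
    continuous_finsetSum _ fun i _ => hterm i
  exact hsum.const_smul (-(1 / 2 : ℝ))

lemma active_of_maskTermGrad_ne_zero {i : Fin (T + 1)} {z : Vec (T + 1)}
    (h : maskTermGrad i z ≠ 0) : 1 / 2 < lft 1 z i ∧ tailSq i z < 1 / 4 := by
  by_contra hc
  refine h ?_
  unfold maskTermGrad
  by_cases h1 : lft 1 z i ≤ 1 / 2
  · simp [gate_of_le h1, gateDeriv_of_le h1]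
  · have h2 : 1 / 4 ≤ tailSq i z := by
      by_contra h2
      exact hc ⟨not_le.1 h1, not_le.1 h2⟩
    simp [step_of_nonpos (by linarith : 2 - 8 * tailSq i z ≤ 0),
      stepDeriv_of_nonpos (by linarith : 2 - 8 * tailSq i z ≤ 0)]

/-- If `i < i'`, then the predecessor of `i'` belongs to the tail from `i`; an open gate at `i'`
puts its square above `1 / 4`, where the cutoff of `i` vanishes. Hence the bound on `maskGrad` does
not depend on `T`. -/
lemma active_unique {i i' : Fin (T + 1)} {z : Vec (T + 1)} (h : maskTermGrad i z ≠ 0)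
    (h' : maskTermGrad i' z ≠ 0) : i = i' := by
  have key : ∀ i i' : Fin (T + 1), maskTermGrad i z ≠ 0 → maskTermGrad i' z ≠ 0 → ¬ i < i' := by
    intro i i' h h' hlt
    obtain ⟨-, h2⟩ := active_of_maskTermGrad_ne_zero h
    obtain ⟨h3, -⟩ := active_of_maskTermGrad_ne_zero h'
    rcases Fin.eq_zero_or_eq_succ i' with rfl | ⟨j, rfl⟩
    · exact absurd hlt (Fin.not_lt_zero i)
    · rw [lft_succ] at h3
      have := sq_le_tailSq (Fin.le_castSucc_iff.2 hlt) z
      nlinarith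
  exact le_antisymm (not_lt.1 (key i' i h' h)) (not_lt.1 (key i i' h h'))

lemma norm_maskTermGrad_le (i : Fin (T + 1)) (z : Vec (T + 1)) : ‖maskTermGrad i z‖ ≤ 11 := by
  by_cases h : maskTermGrad i z = 0
  · rw [h]; simp
  obtain ⟨-, h2⟩ := active_of_maskTermGrad_ne_zero h
  have hz : |z i| ≤ 1 / 2 := by
    refine abs_le_of_sq_le_sq ?_ (by norm_num)
    have := sq_le_tailSq le_rfl (i := i) z
    linarith
  have ht : ‖tailVec i z‖ ≤ 1 / 2 := by
    refine abs_le_of_sq_le_sq' ?_ (by norm_num) |>.2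
    rw [norm_sq_tailVec]; linarith
  have hg := gate_nonneg (lft 1 z i)
  have hg' := gate_le_one (lft 1 z i)
  have hG := gateDeriv_nonneg (lft 1 z i)
  have hG' := gateDeriv_le (lft 1 z i)
  have hs := step_nonneg (2 - 8 * tailSq i z)
  have hs' := step_le_one (2 - 8 * tailSq i z)
  have hS := stepDeriv_nonneg (2 - 8 * tailSq i z)
  have hS' := stepDeriv_le (2 - 8 * tailSq i z)
  have n1 : ‖(gateDeriv (lft 1 z i) * (z i * step (2 - 8 * tailSq i z))) • prevVec i‖ ≤ 2 := by
    rw [norm_smul, Real.norm_eq_abs, abs_mul, abs_mul, abs_of_nonneg hG, abs_of_nonneg hs]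
    refine le_trans (b := 4 * (1 / 2 * 1) * 1) ?_ (by norm_num)
    gcongr
    exact norm_prevVec_le i
  have n2 : ‖(gate (lft 1 z i) * step (2 - 8 * tailSq i z)) •
      EuclideanSpace.single i (1 : ℝ)‖ ≤ 1 := by
    rw [norm_smul, Real.norm_eq_abs, abs_mul, abs_of_nonneg hg, abs_of_nonneg hs]
    simp only [PiLp.norm_single, norm_one, mul_one]
    exact mul_le_one₀ hg' hs hs'
  have n3 : ‖(gate (lft 1 z i) * z i * stepDeriv (2 - 8 * tailSq i z) * (-16)) •
      tailVec i z‖ ≤ 8 := by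
    rw [norm_smul, Real.norm_eq_abs, abs_mul, abs_mul, abs_mul, abs_of_nonneg hg,
      abs_of_nonneg hS, abs_neg, abs_of_pos (by norm_num : (0 : ℝ) < 16)]
    refine le_trans (b := 1 * (1 / 2) * 2 * 16 * (1 / 2)) ?_ (by norm_num)
    gcongr
  unfold maskTermGrad
  refine (norm_add_le _ _).trans ?_
  have := norm_add_le ((gateDeriv (lft 1 z i) * (z i * step (2 - 8 * tailSq i z))) • prevVec i)
    ((gate (lft 1 z i) * step (2 - 8 * tailSq i z)) • EuclideanSpace.single i (1 : ℝ))
  linarith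

lemma norm_maskGrad_le (z : Vec (T + 1)) : ‖maskGrad T z‖ ≤ 6 := by
  have h : ‖∑ i, maskTermGrad i z‖ ≤ 11 := by
    by_cases hex : ∃ i, maskTermGrad i z ≠ 0
    · obtain ⟨i, hi⟩ := hex
      rw [Finset.sum_eq_single i]
      · exact norm_maskTermGrad_le i z
      · intro i' _ hne
        by_contra hc
        exact hne (active_unique hc hi)
      · simp
    · simp only [not_exists, not_not] at hex
      simp [hex]
  rw [maskGrad, norm_smul, norm_neg, Real.norm_of_nonneg (by norm_num)]
  linarith

/-- With zero tail the cutoff is flat and equal to one, and at coordinate `i` the derivatives of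
gates and cutoffs carry vanishing factors. -/
lemma maskGrad_of_mem_initial {k : ℕ} {z : Vec (T + 1)} (hz : z ∈ initial T k) {i : Fin (T + 1)}
    (hi : k ≤ i) : maskGrad T z i = -(1 / 2) * gate (lft 1 z i) := by
  have htail : tailSq i z = 0 := Finset.sum_eq_zero fun k' _ => by
    split_ifs with h
    · rw [hz k' (hi.trans h)]; simp
    · rfl
  have h1 : ∀ i', maskTermGrad i' z i = if i' = i then gate (lft 1 z i) else 0 := by
    intro i'
    have e1 : z i' * prevVec i' i = 0 := by
      rcases le_or_gt i' i with h | h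
      · rw [prevVec_apply_eq_zero h, mul_zero]
      · rw [hz i' (hi.trans (le_of_lt h)), zero_mul]
    have e2 : tailVec i' z i = 0 := by simp [tailVec, hz i hi]
    simp only [maskTermGrad, PiLp.add_apply, PiLp.smul_apply, smul_eq_mul, e2, mul_zero, add_zero]
    have e3 : gateDeriv (lft 1 z i') * (z i' * step (2 - 8 * tailSq i' z)) * prevVec i' i = 0 := by
      linear_combination (gateDeriv (lft 1 z i') * step (2 - 8 * tailSq i' z)) * e1
    rw [e3, zero_add]
    split_ifs with h
    · subst h
      rw [htail, step_of_one_le (by norm_num)]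
      simp
    · simp [Ne.symm h]
  have h2 : (∑ i', maskTermGrad i' z) i = gate (lft 1 z i) := by
    rw [WithLp.ofLp_sum, Finset.sum_apply]
    simp [h1]
  rw [maskGrad, PiLp.smul_apply, h2, smul_eq_mul]

lemma stairGrad_sub_maskGrad_mem {k : ℕ} {z : Vec (T + 1)} (hz : z ∈ initial T k) :
    stairGrad T z - maskGrad T z ∈ initial T k := by
  intro i hi
  rw [PiLp.sub_apply, stairGrad_of_mem_initial hz hi, maskGrad_of_mem_initial hz hi, sub_self]

end Mask

/-! ### The non-convex case -/

/-- There is a non-convex problem with the given parameters on which every method needs at least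
`B` queries. -/
def NonConvexHard (n : ℕ) (δmax δ ρ σ ζ L Δ ε αmin B : ℝ) : Prop :=
  ∃ (P : Problem n) (A : (Fin n → Vec P.d) → Vec P.d),
    (1 - δ) * n ≤ P.H.card ∧ P.InFunctionClass L ζ ∧ P.InOracleClass σ ∧
    IsRobustAggregator δmax ρ δ P.H A ∧
    P.IsNonConvex ∧ P.HasInitialGap Δ ∧
    ENNReal.ofReal (1 / 4 * (√ρ * √δ * ζ)) ≤ byzantineError P A αmin ∧
    ∀ M : MethodRun P A αmin,
      ENNReal.ofReal B ≤ M.queryComplexity (byzantineError P A αmin + ENNReal.ofReal ε)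

lemma NonConvexHard.mono {n : ℕ} {δmax δ ρ σ ζ L Δ ε αmin B B' : ℝ}
    (h : NonConvexHard n δmax δ ρ σ ζ L Δ ε αmin B) (hB : B' ≤ B) :
    NonConvexHard n δmax δ ρ σ ζ L Δ ε αmin B' := by
  obtain ⟨P, A, h1, h2, h3, h4, h5, h6, h7, h8⟩ := h
  exact ⟨P, A, h1, h2, h3, h4, h5, h6, h7, fun M => (ENNReal.ofReal_le_ofReal hB).trans (h8 M)⟩

/-- A function on a chain that is rescaled in its domain and in its range. -/
def rescale {T : ℕ} (G l : ℝ) (f : Vec (T + 1) → ℝ) (z : Vec (T + 1)) : ℝ :=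
  G * l * f (l⁻¹ • z)

/-- The gradient of a rescaled function. -/
def rescaleGrad {T : ℕ} (G l : ℝ) (g : Vec (T + 1) → Vec (T + 1)) (z : Vec (T + 1)) :
    Vec (T + 1) := G • g (l⁻¹ • z)

/-! ### Rescaling in domain and range -/

section Rescale

variable {T : ℕ} {G l : ℝ} {f : Vec (T + 1) → ℝ} {g : Vec (T + 1) → Vec (T + 1)}

lemma hasGradientAt_rescale (hl : l ≠ 0) (hf : ∀ z, HasGradientAt f (g z) z) (z : Vec (T + 1)) :
    HasGradientAt (rescale G l f) (rescaleGrad G l g z) z := by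
  have h1 : HasFDerivAt (fun z : Vec (T + 1) => l⁻¹ • z)
      (l⁻¹ • ContinuousLinearMap.id ℝ (Vec (T + 1))) z := (hasFDerivAt_id z).const_smul l⁻¹
  have h2 := ((hf (l⁻¹ • z)).hasFDerivAt.comp z h1).const_mul (G * l)
  refine hasGradientAt_of_forall h2 fun v => ?_
  rw [← inner_eq_sum, rescaleGrad, real_inner_smul_left]
  simp only [smul_apply, ContinuousLinearMap.comp_apply, ContinuousLinearMap.id_apply,
    InnerProductSpace.toDual_apply_apply, real_inner_smul_right, smul_eq_mul]
  field_simp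

lemma continuous_rescaleGrad (hg : Continuous g) : Continuous (rescaleGrad G l g) := by
  unfold rescaleGrad; fun_prop

lemma norm_rescaleGrad_sub_le (hG : 0 ≤ G) (hl : 0 < l) {C : ℝ}
    (hg : ∀ z z', ‖g z - g z'‖ ≤ C * ‖z - z'‖) (z z' : Vec (T + 1)) :
    ‖rescaleGrad G l g z - rescaleGrad G l g z'‖ ≤ G * C / l * ‖z - z'‖ := by
  have h := hg (l⁻¹ • z) (l⁻¹ • z')
  rw [← smul_sub, norm_smul, Real.norm_of_nonneg (inv_nonneg.2 hl.le)] at h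
  rw [rescaleGrad, rescaleGrad, ← smul_sub, norm_smul, Real.norm_of_nonneg hG]
  calc _ ≤ G * (C * (l⁻¹ * ‖z - z'‖)) := mul_le_mul_of_nonneg_left h hG
    _ = _ := by ring

lemma not_convexOn_rescale (hG : 0 < G) (hl : 0 < l) (hf : ¬ ConvexOn ℝ Set.univ f) :
    ¬ ConvexOn ℝ Set.univ (rescale G l f) := by
  intro h
  refine hf ?_
  have h1 := (h.comp_linearMap (l • LinearMap.id (R := ℝ) (M := Vec (T + 1)))).smul
    (inv_nonneg.2 (mul_pos hG hl).le)
  have h2 : f = fun z => (G * l)⁻¹ •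
      (rescale G l f ∘ ⇑(l • LinearMap.id (R := ℝ) (M := Vec (T + 1)))) z := by
    ext z
    have : l⁻¹ • l • z = z := by rw [smul_smul, inv_mul_cancel₀ hl.ne', one_smul]
    simp only [rescale, Function.comp_apply, LinearMap.smul_apply, LinearMap.id_apply, this,
      smul_eq_mul]
    field_simp
  rw [h2]
  exact h1

end Rescale

/-- The design of the non-convex instances. -/
def stairDesign (n T N : ℕ) (x ε ζ L G l v ω : ℝ) : Design n T N where
  a := L / 2
  b := x / 2
  θ := drop x ε
  -- The stationary point is the constant vector 2, scaled by `l`; its last coordinate sits at a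
  -- quarter period.
  lam := 2 / Real.pi * (l * 2)
  e := L / 2
  s := v
  ω := ω
  τ := tilt n ζ
  H := rescale G l (stair T)
  ψ := rescale G l (mask T)
  gH := rescaleGrad G l (stairGrad T)
  gψ := rescaleGrad G l (maskGrad T)

/-! ### Parameters and bounds of the non-convex instances -/

section NonConvex

variable {n T N : ℕ} {δmax δ ρ σ ζ L Δ ε αmin v ω : ℝ}

/-- The conditions on the parameters of the non-convex instances. -/
structure StairParams (n T : ℕ) (δmax δ ρ ζ L Δ ε : ℝ) : Prop where
  two_le : 2 ≤ n
  δ_nonneg : 0 ≤ δ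
  δ_le : δ ≤ δmax
  δmax_lt : δmax < 1 / 2
  ρ_nonneg : 0 ≤ ρ
  ζ_nonneg : 0 ≤ ζ
  L_pos : 0 < L
  ε_pos : 0 < ε
  slope_le : (√ρ * √δ * ζ) ^ 2 ≤ L * Δ
  -- `100352 = 2 * (43008 + 7168)`, from the range `32 * 1344` per step of the staircase and the
  -- amplitude of the coupling, which together must fit into `Δ / 2`.
  length_le : 100352 * (T + 1) * ε ^ 2 ≤ L * Δ

/-- The design with the scales that are used for optimization error `ε`. -/
abbrev stairInstance (n T N : ℕ) (δ ρ ζ L ε v ω : ℝ) : Design n T N :=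
  -- The factor 32 turns the bound `1 / 8` of `le_norm_stairGrad` into `4 * ε`; and `1344 = 64 * 21`
  -- makes the chain `L / 2`-smooth.
  stairDesign n T N (√ρ * √δ * ζ) ε ζ L (32 * ε) (1344 * ε / L) v ω

lemma StairParams.slope_nonneg (hQ : StairParams n T δmax δ ρ ζ L Δ ε) :
    0 ≤ √ρ * √δ * ζ := mul_nonneg (by positivity) hQ.ζ_nonneg

lemma StairParams.scale_pos (hQ : StairParams n T δmax δ ρ ζ L Δ ε) : 0 < 1344 * ε / L := by
  have := hQ.ε_pos
  have := hQ.L_pos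
  positivity

lemma StairParams.regular (hQ : StairParams n T δmax δ ρ ζ L Δ ε) :
    (stairInstance n T N δ ρ ζ L ε v ω).Regular where
  n_pos := lt_of_lt_of_le two_pos hQ.two_le
  lam_pos := by
    have := hQ.scale_pos
    have := Real.pi_pos
    simp only [stairDesign]
    positivity
  hasGradientAt_H := hasGradientAt_rescale hQ.scale_pos.ne' hasGradientAt_stair
  continuous_gH := continuous_rescaleGrad continuous_stairGrad
  hasGradientAt_ψ := hasGradientAt_rescale hQ.scale_pos.ne' hasGradientAt_mask
  continuous_gψ := continuous_rescaleGrad continuous_maskGrad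
  sum_τ := sum_tilt hQ.two_le ζ

lemma sub_rescaleGrad_mem {G l : ℝ} {k : ℕ} {z : Vec (T + 1)} (hz : z ∈ initial T k) :
    rescaleGrad G l (stairGrad T) z - rescaleGrad G l (maskGrad T) z ∈ initial T k := by
  rw [rescaleGrad, rescaleGrad, ← smul_sub]
  exact Submodule.smul_mem _ _ (stairGrad_sub_maskGrad_mem (Submodule.smul_mem _ _ hz))

lemma rescaleGrad_stair_mem {G l : ℝ} {k : ℕ} {z : Vec (T + 1)} (hz : z ∈ initial T k) :
    rescaleGrad G l (stairGrad T) z ∈ initial T (k + 1) :=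
  Submodule.smul_mem _ _ (stairGrad_mem (Submodule.smul_mem _ _ hz))

lemma StairParams.hard (hQ : StairParams n T δmax δ ρ ζ L Δ ε) :
    (stairInstance n T N δ ρ ζ L ε v ω).Hard (ρ * δ) ε where
  regular := hQ.regular
  two_le := hQ.two_le
  κ_nonneg := mul_nonneg hQ.ρ_nonneg hQ.δ_nonneg
  θ_nonneg := drop_nonneg hQ.slope_nonneg hQ.ε_pos.le
  θ_le := by
    have := drop_le_left (√ρ * √δ * ζ) ε
    have := hQ.slope_nonneg
    simp only [stairDesign]
    linarith
  tilt := tilt_condition hQ.ρ_nonneg hQ.δ_nonneg hQ.ζ_nonneg hQ.two_le hQ.ε_pos.le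
  ε_pos := hQ.ε_pos
  lock z hz := by
    refine (slope_lock hQ.slope_nonneg hQ.ε_pos.le).trans (add_le_add_right ?_ _)
    refine pow_le_pow_left₀ (by linarith [hQ.ε_pos]) ?_ 2
    have h1 := le_norm_stairGrad (z := (1344 * ε / L)⁻¹ • z) (by simp [hz])
    have hG : 0 ≤ 32 * ε := by linarith [hQ.ε_pos]
    simp only [stairDesign, rescaleGrad]
    rw [norm_smul, Real.norm_of_nonneg hG]
    nlinarith
  zeroChain :=
    { gH_mem := fun _ _ hz => rescaleGrad_stair_mem hz
      gψ_mem := fun k z hz => by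
        have h := sub_mem (rescaleGrad_stair_mem (G := 32 * ε) (l := 1344 * ε / L) hz)
          (initial_mono k.le_succ (sub_rescaleGrad_mem (G := 32 * ε) (l := 1344 * ε / L) hz))
        rwa [sub_sub_cancel] at h }
  progress k := by
    obtain ⟨z, hz, hne⟩ := exists_stairGrad_ne_zero k
    refine ⟨(1344 * ε / L) • z, Submodule.smul_mem _ _ hz, ?_⟩
    have hG : 32 * ε ≠ 0 := by linarith [hQ.ε_pos]
    simp only [stairDesign, rescaleGrad]
    rw [smul_smul, inv_mul_cancel₀ hQ.scale_pos.ne', one_smul]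
    exact mul_ne_zero hG hne
  target := by
    refine ⟨(1344 * ε / L) • WithLp.toLp 2 fun _ => 2, ?_, ?_⟩
    · simp only [stairDesign, rescaleGrad]
      rw [smul_smul, inv_mul_cancel₀ hQ.scale_pos.ne', one_smul, stairGrad_const, smul_zero]
    · exact sin_div_eq_one (mul_pos hQ.scale_pos two_pos).ne'

lemma StairParams.nonConvexHard (hQ : StairParams n T δmax δ ρ ζ L Δ ε) {B : ℝ}
    (hσ : ω ^ 2 * N * (192 * ε) ^ 2 + v ^ 2 ≤ σ ^ 2)
    (hB : ∀ r (M : MethodRun (Design.problem (hQ.regular (N := N) (v := v) (ω := ω)) r)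
      (erasingMean (ρ * δ)) αmin), ENNReal.ofReal B ≤ M.queryComplexity
        (byzantineError (Design.problem (hQ.regular (N := N) (v := v) (ω := ω)) r)
          (erasingMean (ρ * δ)) αmin + ENNReal.ofReal ε)) :
    NonConvexHard n δmax δ ρ σ ζ L Δ ε αmin B := by
  have hε := hQ.ε_pos
  have hL := hQ.L_pos
  have hl := hQ.scale_pos
  have hx := hQ.slope_nonneg
  have hreg := hQ.regular (N := N) (v := v) (ω := ω)
  have hθ := drop_nonneg hx hε.le
  have hpi := Real.pi_gt_three
  have hpi' := Real.pi_lt_four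
  have hG : 0 < 32 * ε := by positivity
  have hlow : ∀ z : Vec (T + 1), -(32 * ε * (1344 * ε / L) * (T + 1))
      ≤ rescale (32 * ε) (1344 * ε / L) (stair T) z := by
    intro z
    have := mul_le_mul_of_nonneg_left (le_stair ((1344 * ε / L)⁻¹ • z)) (mul_pos hG hl).le
    unfold rescale
    linarith
  have hzero : rescale (32 * ε) (1344 * ε / L) (stair T) 0 ≤ 0 := by
    unfold rescale
    rw [smul_zero]
    exact mul_nonpos_of_nonneg_of_nonpos (mul_pos hG hl).le stair_zero_nonpos
  obtain ⟨r, hr⟩ := hreg.exists_hasInitialGap (Δ := Δ) (half_pos hL) (half_pos hL) hθ hlow (by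
    have h1 : (√ρ * √δ * ζ / 2) ^ 2 / (2 * (L / 2)) ≤ Δ / 4 := by
      rw [div_le_iff₀ (by positivity)]
      have := hQ.slope_le
      linarith
    have h2 : drop (√ρ * √δ * ζ) ε * (2 / Real.pi * (1344 * ε / L * 2))
        ≤ 4 * ε * (2 / 3 * (1344 * ε / L * 2)) := by
      gcongr
      exact drop_le_right _ _
    have h3 : 32 * ε * (1344 * ε / L) * (T + 1) + 4 * ε * (2 / 3 * (1344 * ε / L * 2))
        ≤ Δ / 2 := by
      have h4 : 32 * ε * (1344 * ε / L) * (T + 1) + 4 * ε * (2 / 3 * (1344 * ε / L * 2))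
          = (43008 * (T + 1) + 7168) * ε ^ 2 / L := by field_simp; ring
      rw [h4, div_le_iff₀ hL]
      have h5 := hQ.length_le
      have h6 : 0 ≤ (T : ℝ) * ε ^ 2 := by positivity
      linarith
    have hΔ : 0 ≤ Δ := by
      refine nonneg_of_mul_nonneg_right (a := L) ?_ hL
      exact (sq_nonneg _).trans hQ.slope_le
    simp only [stairDesign]
    linarith)
  refine ⟨Design.problem hreg r, erasingMean (ρ * δ), ?_, ?_, ?_, ?_, ?_, hr, ?_, hB r⟩
  · change (1 - δ) * n ≤ ((Finset.univ : Finset (Fin n)).card : ℝ)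
    rw [Finset.card_univ, Fintype.card_fin]
    nlinarith [Nat.cast_nonneg (α := ℝ) n, hQ.δ_nonneg]
  · refine hreg.inFunctionClass (M := L / 2) (half_pos hL) le_rfl (half_pos hL).le le_rfl hθ ?_
      hlow ?_ (sum_tilt_sq hQ.two_le ζ).le
    · intro z z'
      refine (norm_rescaleGrad_sub_le hG.le hl norm_stairGrad_sub_le z z').trans (le_of_eq ?_)
      congr 1
      field_simp
      norm_num
    · have h1 : drop (√ρ * √δ * ζ) ε / (2 / Real.pi * (1344 * ε / L * 2)) ≤ L / 4 := by
        rw [div_le_iff₀ (by positivity)]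
        refine (drop_le_right _ _).trans ?_
        have h2 : L / 4 * (2 / Real.pi * (1344 * ε / L * 2)) = 1344 * ε / Real.pi := by
          field_simp; ring
        rw [h2, le_div_iff₀ (by positivity)]
        nlinarith
      simp only [stairDesign]
      linarith
  · refine hreg.inOracleClass fun z => ?_
    -- `192 = 32 * 6`, with 6 from `norm_maskGrad_le`.
    have h1 : ‖rescaleGrad (32 * ε) (1344 * ε / L) (maskGrad T) z‖ ^ 2 ≤ (192 * ε) ^ 2 := by
      refine pow_le_pow_left₀ (norm_nonneg _) ?_ 2
      rw [rescaleGrad, norm_smul, Real.norm_of_nonneg hG.le]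
      have := norm_maskGrad_le ((1344 * ε / L)⁻¹ • z)
      nlinarith
    have h2 : 0 ≤ ω ^ 2 * (N : ℝ) := by positivity
    have h3 := mul_le_mul_of_nonneg_left h1 h2
    simp only [stairDesign]
    linarith
  · exact isRobustAggregator_erasingMean hQ.ρ_nonneg hQ.δ_nonneg hQ.δ_le hQ.δmax_lt
  · exact hreg.isNonConvex (not_convexOn_rescale hG hl not_convexOn_stair)
  · refine le_trans (ENNReal.ofReal_le_ofReal ?_) hQ.hard.le_byzantineError
    have := drop_le_left (√ρ * √δ * ζ) ε
    simp only [stairDesign]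
    linarith

lemma StairParams.hard_chain (hQ : StairParams n T δmax δ ρ ζ L Δ ε) (hα : 0 < αmin) :
    NonConvexHard n δmax δ ρ σ ζ L Δ ε αmin (T + 1) :=
  hQ.nonConvexHard (N := 0) (v := 0) (ω := 0) (by simp; positivity)
    fun _ M => hQ.hard.le_queryComplexity_chain hα M

lemma StairParams.hard_noise (hQ : StairParams n T δmax δ ρ ζ L Δ ε) (hα : 0 < αmin) {K : ℕ}
    (hK : 0 < K) (hK' : 4 * K * (32 * ε) ^ 2 ≤ ρ * δ * σ ^ 2) :
    NonConvexHard n δmax δ ρ σ ζ L Δ ε αmin ((T + 1) * K) := by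
  refine hQ.nonConvexHard (N := 2 * ((T + 1) * K)) (v := σ) (ω := 0) (by simp)
    fun _ M => hQ.hard.le_queryComplexity_noise hα M rfl hK hK' (by omega) ?_
  intro i z hz
  have hG : 0 < 32 * ε := by linarith [hQ.ε_pos]
  have h1 := stairGrad_of_mem_initial (Submodule.smul_mem _ (1344 * ε / L)⁻¹ hz) le_rfl
  have h2 := gate_nonneg (lft 1 ((1344 * ε / L)⁻¹ • z) i)
  have h3 := gate_le_one (lft 1 ((1344 * ε / L)⁻¹ • z) i)
  simp only [stairDesign, rescaleGrad, PiLp.smul_apply, smul_eq_mul, h1]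
  rw [abs_mul (32 * ε), abs_of_pos hG, abs_mul, abs_neg,
    abs_of_pos (by norm_num : (0 : ℝ) < 1 / 2), abs_of_nonneg h2]
  nlinarith

lemma StairParams.hard_switch (hQ : StairParams n T δmax δ ρ ζ L Δ ε) (hα : 0 < αmin) {N : ℕ}
    (hN : N * (192 * ε) ^ 2 ≤ σ ^ 2) :
    NonConvexHard n δmax δ ρ σ ζ L Δ ε αmin ((T + 1) * (N + 1) / (2 * n)) :=
  hQ.nonConvexHard (N := N) (v := 0) (ω := 1) (by simpa using hN)
    fun _ M => hQ.hard.le_queryComplexity_switch hα M rfl fun _ _ hz => sub_rescaleGrad_mem hz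

lemma nonConvex_case {n : ℕ} {δmax δ ρ σ ζ L Δ ε αmin : ℝ} (hn : 2 ≤ n) (hδ : 0 ≤ δ)
    (hδm : δ ≤ δmax) (hδmax : δmax < 1 / 2) (hρ : 0 ≤ ρ) (hζ : 0 ≤ ζ) (hL : 0 < L) (hε : 0 < ε)
    (hα : 0 < αmin) (hεΔ : ε ^ 2 ≤ 1 / 10 ^ 11 * (L * Δ))
    (hx : ρ * δ * ζ ^ 2 ≤ 1 / 10 ^ 11 * (L * Δ)) :
    NonConvexHard n δmax δ ρ σ ζ L Δ ε αmin
      (1 / 10 ^ 11 * (L * Δ * ρ * δ * σ ^ 2 / ε ^ 4 + L * Δ * σ ^ 2 / ((1 - δ) * n * ε ^ 4)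
        + L * Δ / ε ^ 2)) := by
  -- `y` is the chain length that the gap allows; `u` and `w` below count the samples per coordinate
  -- that noise and mask can hide.
  set y := L * Δ / (100352 * ε ^ 2) with hy
  have hLΔ : 0 < L * Δ := by
    have : 0 < ε ^ 2 := by positivity
    linarith
  have hy1 : 1 ≤ y := by
    rw [hy, le_div_iff₀ (by positivity)]
    linarith
  obtain ⟨T, hT⟩ : ∃ T : ℕ, ⌊y⌋₊ = T + 1 :=
    Nat.exists_eq_add_of_le' ((Nat.one_le_floor_iff y).2 hy1)
  have hTy : (T : ℝ) + 1 ≤ y := by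
    have := Nat.floor_le (zero_le_one.trans hy1)
    rw [hT] at this
    exact_mod_cast this
  have hyT : y / 2 ≤ (T : ℝ) + 1 := by
    have := half_le_floor hy1
    rw [hT] at this
    exact_mod_cast this
  have hQ : StairParams n T δmax δ ρ ζ L Δ ε := by
    refine ⟨hn, hδ, hδm, hδmax, hρ, hζ, hL, hε, ?_, ?_⟩
    · rw [mul_pow, mul_pow, Real.sq_sqrt hρ, Real.sq_sqrt hδ]
      linarith
    · have h1 : y * (100352 * ε ^ 2) = L * Δ := by rw [hy]; field_simp
      have h2 := mul_le_mul_of_nonneg_right hTy (by positivity : 0 ≤ 100352 * ε ^ 2)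
      linarith
  set u := ρ * δ * σ ^ 2 / (4096 * ε ^ 2) with hu
  set w := σ ^ 2 / (36864 * ε ^ 2) with hw
  have hu0 : 0 ≤ u := by positivity
  have hw0 : 0 ≤ w := by positivity
  have hδ1 : 0 < 1 - δ := by linarith
  have ht₁ : L * Δ * ρ * δ * σ ^ 2 / ε ^ 4 = 100352 * 4096 * (y * u) := by
    rw [hy, hu]; field_simp
  have ht₂ : L * Δ * σ ^ 2 / ((1 - δ) * n * ε ^ 4)
      = 100352 * 36864 * (y * w / ((1 - δ) * n)) := by
    rw [hy, hw]; field_simp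
  have ht₃ : L * Δ / ε ^ 2 = 100352 * y := by
    rw [hy]; field_simp
  have hyu : 0 ≤ y * u := by positivity
  have hyw : 0 ≤ y * w / (2 * n) := by positivity
  have h₂ := inv_card_le (n := n) (mul_nonneg (zero_le_one.trans hy1) hw0)
    (hδm.trans_lt hδmax) hn
  rw [ht₁, ht₂, ht₃]
  -- The second case dictates the constant: `3 * 4 * 100352 * 36864 ≤ 10 ^ 11 / 2`.
  rcases max_cases_three (100352 * 4096 * (y * u))
    (100352 * 36864 * (y * w / ((1 - δ) * n))) (100352 * y) with h | h | h
  · rcases lt_or_ge u 1 with hu1 | hu1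
    · refine (hQ.hard_chain hα).mono ?_
      have : y * u ≤ y := by nlinarith
      linarith
    · refine (hQ.hard_noise hα (K := ⌊u⌋₊) (Nat.floor_pos.2 hu1) ?_).mono ?_
      · have h1 := Nat.floor_le hu0
        calc 4 * (⌊u⌋₊ : ℝ) * (32 * ε) ^ 2 ≤ 4 * u * (32 * ε) ^ 2 := by gcongr
          _ = ρ * δ * σ ^ 2 := by rw [hu]; field_simp; ring
      · have h1 : y / 2 * (u / 2) ≤ ((T : ℝ) + 1) * ⌊u⌋₊ :=
          mul_le_mul hyT (half_le_floor hu1) (by positivity) (by positivity)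
        linarith
  · refine (hQ.hard_switch hα (N := ⌊w⌋₊) ?_).mono ?_
    · have h1 := Nat.floor_le hw0
      calc (⌊w⌋₊ : ℝ) * (192 * ε) ^ 2 ≤ w * (192 * ε) ^ 2 := by gcongr
        _ = σ ^ 2 := by rw [hw]; field_simp; ring
    · have h1 : y / 2 * w ≤ ((T : ℝ) + 1) * (⌊w⌋₊ + 1) :=
        mul_le_mul hyT (Nat.lt_floor_add_one w).le hw0 (by positivity)
      have h2 : y * w / (2 * n) / 2 ≤ ((T : ℝ) + 1) * (⌊w⌋₊ + 1) / (2 * n) := by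
        have h3 : y * w / (2 * n) / 2 = y / 2 * w / (2 * n) := by ring
        rw [h3]
        gcongr
      linarith
  · refine (hQ.hard_chain hα).mono ?_
    linarith

end NonConvex

end ByzOpt

end

theorem theorem1 :
    -- the strongly convex case
    (∀ κ₀ : ℝ, 1 < κ₀ → ∃ c : ℝ, 0 < c ∧
      ∀ (n : ℕ) (δmax δ ρ σ ζ L μ R ε αmin : ℝ),
        2 ≤ n → 0 ≤ δ → δ ≤ δmax → δmax < 1 / 2 → 0 ≤ ρ → 0 ≤ σ → 0 ≤ ζ →
        0 < μ → κ₀ * μ ≤ L → 0 < ε → 0 < αmin →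
        ε ≤ c * (L * R) → √ρ * √δ * ζ ≤ c * (L * R) →
        ∃ (P : ByzOpt.Problem n) (A : (Fin n → ByzOpt.Vec P.d) → ByzOpt.Vec P.d),
          (1 - δ) * n ≤ P.H.card ∧ P.InFunctionClass L ζ ∧ P.InOracleClass σ ∧
          ByzOpt.IsRobustAggregator δmax ρ δ P.H A ∧
          P.IsStronglyConvex μ ∧ P.HasInitialDistance R ∧
          ENNReal.ofReal (c * (√ρ * √δ * ζ)) ≤ ByzOpt.byzantineError P A αmin ∧
          ∀ M : ByzOpt.MethodRun P A αmin,
            ENNReal.ofReal (c * (ρ * δ * σ ^ 2 / ε ^ 2 + σ ^ 2 / ((1 - δ) * n * ε ^ 2)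
                + √(L / μ) * Real.log (μ * R / ε)))
              ≤ M.queryComplexity (ByzOpt.byzantineError P A αmin + ENNReal.ofReal ε)) ∧
    -- the non-convex case
    (∃ c : ℝ, 0 < c ∧
      ∀ (n : ℕ) (δmax δ ρ σ ζ L Δ ε αmin : ℝ),
        2 ≤ n → 0 ≤ δ → δ ≤ δmax → δmax < 1 / 2 → 0 ≤ ρ → 0 ≤ σ → 0 ≤ ζ →
        0 < L → 0 < ε → 0 < αmin →
        ε ^ 2 ≤ c * (L * Δ) → ρ * δ * ζ ^ 2 ≤ c * (L * Δ) →
        ∃ (P : ByzOpt.Problem n) (A : (Fin n → ByzOpt.Vec P.d) → ByzOpt.Vec P.d),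
          (1 - δ) * n ≤ P.H.card ∧ P.InFunctionClass L ζ ∧ P.InOracleClass σ ∧
          ByzOpt.IsRobustAggregator δmax ρ δ P.H A ∧
          P.IsNonConvex ∧ P.HasInitialGap Δ ∧
          ENNReal.ofReal (c * (√ρ * √δ * ζ)) ≤ ByzOpt.byzantineError P A αmin ∧
          ∀ M : ByzOpt.MethodRun P A αmin,
            ENNReal.ofReal (c * (L * Δ * ρ * δ * σ ^ 2 / ε ^ 4
                + L * Δ * σ ^ 2 / ((1 - δ) * n * ε ^ 4) + L * Δ / ε ^ 2))
              ≤ M.queryComplexity (ByzOpt.byzantineError P A αmin + ENNReal.ofReal ε)) := by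
  refine ⟨fun κ₀ hκ₀ => ?_, 1 / 10 ^ 11, by norm_num, ?_⟩
  · obtain ⟨c, hc0, hc1, h⟩ := ByzOpt.stronglyConvex_case hκ₀
    refine ⟨c, hc0, fun n δmax δ ρ σ ζ L μ R ε αmin
      hn hδ hδm hδmax hρ _ hζ hμ hL hε hα hεR hx => ?_⟩
    obtain ⟨P, A, h1, h2, h3, h4, h5, h6, h7, h8⟩ :=
      h n δmax δ ρ σ ζ L μ R ε αmin hn hδ hδm hδmax hρ hζ hμ hL hε hα hεR hx
    refine ⟨P, A, h1, h2, h3, h4, h5, h6, le_trans (ENNReal.ofReal_le_ofReal ?_) h7, h8⟩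
    gcongr
  · intro n δmax δ ρ σ ζ L Δ ε αmin hn hδ hδm hδmax hρ _ hζ hL hε hα hεΔ hx
    obtain ⟨P, A, h1, h2, h3, h4, h5, h6, h7, h8⟩ :=
      ByzOpt.nonConvex_case hn hδ hδm hδmax hρ hζ hL hε hα hεΔ hx
    refine ⟨P, A, h1, h2, h3, h4, h5, h6, le_trans (ENNReal.ofReal_le_ofReal ?_) h7, h8⟩
    gcongr
    norm_num
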